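/- Let $\Bbbk$ be a commutative unital ring. **Multicyclically ordered sets.** A multicyclically ordered set $\mathsf S=C_1\cup\dots\cup C_b$ is a finite set $S$ decomposed into $b\ge 1$ possibly empty parts $C_i$, each equipped with a total cyclic order. An isomorphism is a bijection of the underlying sets together with a compatible bijection of the sets of parts, preserving the cyclic orders. A pair $(\mathsf S,g)$ with $g\in\mathbb N$ is *geometric* if $\frac12(g-b+1)\in\mathbb N$. Merging $\mathsf S'$ and $\mathsf S''$ at $u\in S'$, $v\in S''$ removes $u,v$ and joins the parts $[a_1\cdots a_k\,u]$ and $[v\,b_1\cdots b_l]$ containing them into $[a_1\cdots a_k b_1\cdots b_l]$. Gluing $u\ne v$ in one $\mathsf S$ does the same if $u,v$ lie in different parts; if they lie in the same part $[u\,x_1\cdots x_k\,v\,y_1\cdots y_l]$, this part is replaced by the two parts $[x_1\cdots x_k]$ and $[y_1\cdots y_l]$. **Operads.** A non-$\Sigma$ modular operad $P$ in a symmetric monoidal category consists of objects $P(\mathsf S;g)$, functorial with respect to isomorphisms of $\mathsf S$, of compositions ${}_u\circ_v:P(\mathsf S';g')\otimes P(\mathsf S'';g'')\to P(\mathsf T;g'+g'')$,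 where $\mathsf T$ is the merging of $\mathsf S'$ and $\mathsf S''$ at $u,v$, and of contractions $\xi_{uv}=\xi_{vu}:P(\mathsf S;g)\to P(\mathsf U;g+1)$, where $\mathsf U$ is obtained from $\mathsf S$ by gluing $u\neq v$, satisfying the usual axioms of modular operads (symmetry and associativity of the compositions, interchange of compositions and contractions, and equivariance). It is geometric if $P(\mathsf S;g)$ is an initial object whenever $(\mathsf S,g)$ is not geometric; ${\tt NsModOp}$ denotes the category of geometric non-$\Sigma$ modular operads. Replacing multicyclically ordered sets by plain finite sets one gets modular operads (category ${\tt ModOp}$). Using only compositions, and no genus, and cyclically ordered finite sets (those with $b=1$), respectively plain finite sets, one gets non-$\Sigma$ cyclic operads (${\tt NsCycOp}$), respectively cyclic operads (${\tt CycOp}$). Let $\underline\Box:{\tt NsModOp}\to{\tt NsCycOp}$ be the forgetful functor $P\mapsto\{P(C;0)\}$, let $\Box:{\tt ModOp}\to{\tt CycOp}$ be the forgetful functor $P\mapsto\{P(S;0)\}$, and let ${\rm Des}$ be the functor from modular operads to non-$\Sigma$ modular operads given by ${\rm Des}(P)(\mathsf S;g)=P(S;g)$, where $S$ is the underlying set of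 $\mathsf S$. The modular envelopes $\underline{\rm Mod}$ and ${\rm Mod}$ and the symmetrization ${\rm Sym}$ are the left adjoints of $\underline\Box$, $\Box$ and ${\rm Des}$; their value at an object $c$ is an object $d$ with a universal morphism from $c$ to the image of $d$. Let $\underline *_C$ be the non-$\Sigma$ cyclic operad in the category of sets with a one-point set at every cyclically ordered finite set, and let $\underline *_M$ be the geometric non-$\Sigma$ modular operad in the category of sets with a one-point set at every geometric $(\mathsf S,g)$ and the empty set at every other pair. Let $\underline{\mathcal Ass}={\rm Span}(\underline *_C)$ be the non-$\Sigma$ cyclic operad of $\Bbbk$-modules for associative algebras, and let $\mathcal Ass$ be the cyclic operad of $\Bbbk$-modules for associative algebras, whose component at $S$ is the span of the total cyclic orders on $S$ (with cyclic orders composed by merging). **Theorem.** 1. $\underline *_C$ and $\underline *_M$ are the terminal objects of the categories of non-$\Sigma$ cyclic operads and of geometric non-$\Sigma$ modular operads in the category of sets. 2. The non-$\Sigma$ modular envelope of $\underline{\mathcal Ass}$ exists and is the $\Bbbk$-linear span of $\underline *_M$: $$\underline{\rm Mod}(\underline{\mathcal Ass})\cong{\rm Span}(\underline *_M).$$ Explicitly,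 $\underline{\rm Mod}(\underline{\mathcal Ass})(\mathsf S;g)=0$ if $(\mathsf S,g)$ is not geometric, and there are isomorphisms $\underline{\rm Mod}(\underline{\mathcal Ass})(\mathsf S;g)\cong\Bbbk$ for all geometric $(\mathsf S,g)$ under which all isomorphisms of multicyclically ordered sets and all contractions act as the identity of $\Bbbk$ and all compositions of geometric components are the canonical isomorphism $\Bbbk\otimes\Bbbk\cong\Bbbk$. 3. Let $Q$ be the modular operad for which $Q(S;g)$ is the span of the multicyclic orders on $S$, taken up to relabelling of the parts, that are geometric with $g$, with structure operations given by transport of orders, merging and gluing. Then $Q$ is the symmetrization ${\rm Sym}({\rm Span}(\underline *_M))$, and $Q$ is the modular envelope of $\mathcal Ass$. In particular $${\rm Mod}(\mathcal Ass)\cong{\rm Sym}\big({\rm Span}(\underline *_M)\big).$$ -/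

import Mathlib

open CategoryTheory MonoidalCategory
noncomputable section

set_option linter.unusedVariables false
namespace ModEnv
open Equiv
open scoped Classical

section Perm
variable {α β : Type}

/-- Remove the point `a` from its cycle. -/
def skip (f : Perm α) (a : α) : Perm α := swap a (f a) * f

theorem skip_apply (f : Perm α) (a x : α) :
    skip f a x = if x = a then a else if f x = a then f a else f x := by
  unfold skip
  rw [Perm.mul_apply, swap_apply_def]
  by_cases hx : x = a
  · subst hx; by_cases h : f x = x <;> simp [h]
  · have : f x ≠ f a := fun h => hx (f.injective h)
    simp [hx, this]

theorem skip_self (f : Perm α) (a : α) : skip f a a = a := by simp [skip_apply]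

theorem skip_fix (f : Perm α) {a b : α} (h : f b = b) : skip f a b = b := by
  rw [skip_apply]; split_ifs <;> simp_all

theorem skip_comm (f : Perm α) (a b : α) : skip (skip f a) b = skip (skip f b) a := by
  ext x
  have h1 : ∀ y z, f y = f z → y = z := fun y z h => f.injective h
  simp only [skip_apply]
  grind

/-- The permutation `f` composed with the transposition of `u` and `v`: the element following `u`
becomes the one that followed `v`, and vice versa. -/
def glue (f : Perm α) (u v : α) : Perm α := f * swap u v

theorem glue_apply (f : Perm α) (u v x : α) :
    glue f u v x = if x = u then f v else if x = v then f u else f x := by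
  unfold glue
  rw [Perm.mul_apply, swap_apply_def]
  split_ifs <;> rfl

theorem glue_symm (f : Perm α) (u v : α) : glue f u v = glue f v u := by
  unfold glue; rw [swap_comm]

theorem glue_glue (f : Perm α) (u v : α) : glue (glue f u v) u v = f := by
  ext x; simp only [glue_apply]; grind

theorem skip_glue (f : Perm α) {a c d : α} (hc : a ≠ c) (hd : a ≠ d) :
    glue (skip f a) c d = skip (glue f c d) a := by
  ext x
  have h1 : ∀ y z, f y = f z → y = z := fun y z h => f.injective h
  simp only [skip_apply, glue_apply]
  grind

theorem glue_comm (f : Perm α) {a b c d : α} (hac : a ≠ c) (had : a ≠ d) (hbc : b ≠ c)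
    (hbd : b ≠ d) : glue (glue f a b) c d = glue (glue f c d) a b := by
  ext x
  simp only [glue_apply]
  grind

/-- A step of `f` stays in the same class. -/
theorem sameCycle_of_step {f : Perm α} {r : Setoid α} (h : ∀ x, r x (f x)) {x y : α}
    (hxy : f.SameCycle x y) : r x y := by
  obtain ⟨n, rfl⟩ := hxy
  induction n using Int.induction_on with
  | zero => exact r.refl _
  | succ n ih =>
    rw [add_comm, zpow_add, zpow_one, Perm.mul_apply]
    exact r.trans ih (h _)
  | pred n ih =>
    refine r.trans ih (r.symm ?_)
    have := h ((f ^ (-(n : ℤ) - 1)) x)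
    rwa [← Perm.mul_apply, ← zpow_one_add, add_sub_cancel] at this

theorem sameCycle_skip (f : Perm α) {a x y : α} (hx : x ≠ a) (hy : y ≠ a) :
    (skip f a).SameCycle x y ↔ f.SameCycle x y := by
  constructor
  · refine sameCycle_of_step (r := Perm.SameCycle.setoid f) (fun z => ?_)
    change f.SameCycle z (skip f a z)
    rw [skip_apply]
    split_ifs with h1 h2
    · exact h1 ▸ Perm.SameCycle.rfl
    · rw [← h2, Perm.sameCycle_apply_right, Perm.sameCycle_apply_right]
    · rw [Perm.sameCycle_apply_right]
  · intro h
    let c : α → α := fun z => if z = a then f a else z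
    have := sameCycle_of_step (f := f) (r := (Perm.SameCycle.setoid (skip f a)).comap c)
      (fun z => by
        change (skip f a).SameCycle (c z) (c (f z))
        by_cases hz : z = a
        · subst hz
          by_cases h2 : f z = z
          · simp [c, h2, Perm.SameCycle.refl]
          · simp [c, Perm.SameCycle.refl]
        · have e : c (f z) = skip f a (c z) := by simp [c, hz, skip_apply]
          rw [e, Perm.sameCycle_apply_right]) h
    change (skip f a).SameCycle (c x) (c y) at this
    simpa [c, hx, hy] using this

/-- The permutation of `α ∖ {u, v}` obtained from `f` by gluing `u` with `v`: what came before `u`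
is now followed by what came after `v`, and vice versa. -/
def cutPerm (f : Perm α) (u v : α) : Perm {x : α // x ≠ u ∧ x ≠ v} :=
  (skip (skip (glue f u v) u) v).subtypePerm (fun x => by
    have hv := skip_self (skip (glue f u v) u) v
    have hu : skip (skip (glue f u v) u) v u = u := skip_fix _ (skip_self _ _)
    generalize skip (skip (glue f u v) u) v = g at hu hv
    constructor
    · rintro ⟨h1, h2⟩; exact ⟨fun h => h1 (by rw [h, hu]), fun h => h2 (by rw [h, hv])⟩
    · rintro ⟨h1, h2⟩
      exact ⟨fun h => h1 (g.injective (h.trans hu.symm)), fun h => h2 (g.injective (h.trans hv.symm))⟩)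

theorem coe_cutPerm (f : Perm α) (u v : α) (x : {x : α // x ≠ u ∧ x ≠ v}) :
    (cutPerm f u v x : α) = skip (skip (glue f u v) u) v x := rfl

theorem sameCycle_cutPerm (f : Perm α) (u v : α) (x y : {x : α // x ≠ u ∧ x ≠ v}) :
    (cutPerm f u v).SameCycle x y ↔ (glue f u v).SameCycle (x : α) y := by
  unfold cutPerm
  rw [Perm.sameCycle_subtypePerm, sameCycle_skip _ x.2.2 y.2.2, sameCycle_skip _ x.2.1 y.2.1]

/-- The set of cycles of a permutation, fixed points included. -/
abbrev Orb (f : Perm α) : Type := Quotient (Perm.SameCycle.setoid f)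

theorem orb_eq {f : Perm α} {x y : α} : (Quotient.mk _ x : Orb f) = Quotient.mk _ y ↔ f.SameCycle x y :=
  Quotient.eq (r := Perm.SameCycle.setoid f)

theorem sameCycle_semiconj {f : Perm α} {g : Perm β} (e : α ≃ β) (h : ∀ x, e (f x) = g (e x))
    (x y : α) : f.SameCycle x y ↔ g.SameCycle (e x) (e y) := by
  constructor
  · exact sameCycle_of_step (r := (Perm.SameCycle.setoid g).comap e)
      (fun z => by change g.SameCycle _ _; rw [h, Perm.sameCycle_apply_right])
  · intro hh
    have := sameCycle_of_step (f := g) (r := (Perm.SameCycle.setoid f).comap e.symm)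
      (fun z => by
        change f.SameCycle _ _
        have : e.symm (g z) = f (e.symm z) := by rw [symm_apply_eq, h]; simp
        rw [this, Perm.sameCycle_apply_right]) hh
    change f.SameCycle _ _ at this
    simpa using this

theorem sameCycle_glue {f : Perm α} {c d y : α}
    (h : ∀ z, f.SameCycle y z → z ≠ c ∧ z ≠ d) (z : α) (hz : (glue f c d).SameCycle y z) :
    f.SameCycle y z := by
  have key : ∀ w, f.SameCycle y w ↔ f.SameCycle y ((glue f c d) w) := by
    intro w
    rw [glue_apply]
    split_ifs with h1 h2
    · subst h1
      exact ⟨fun hw => ((h _ hw).1 rfl).elim,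
        fun hw => ((h _ (Perm.sameCycle_apply_right.1 hw)).2 rfl).elim⟩
    · subst h2
      exact ⟨fun hw => ((h _ hw).2 rfl).elim,
        fun hw => ((h _ (Perm.sameCycle_apply_right.1 hw)).1 rfl).elim⟩
    · rw [Perm.sameCycle_apply_right]
  have := sameCycle_of_step (f := glue f c d) (r := Setoid.comap (fun w => f.SameCycle y w) ⊥)
      (fun w => by change _ = _; exact propext (key w)) hz
  have this : f.SameCycle y y = f.SameCycle y z := this
  exact this ▸ Perm.SameCycle.rfl

theorem sameCycle_sumCongr {f : Perm α} {g : Perm β} (z w : α ⊕ β) :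
    (Perm.sumCongr f g).SameCycle z w ↔
      (Sum.map (Quotient.mk _) (Quotient.mk _) z : Orb f ⊕ Orb g) =
        Sum.map (Quotient.mk _) (Quotient.mk _) w := by
  constructor
  · refine sameCycle_of_step (r := Setoid.comap
      (fun z => (Sum.map (Quotient.mk _) (Quotient.mk _) z : Orb f ⊕ Orb g)) ⊥) (fun z => ?_)
    change (Sum.map (Quotient.mk _) (Quotient.mk _) z : Orb f ⊕ Orb g) = Sum.map _ _ _
    rcases z with x | y
    · refine congrArg Sum.inl (orb_eq.2 ?_)
      rw [Perm.sameCycle_apply_right]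
    · refine congrArg Sum.inr (orb_eq.2 ?_)
      rw [Perm.sameCycle_apply_right]
  · rcases z with x | y <;> rcases w with x' | y' <;> intro h
    · exact sameCycle_of_step (r := (Perm.SameCycle.setoid (Perm.sumCongr f g)).comap Sum.inl)
        (fun x => by
          change (Perm.sumCongr f g).SameCycle (Sum.inl x) (Perm.sumCongr f g (Sum.inl x))
          rw [Perm.sameCycle_apply_right]) (orb_eq.1 (Sum.inl_injective h))
    · cases h
    · cases h
    · exact sameCycle_of_step (r := (Perm.SameCycle.setoid (Perm.sumCongr f g)).comap Sum.inr)
        (fun x => by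
          change (Perm.sumCongr f g).SameCycle (Sum.inr x) (Perm.sumCongr f g (Sum.inr x))
          rw [Perm.sameCycle_apply_right]) (orb_eq.1 (Sum.inr_injective h))

theorem glue_sumCongr (f : Perm α) (g : Perm β) (c d : α) :
    glue (Perm.sumCongr f g) (Sum.inl c) (Sum.inl d) = Perm.sumCongr (glue f c d) g := by
  ext z
  rcases z with x | y
  · simp only [glue_apply, Perm.sumCongr_apply, Sum.map_inl, Sum.inl.injEq]
    split_ifs <;> rfl
  · simp [glue_apply]

theorem skip_sumCongr (f : Perm α) (g : Perm β) (c : α) :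
    skip (Perm.sumCongr f g) (Sum.inl c) = Perm.sumCongr (skip f c) g := by
  ext z
  rcases z with x | y
  · simp only [skip_apply, Perm.sumCongr_apply, Sum.map_inl, Sum.inl.injEq]
    split_ifs <;> rfl
  · simp [skip_apply]

theorem skip_lift {p : α → Prop} {f : Perm α} {g : Perm {x // p x}} (h : ∀ x, (g x : α) = f x)
    (a x : {x // p x}) : (skip g a x : α) = skip f a x := by
  simp only [skip_apply, ← h, Subtype.ext_iff]
  split_ifs <;> simp_all

theorem glue_lift {p : α → Prop} {f : Perm α} {g : Perm {x // p x}} (h : ∀ x, (g x : α) = f x)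
    (c d x : {x // p x}) : (glue g c d x : α) = glue f c d x := by
  simp only [glue_apply, ← h, Subtype.ext_iff]
  split_ifs <;> rfl

theorem sameCycle_lift {p : α → Prop} {f : Perm α} {g : Perm {x // p x}}
    (h : ∀ x, (g x : α) = f x) (x y : {x // p x}) : g.SameCycle x y ↔ f.SameCycle x y := by
  have hp : ∀ x, p (f x) ↔ p x := by
    intro x
    constructor
    · intro hx
      have h2 := h (g.symm ⟨f x, hx⟩)
      rw [apply_symm_apply] at h2
      rw [f.injective h2]
      exact Subtype.property _
    · intro hx
      have h2 := h ⟨x, hx⟩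
      rw [← h2]
      exact Subtype.property _
  have : g = f.subtypePerm hp := by
    ext x; exact h x
  rw [this, Perm.sameCycle_subtypePerm]

theorem skip_semiconj {f : Perm α} {g : Perm β} (e : α ≃ β) (h : ∀ x, e (f x) = g (e x))
    (a x : α) : e (skip f a x) = skip g (e a) (e x) := by
  simp only [skip_apply, ← h, e.injective.eq_iff]
  split_ifs <;> rfl

theorem glue_semiconj {f : Perm α} {g : Perm β} (e : α ≃ β) (h : ∀ x, e (f x) = g (e x))
    (c d x : α) : e (glue f c d x) = glue g (e c) (e d) (e x) := by
  simp only [glue_apply, ← h, e.injective.eq_iff]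
  split_ifs <;> rfl

theorem glue_cutPerm (f : Perm α) {a b : α} (c d x : {x : α // x ≠ a ∧ x ≠ b}) :
    (glue (cutPerm f a b) c d x : α) = skip (skip (glue (glue f a b) c d) a) b x := by
  rw [glue_lift (coe_cutPerm f a b), skip_glue _ c.2.2.symm d.2.2.symm,
    skip_glue _ c.2.1.symm d.2.1.symm]

theorem coe_cutPerm_cutPerm (f : Perm α) {a b : α} (c d : {x : α // x ≠ a ∧ x ≠ b}) (x) :
    ((cutPerm (cutPerm f a b) c d x).1.1 : α) =
      skip (skip (skip (skip (glue (glue f a b) c d) a) b) c) d x.1.1 :=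
  skip_lift (skip_lift (glue_cutPerm f c d) c) d x.1

theorem sameCycle_glue_cutPerm (f : Perm α) {a b : α} (c d x y : {x : α // x ≠ a ∧ x ≠ b}) :
    (glue (cutPerm f a b) c d).SameCycle x y ↔ (glue (glue f a b) c d).SameCycle (x : α) y := by
  rw [sameCycle_lift (glue_cutPerm f c d), sameCycle_skip _ x.2.2 y.2.2,
    sameCycle_skip _ x.2.1 y.2.1]

end Perm

section Carriers
variable {α β : Type}

def cutEquiv (e : α ≃ β) {u v : α} {u' v' : β} (hu : e u = u') (hv : e v = v') :
    {x : α // x ≠ u ∧ x ≠ v} ≃ {y : β // y ≠ u' ∧ y ≠ v'} :=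
  e.subtypeEquiv (fun x => by subst hu hv; simp)

def cutSwapEquiv (u v : α) : {x : α // x ≠ u ∧ x ≠ v} ≃ {x : α // x ≠ v ∧ x ≠ u} :=
  Equiv.subtypeEquivRight (fun _ => and_comm)

def cutCommEquiv {a b c d : α} (hac : a ≠ c) (had : a ≠ d) (hbc : b ≠ c) (hbd : b ≠ d) :
    {x : {x : α // x ≠ a ∧ x ≠ b} // x ≠ ⟨c, hac.symm, hbc.symm⟩ ∧ x ≠ ⟨d, had.symm, hbd.symm⟩} ≃
      {x : {x : α // x ≠ c ∧ x ≠ d} // x ≠ ⟨a, hac, had⟩ ∧ x ≠ ⟨b, hbc, hbd⟩} where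
  toFun x := ⟨⟨x.1.1, fun h => x.2.1 (Subtype.ext h), fun h => x.2.2 (Subtype.ext h)⟩,
    fun h => x.1.2.1 (congrArg Subtype.val h), fun h => x.1.2.2 (congrArg Subtype.val h)⟩
  invFun x := ⟨⟨x.1.1, fun h => x.2.1 (Subtype.ext h), fun h => x.2.2 (Subtype.ext h)⟩,
    fun h => x.1.2.1 (congrArg Subtype.val h), fun h => x.1.2.2 (congrArg Subtype.val h)⟩
  left_inv _ := rfl
  right_inv _ := rfl

def cutSumEquiv (c d : α) (β : Type) :
    {z : α ⊕ β // z ≠ Sum.inl c ∧ z ≠ Sum.inl d} ≃ {x : α // x ≠ c ∧ x ≠ d} ⊕ β where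
  toFun z := match z with
    | ⟨.inl x, h⟩ => .inl ⟨x, fun e => h.1 (congrArg _ e), fun e => h.2 (congrArg _ e)⟩
    | ⟨.inr y, _⟩ => .inr y
  invFun z := match z with
    | .inl x => ⟨.inl x.1, fun e => x.2.1 (Sum.inl_injective e), fun e => x.2.2 (Sum.inl_injective e)⟩
    | .inr y => ⟨.inr y, Sum.inr_ne_inl, Sum.inr_ne_inl⟩
  left_inv z := by rcases z with ⟨x | y, h⟩ <;> rfl
  right_inv z := by rcases z with x | y <;> rfl

end Carriers

/-- A (finite) multicyclically ordered set: a finite set decomposed into a positive finite number of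
possibly empty parts, each of them totally cyclically ordered. The total cyclic orders of the parts
are encoded by their successor maps: `next` is a permutation whose cycles are exactly the nonempty
parts. -/
structure MultCyc where
  carrier : Type
  index : Type
  [finite_carrier : Finite carrier]
  [finite_index : Finite index]
  [nonempty_index : Nonempty index]
  part : carrier → index
  next : Perm carrier
  sameCycle_iff : ∀ x y, next.SameCycle x y ↔ part x = part y

attribute [instance] MultCyc.finite_carrier MultCyc.finite_index MultCyc.nonempty_index

namespace MultCyc

/-- Isomorphisms of multicyclically ordered sets: a bijection of the underlying sets and a bijection
of the sets of parts, compatible with each other and with the cyclic orders. -/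
@[ext]
structure Hom (X Y : MultCyc) where
  toEquiv : X.carrier ≃ Y.carrier
  indexEquiv : X.index ≃ Y.index
  part_eq : ∀ x, Y.part (toEquiv x) = indexEquiv (X.part x)
  next_eq : ∀ x, toEquiv (X.next x) = Y.next (toEquiv x)

instance : Category MultCyc where
  Hom := Hom
  id X := ⟨Equiv.refl _, Equiv.refl _, fun _ => rfl, fun _ => rfl⟩
  comp f g := ⟨f.toEquiv.trans g.toEquiv, f.indexEquiv.trans g.indexEquiv,
    fun x => by simp [g.part_eq, f.part_eq], fun x => by simp [g.next_eq, f.next_eq]⟩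

def inv {X Y : MultCyc} (f : X ⟶ Y) : Y ⟶ X :=
  ⟨f.toEquiv.symm, f.indexEquiv.symm,
    fun y => by rw [eq_comm, symm_apply_eq, ← f.part_eq, apply_symm_apply],
    fun y => by rw [symm_apply_eq, f.next_eq, apply_symm_apply]⟩

/-- The parts of `X` that are empty. -/
abbrev Empties (X : MultCyc) : Type := {i : X.index // ∀ x, X.part x ≠ i}

/-- The disjoint union. -/
abbrev sum (X Y : MultCyc) : MultCyc where
  carrier := X.carrier ⊕ Y.carrier
  index := X.index ⊕ Y.index
  part := Sum.map X.part Y.part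
  next := Perm.sumCongr X.next Y.next
  sameCycle_iff z w := by
    rw [sameCycle_sumCongr]
    rcases z with x | y <;> rcases w with x' | y' <;> simp [X.sameCycle_iff, Y.sameCycle_iff, orb_eq]

/-- Gluing two elements `u` and `v` (meant to be distinct) of a multicyclically ordered set.

Both are removed. The last element before `u` is then followed by the first one after `v`, and the
last element before `v` is followed by the first one after `u`. The parts containing neither `u` nor
`v` are unaffected. If `u` and `v` lie in different parts, then these two parts are merged into one
(the cyclic order of the parts represented by `a₁ < ⋯ < aₖ < u` and `v < b₁ < ⋯ < bₗ` is merged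
into the one represented by `a₁ < ⋯ < aₖ < b₁ < ⋯ < bₗ`). If they lie in the same part, then this
part is split into the two open intervals between `u` and `v`. In both cases the resulting parts, some
of which may be empty, are the cycles of the permutation `glue next u v`, with `u` and `v` removed. -/
abbrev cut (X : MultCyc) (u v : X.carrier) : MultCyc where
  carrier := {x : X.carrier // x ≠ u ∧ x ≠ v}
  index := X.Empties ⊕ Orb (glue X.next u v)
  nonempty_index := ⟨Sum.inr (Quotient.mk _ u)⟩
  part x := Sum.inr (Quotient.mk _ x.1)
  next := cutPerm X.next u v
  sameCycle_iff x y := by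
    rw [sameCycle_cutPerm, Sum.inr.injEq, orb_eq]

theorem part_surj_or {X : MultCyc} (i : X.index) : (∃ x, X.part x = i) ∨ ∀ x, X.part x ≠ i := by
  by_cases h : ∃ x, X.part x = i
  · exact .inl h
  · exact .inr (fun x hx => h ⟨x, hx⟩)

/-- An isomorphism restricts to the sets obtained by gluing. -/
def cutMap {X Y : MultCyc} (f : X ⟶ Y) {u v : X.carrier} {u' v' : Y.carrier}
    (hu : f.toEquiv u = u') (hv : f.toEquiv v = v') : X.cut u v ⟶ Y.cut u' v' where
  toEquiv := cutEquiv f.toEquiv hu hv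
  indexEquiv := Equiv.sumCongr
    (f.indexEquiv.subtypeEquiv (fun i => by
      constructor
      · intro h y hy
        apply h (f.toEquiv.symm y)
        apply f.indexEquiv.injective
        rw [← hy, ← f.part_eq, apply_symm_apply]
      · intro h x hx
        exact h (f.toEquiv x) (by rw [f.part_eq, hx])))
    (Quotient.congr f.toEquiv (fun x y => by
      subst hu hv
      exact sameCycle_semiconj _ (glue_semiconj _ f.next_eq _ _) x y))
  part_eq x := rfl
  next_eq x := by
    subst hu hv
    apply Subtype.ext
    exact skip_semiconj _ (skip_semiconj _ (glue_semiconj _ f.next_eq _ _) _) _ _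

def cutSwap (X : MultCyc) (u v : X.carrier) : X.cut u v ⟶ X.cut v u where
  toEquiv := cutSwapEquiv u v
  indexEquiv := Equiv.sumCongr (Equiv.refl _) (Quotient.congr (Equiv.refl _) (fun x y => by
    change (glue X.next u v).SameCycle x y ↔ (glue X.next v u).SameCycle x y
    rw [glue_symm]))
  part_eq x := rfl
  next_eq x := by
    apply Subtype.ext
    change skip (skip (glue X.next u v) u) v x.1 = skip (skip (glue X.next v u) v) u x.1
    rw [glue_symm, skip_comm]

section cutComm
variable {X : MultCyc} {a b c d : X.carrier} (hac : a ≠ c) (had : a ≠ d) (hbc : b ≠ c) (hbd : b ≠ d)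

/-- The parts after two gluings are the parts unaffected by them, and the cycles of the permutation
obtained from both gluings at once. -/
def cutcutIndex : ((X.cut a b).cut ⟨c, hac.symm, hbc.symm⟩ ⟨d, had.symm, hbd.symm⟩).index →
    X.Empties ⊕ Orb (glue (glue X.next a b) c d)
  | .inl ⟨.inl e, _⟩ => .inl e
  | .inl ⟨.inr q, _⟩ => .inr (Quotient.mk _ q.out)
  | .inr q => .inr (Quotient.map Subtype.val
      (fun x y h => (sameCycle_glue_cutPerm _ _ _ x y).1 h) q)

theorem cutcutIndex_bijective : Function.Bijective (cutcutIndex hac had hbc hbd) := by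
  have avoid : ∀ q : Orb (glue X.next a b),
      (∀ x : (X.cut a b).carrier, (X.cut a b).part x ≠ Sum.inr q) →
      ∀ z, (glue X.next a b).SameCycle q.out z → z = a ∨ z = b := by
    intro q h z hz
    by_contra hne
    rw [not_or] at hne
    refine h ⟨z, hne.1, hne.2⟩ (congrArg Sum.inr ?_)
    rw [← q.out_eq]
    exact orb_eq.2 hz.symm
  have avoid' : ∀ q : Orb (glue X.next a b),
      (∀ x : (X.cut a b).carrier, (X.cut a b).part x ≠ Sum.inr q) →
      ∀ z, (glue (glue X.next a b) c d).SameCycle q.out z → (glue X.next a b).SameCycle q.out z := by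
    intro q h
    refine sameCycle_glue (fun z hz => ?_)
    rcases avoid q h z hz with rfl | rfl
    exacts [⟨hac, had⟩, ⟨hbc, hbd⟩]
  constructor
  · rintro (⟨e | q, h⟩ | p) (⟨e' | q', h'⟩ | p') hh
    · cases hh; rfl
    · cases hh
    · cases hh
    · cases hh
    · have h1 := avoid' q h _ (orb_eq.1 (Sum.inr_injective hh))
      have h2 := orb_eq.2 h1
      rw [q.out_eq, q'.out_eq] at h2
      subst h2; rfl
    · induction p' using Quotient.inductionOn with | _ x =>
      have h1 := avoid' q h _ (orb_eq.1 (Sum.inr_injective hh))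
      rcases avoid q h _ h1 with h2 | h2
      exacts [(x.2.1 h2).elim, (x.2.2 h2).elim]
    · cases hh
    · induction p using Quotient.inductionOn with | _ x =>
      have h1 := avoid' q' h' _ (orb_eq.1 (Sum.inr_injective hh.symm))
      rcases avoid q' h' _ h1 with h2 | h2
      exacts [(x.2.1 h2).elim, (x.2.2 h2).elim]
    · induction p using Quotient.inductionOn with | _ x =>
      induction p' using Quotient.inductionOn with | _ x' =>
      exact congrArg Sum.inr (orb_eq.2 ((sameCycle_glue_cutPerm _ _ _ _ _).2
        (orb_eq.1 (Sum.inr_injective hh))))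
  · rintro (e | p)
    · exact ⟨.inl ⟨.inl e, fun x hx => by cases hx⟩, rfl⟩
    · induction p using Quotient.inductionOn with | _ y =>
      by_cases hy : ∃ x, (glue (glue X.next a b) c d).SameCycle y x ∧ x ≠ a ∧ x ≠ b
      · obtain ⟨x, hx, hx'⟩ := hy
        exact ⟨.inr (Quotient.mk _ ⟨x, hx'⟩), congrArg Sum.inr (orb_eq.2 hx.symm)⟩
      · push Not at hy
        have hF : glue (glue (glue X.next a b) c d) c d = glue X.next a b := by
          ext x; simp only [glue_apply]; grind
        have h1 : ∀ z, (glue X.next a b).SameCycle y z →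
            (glue (glue X.next a b) c d).SameCycle y z := by
          rw [← hF]
          rw [hF]
          intro z hz
          rw [← hF] at hz
          refine sameCycle_glue (fun w hw => ?_) z hz
          have := hy w hw
          by_cases hwa : w = a
          · subst hwa; exact ⟨hac, had⟩
          · obtain rfl := this hwa; exact ⟨hbc, hbd⟩
        refine ⟨.inl ⟨.inr (Quotient.mk _ y), fun x hx => ?_⟩, congrArg Sum.inr (orb_eq.2 ?_)⟩
        · exact x.2.2 (hy _ (h1 _ (orb_eq.1 (Sum.inr_injective hx).symm)) x.2.1)
        · exact (h1 _ (orb_eq.1 (Quotient.out_eq _).symm)).symm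

/-- Two gluings at disjoint pairs of elements may be interchanged. -/
def cutComm : (X.cut a b).cut ⟨c, hac.symm, hbc.symm⟩ ⟨d, had.symm, hbd.symm⟩ ⟶
    (X.cut c d).cut ⟨a, hac, had⟩ ⟨b, hbc, hbd⟩ where
  toEquiv := cutCommEquiv hac had hbc hbd
  indexEquiv := (Equiv.ofBijective _ (cutcutIndex_bijective hac had hbc hbd)).trans
    ((Equiv.sumCongr (Equiv.refl _) (Quotient.congr (Equiv.refl _) (fun x y => by
      change (glue (glue X.next a b) c d).SameCycle x y ↔
        (glue (glue X.next c d) a b).SameCycle x y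
      rw [glue_comm _ hac had hbc hbd]))).trans
    (Equiv.ofBijective _ (cutcutIndex_bijective hac.symm hbc.symm had.symm hbd.symm)).symm)
  part_eq x := by
    rw [eq_comm, trans_apply, trans_apply, symm_apply_eq]
    rfl
  next_eq x := by
    apply Subtype.ext
    apply Subtype.ext
    refine (coe_cutPerm_cutPerm _ _ _ x).trans ?_
    refine Eq.trans ?_ (coe_cutPerm_cutPerm _ _ _ _).symm
    rw [glue_comm _ hac had hbc hbd]
    generalize glue (glue X.next c d) a b = g
    rw [skip_comm (skip g a) b c, skip_comm g a c, skip_comm (skip (skip g c) a) b d,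
      skip_comm (skip g c) a d]
    rfl

end cutComm

/-- Gluing two elements of `X` commutes with the disjoint union with `Y`. -/
def cutSumIndex (X Y : MultCyc) (c d : X.carrier) :
    ((X.sum Y).cut (Sum.inl c) (Sum.inl d)).index → ((X.cut c d).sum Y).index
  | .inl ⟨.inl i, h⟩ => .inl (.inl ⟨i, fun x hx => h (.inl x) (congrArg Sum.inl hx)⟩)
  | .inl ⟨.inr j, _⟩ => .inr j
  | .inr q => Quotient.lift (fun z : X.carrier ⊕ Y.carrier => match z with
      | .inl x => (.inl (.inr (Quotient.mk _ x)) : (X.Empties ⊕ Orb (glue X.next c d)) ⊕ Y.index)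
      | .inr y => .inr (Y.part y)) (fun z w h => by
        change (glue (Perm.sumCongr X.next Y.next) _ _).SameCycle z w at h
        rw [glue_sumCongr, sameCycle_sumCongr] at h
        rcases z with x | y <;> rcases w with x' | y'
        · exact congrArg (fun q => Sum.inl (Sum.inr q)) (Sum.inl_injective h)
        · cases h
        · cases h
        · exact congrArg Sum.inr ((Y.sameCycle_iff _ _).1 (orb_eq.1 (Sum.inr_injective h)))) q

theorem cutSumIndex_bijective (X Y : MultCyc) (c d : X.carrier) :
    Function.Bijective (cutSumIndex X Y c d) := by
  constructor
  · rintro (⟨i | j, h⟩ | p) (⟨i' | j', h'⟩ | p') hh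
    · cases hh; rfl
    · cases hh
    · induction p' using Quotient.inductionOn with | _ z => rcases z with x | y <;> cases hh
    · cases hh
    · cases hh; rfl
    · induction p' using Quotient.inductionOn with | _ z =>
      rcases z with x | y
      · cases hh
      · exact (h (.inr y) (congrArg Sum.inr (Sum.inr_injective hh.symm))).elim
    · induction p using Quotient.inductionOn with | _ z => rcases z with x | y <;> cases hh
    · induction p using Quotient.inductionOn with | _ z =>
      rcases z with x | y
      · cases hh
      · exact (h' (.inr y) (congrArg Sum.inr (Sum.inr_injective hh))).elim
    · induction p using Quotient.inductionOn with | _ z =>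
      induction p' using Quotient.inductionOn with | _ w =>
      refine congrArg Sum.inr (orb_eq.2 ?_)
      change (glue (Perm.sumCongr X.next Y.next) _ _).SameCycle z w
      rw [glue_sumCongr, sameCycle_sumCongr]
      rcases z with x | y <;> rcases w with x' | y'
      · exact congrArg Sum.inl (Sum.inr_injective (Sum.inl_injective hh))
      · cases hh
      · cases hh
      · exact congrArg Sum.inr (orb_eq.2 ((Y.sameCycle_iff _ _).2 (Sum.inr_injective hh)))
  · rintro ((⟨i, h⟩ | q) | j)
    · exact ⟨.inl ⟨.inl i, by
        rintro (x | y) hx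
        · exact h x (Sum.inl_injective hx)
        · cases hx⟩, rfl⟩
    · induction q using Quotient.inductionOn with | _ x =>
      exact ⟨.inr (Quotient.mk _ (.inl x)), rfl⟩
    · rcases part_surj_or j with ⟨y, rfl⟩ | h
      · exact ⟨.inr (Quotient.mk _ (.inr y)), rfl⟩
      · exact ⟨.inl ⟨.inr j, by
          rintro (x | y) hx
          · cases hx
          · exact h y (Sum.inr_injective hx)⟩, rfl⟩

def cutSum (X Y : MultCyc) (c d : X.carrier) :
    (X.sum Y).cut (Sum.inl c) (Sum.inl d) ⟶ (X.cut c d).sum Y where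
  toEquiv := cutSumEquiv c d Y.carrier
  indexEquiv := Equiv.ofBijective _ (cutSumIndex_bijective X Y c d)
  part_eq z := by rcases z with ⟨x | y, h⟩ <;> rfl
  next_eq z := by
    have key : ∀ w : (X.cut c d).carrier ⊕ Y.carrier,
        (((X.sum Y).cut (Sum.inl c) (Sum.inl d)).next ((cutSumEquiv c d Y.carrier).symm w)) =
          (cutSumEquiv c d Y.carrier).symm (((X.cut c d).sum Y).next w) := by
      intro w
      apply Subtype.ext
      change skip (skip (glue (Perm.sumCongr X.next Y.next) _ _) _) _ _ = _
      rw [glue_sumCongr, skip_sumCongr, skip_sumCongr]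
      rcases w with x | y <;> rfl
    obtain ⟨w, rfl⟩ := (cutSumEquiv c d Y.carrier).symm.surjective z
    change cutSumEquiv c d Y.carrier _ = _
    rw [key]
    simp only [apply_symm_apply]

def sumMap {X X' Y Y' : MultCyc} (f : X ⟶ X') (g : Y ⟶ Y') : X.sum Y ⟶ X'.sum Y' where
  toEquiv := Equiv.sumCongr f.toEquiv g.toEquiv
  indexEquiv := Equiv.sumCongr f.indexEquiv g.indexEquiv
  part_eq z := by
    rcases z with x | y
    exacts [congrArg Sum.inl (f.part_eq x), congrArg Sum.inr (g.part_eq y)]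
  next_eq z := by
    rcases z with x | y
    exacts [congrArg Sum.inl (f.next_eq x), congrArg Sum.inr (g.next_eq y)]

def sumSwap (X Y : MultCyc) : X.sum Y ⟶ Y.sum X where
  toEquiv := Equiv.sumComm _ _
  indexEquiv := Equiv.sumComm _ _
  part_eq z := by rcases z with x | y <;> rfl
  next_eq z := by rcases z with x | y <;> rfl

def sumAssoc (X Y Z : MultCyc) : X.sum (Y.sum Z) ⟶ (X.sum Y).sum Z where
  toEquiv := (Equiv.sumAssoc _ _ _).symm
  indexEquiv := (Equiv.sumAssoc _ _ _).symm
  part_eq z := by rcases z with x | y | z <;> rfl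
  next_eq z := by rcases z with x | y | z <;> rfl

/-- The merging of two multicyclically ordered sets at `u` and `v`: the result of gluing `u` with `v`
in the disjoint union. -/
abbrev merge (X Y : MultCyc) (u : X.carrier) (v : Y.carrier) : MultCyc :=
  (X.sum Y).cut (Sum.inl u) (Sum.inr v)

/-- The canonical isomorphism between iterated mergings. -/
def mergeAssoc (X Y Z : MultCyc) (a : X.carrier) (b c : Y.carrier) (d : Z.carrier) (h : b ≠ c) :
    X.merge (Y.merge Z c d) a ⟨Sum.inl b, Sum.inl_injective.ne h, Sum.inl_ne_inr⟩ ⟶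
      (X.merge Y a b).merge Z ⟨Sum.inr c, Sum.inr_ne_inl, Sum.inr_injective.ne h.symm⟩ d :=
  have h1 : (Sum.inr (Sum.inl c) : X.carrier ⊕ (Y.carrier ⊕ Z.carrier)) ≠ Sum.inl a := Sum.inr_ne_inl
  have h2 : (Sum.inr (Sum.inl c) : X.carrier ⊕ (Y.carrier ⊕ Z.carrier)) ≠ Sum.inr (Sum.inl b) :=
    fun e => h (Sum.inl_injective (Sum.inr_injective e)).symm
  have h3 : (Sum.inr (Sum.inr d) : X.carrier ⊕ (Y.carrier ⊕ Z.carrier)) ≠ Sum.inl a := Sum.inr_ne_inl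
  have h4 : (Sum.inr (Sum.inr d) : X.carrier ⊕ (Y.carrier ⊕ Z.carrier)) ≠ Sum.inr (Sum.inl b) :=
    fun e => Sum.inr_ne_inl (Sum.inr_injective e)
  cutMap (u' := ⟨Sum.inl a, h1.symm, h3.symm⟩) (v' := ⟨Sum.inr (Sum.inl b), h2.symm, h4.symm⟩)
    (sumSwap _ _ ≫ inv (cutSum (Y.sum Z) X (Sum.inl c) (Sum.inr d)) ≫
      cutMap (sumSwap (Y.sum Z) X) rfl rfl) rfl rfl ≫
  cutComm (X := X.sum (Y.sum Z)) h1 h2 h3 h4 ≫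
  cutMap (cutMap (sumAssoc X Y Z) rfl rfl) rfl rfl ≫
  cutMap (cutSum (X.sum Y) Z (Sum.inl a) (Sum.inr b)) rfl rfl

end MultCyc

section Count
variable {α : Type} [Finite α]

theorem sameCycle_glue_of_not {f : Perm α} {u v : α} (h : ¬ f.SameCycle u v) :
    (glue f u v).SameCycle v u := by
  by_contra hc
  have key : ∀ n : ℕ, (glue f u v).SameCycle v ((f ^ (n + 1)) u) := by
    intro n
    induction n with
    | zero =>
      have : f u = glue f u v v := by rw [glue_apply]; grind
      rw [zero_add, pow_one, this, Perm.sameCycle_apply_right]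
    | succ n ih =>
      have h1 : (f ^ (n + 1)) u ≠ u := fun e => hc (by rwa [e] at ih)
      have h2 : (f ^ (n + 1)) u ≠ v := fun e => h ⟨(n + 1 : ℕ), by rw [zpow_natCast]; exact e⟩
      have : (f ^ (n + 1 + 1)) u = glue f u v ((f ^ (n + 1)) u) := by
        rw [glue_apply, if_neg h1, if_neg h2, pow_succ', Perm.mul_apply]
      rwa [this, Perm.sameCycle_apply_right]
  obtain ⟨n, hn, hn'⟩ := isOfFinOrder_iff_pow_eq_one.1 (isOfFinOrder_of_finite f)
  have := key (n - 1)
  rw [Nat.sub_add_cancel hn, hn', Perm.one_apply] at this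
  exact hc this

theorem card_orb_glue {f : Perm α} {u v : α} (h : ¬ f.SameCycle u v) :
    Nat.card (Orb (glue f u v)) + 1 = Nat.card (Orb f) := by
  have hg := sameCycle_glue_of_not h
  have step : ∀ x, (glue f u v).SameCycle x (f x) := by
    intro x
    by_cases hu : x = u
    · subst hu
      have : f x = glue f x v v := by rw [glue_apply]; grind
      rw [this, Perm.sameCycle_apply_right]
      exact hg.symm
    · by_cases hv : x = v
      · subst hv
        have : f x = glue f u x u := by rw [glue_apply]; grind
        rw [this, Perm.sameCycle_apply_right]
        exact hg
      · have : f x = glue f u v x := by rw [glue_apply]; grind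
        rw [this, Perm.sameCycle_apply_right]
  let π : {q : Orb f // q ≠ Quotient.mk _ v} → Orb (glue f u v) := fun q =>
    Quotient.map (sa := Perm.SameCycle.setoid f) (sb := Perm.SameCycle.setoid (glue f u v)) id
      (fun x y hxy => sameCycle_of_step (r := Perm.SameCycle.setoid (glue f u v)) step hxy) q.1
  let κ : Orb f → Orb f := fun q => if q = Quotient.mk _ v then Quotient.mk _ u else q
  have hκ : ∀ x y, (glue f u v).SameCycle x y →
      κ (Quotient.mk _ x) = κ (Quotient.mk _ y) := by
    intro x y
    refine sameCycle_of_step (r := Setoid.comap (fun x => κ (Quotient.mk _ x)) ⊥) (fun x => ?_)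
    change κ (Quotient.mk _ x) = κ (Quotient.mk _ (glue f u v x))
    have e : ∀ z, (Quotient.mk _ (f z) : Orb f) = Quotient.mk _ z := fun z =>
      orb_eq.2 (by rw [Perm.sameCycle_apply_left])
    rw [glue_apply]
    split_ifs with h1 h2
    · subst h1; rw [e]; simp only [κ]; split_ifs <;> simp_all
    · subst h2; rw [e]; simp only [κ]; split_ifs <;> simp_all
    · rw [e]
  have hπ : Function.Bijective π := by
    constructor
    · rintro ⟨q, hq⟩ ⟨q', hq'⟩ hh
      induction q using Quotient.inductionOn with | _ x =>
      induction q' using Quotient.inductionOn with | _ y =>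
      have := hκ x y (orb_eq.1 hh)
      simp only [κ, if_neg hq, if_neg hq'] at this
      exact Subtype.ext this
    · intro q
      induction q using Quotient.inductionOn with | _ x =>
      by_cases hx : f.SameCycle x v
      · refine ⟨⟨Quotient.mk _ u, fun e => h (orb_eq.1 e)⟩, orb_eq.2 ?_⟩
        exact (hg.symm.trans (sameCycle_of_step
          (r := Perm.SameCycle.setoid (glue f u v)) step hx.symm))
      · exact ⟨⟨Quotient.mk _ x, fun e => hx (orb_eq.1 e)⟩, rfl⟩
  rw [← Nat.card_congr (Equiv.ofBijective π hπ)]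
  have h1 := Nat.card_congr (Equiv.sumCompl (fun q : Orb f => q = Quotient.mk _ v))
  rw [Nat.card_sum, Nat.card_unique] at h1
  rw [← h1, add_comm]

theorem not_sameCycle_glue {f : Perm α} {u v : α} (h : f.SameCycle u v) (huv : u ≠ v) :
    ¬ (glue f u v).SameCycle u v := by
  have hex : ∃ n : ℕ, (f ^ n) u = v := h.exists_nat_pow_eq
  have hmin : ∀ m, m < Nat.find hex → (f ^ m) u ≠ v := fun m hm => Nat.find_min hex hm
  have hspec := Nat.find_spec hex
  generalize Nat.find hex = n at hmin hspec
  have hn : 0 < n := Nat.pos_of_ne_zero (fun e => huv (by simpa [e] using hspec))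
  have hne : ∀ i, 0 < i → i ≤ n → (f ^ i) u ≠ u := by
    intro i hi hin e
    refine hmin (n - i) (by omega) ?_
    have : (f ^ (n - i)) ((f ^ i) u) = v := by
      rw [← Perm.mul_apply, ← pow_add, Nat.sub_add_cancel hin, hspec]
    rwa [e] at this
  intro hc
  have key : ∀ x y, (glue f u v).SameCycle x y →
      ((∃ i, 0 < i ∧ i ≤ n ∧ (f ^ i) u = x) = (∃ i, 0 < i ∧ i ≤ n ∧ (f ^ i) u = y)) := by
    have fwd : ∀ x, (∃ i, 0 < i ∧ i ≤ n ∧ (f ^ i) u = x) →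
        (∃ i, 0 < i ∧ i ≤ n ∧ (f ^ i) u = glue f u v x) := by
      rintro x ⟨i, hi, hin, rfl⟩
      rcases hin.eq_or_lt with rfl | hlt
      · refine ⟨1, one_pos, hi, ?_⟩
        rw [hspec, glue_apply, if_neg huv.symm, if_pos rfl, pow_one]
      · refine ⟨i + 1, by omega, hlt, ?_⟩
        rw [glue_apply, if_neg (hne i hi hin), if_neg (hmin i hlt), pow_succ', Perm.mul_apply]
    have fwd' : ∀ (m : ℕ) x, (∃ i, 0 < i ∧ i ≤ n ∧ (f ^ i) u = x) →
        (∃ i, 0 < i ∧ i ≤ n ∧ (f ^ i) u = (glue f u v ^ m) x) := by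
      intro m
      induction m with
      | zero => intro x hx; simpa using hx
      | succ m ih => intro x hx; rw [pow_succ', Perm.mul_apply]; exact fwd _ (ih x hx)
    intro x y hxy
    obtain ⟨m, hm⟩ := hxy.exists_nat_pow_eq
    obtain ⟨m', hm'⟩ := hxy.symm.exists_nat_pow_eq
    exact propext ⟨fun hx => hm ▸ fwd' m x hx, fun hy => hm' ▸ fwd' m' y hy⟩
  have : ∃ i, 0 < i ∧ i ≤ n ∧ (f ^ i) u = u := by
    rw [key u v hc]; exact ⟨n, hn, le_rfl, hspec⟩
  obtain ⟨i, hi, hin, e⟩ := this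
  exact hne i hi hin e

end Count

namespace MultCyc

/-- The parts of `X` are the empty ones and the cycles of `X.next`. -/
def indexOfOrder (X : MultCyc) : X.Empties ⊕ Orb X.next → X.index
  | .inl e => e.1
  | .inr q => Quotient.lift (s := Perm.SameCycle.setoid X.next) X.part
      (fun x y h => (X.sameCycle_iff x y).1 h) q

theorem indexOfOrder_bijective (X : MultCyc) : Function.Bijective X.indexOfOrder := by
  constructor
  · rintro (⟨i, h⟩ | q) (⟨i', h'⟩ | q') hh
    · exact congrArg Sum.inl (Subtype.ext hh)
    · induction q' using Quotient.inductionOn with | _ x => exact (h x hh.symm).elim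
    · induction q using Quotient.inductionOn with | _ x => exact (h' x hh).elim
    · induction q using Quotient.inductionOn with | _ x =>
      induction q' using Quotient.inductionOn with | _ y =>
      exact congrArg Sum.inr (orb_eq.2 ((X.sameCycle_iff x y).2 hh))
  · intro i
    rcases part_surj_or i with ⟨x, rfl⟩ | h
    · exact ⟨.inr (Quotient.mk _ x), rfl⟩
    · exact ⟨.inl ⟨i, h⟩, rfl⟩

theorem card_index (X : MultCyc) :
    Nat.card X.Empties + Nat.card (Orb X.next) = Nat.card X.index := by
  rw [← Nat.card_sum]
  exact Nat.card_congr (Equiv.ofBijective _ X.indexOfOrder_bijective)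

theorem card_index_pos (X : MultCyc) : 0 < Nat.card X.index := Nat.card_pos

/-- Gluing elements of different parts merges these parts. -/
theorem card_cut_of_ne (X : MultCyc) {u v : X.carrier} (h : X.part u ≠ X.part v) :
    Nat.card (X.cut u v).index + 1 = Nat.card X.index := by
  rw [← X.card_index, ← card_orb_glue (f := X.next) (u := u) (v := v)
    (fun e => h ((X.sameCycle_iff u v).1 e)), ← add_assoc, ← Nat.card_sum]

/-- Gluing distinct elements of the same part splits this part. -/
theorem card_cut_of_eq (X : MultCyc) {u v : X.carrier} (huv : u ≠ v) (h : X.part u = X.part v) :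
    Nat.card (X.cut u v).index = Nat.card X.index + 1 := by
  have := card_orb_glue (not_sameCycle_glue ((X.sameCycle_iff u v).2 h) huv)
  rw [glue_glue] at this
  rw [← X.card_index, add_assoc, this, ← Nat.card_sum]

theorem card_merge (X Y : MultCyc) (u : X.carrier) (v : Y.carrier) :
    Nat.card (X.merge Y u v).index + 1 = Nat.card X.index + Nat.card Y.index := by
  rw [card_cut_of_ne (X.sum Y) (u := Sum.inl u) (v := Sum.inr v) Sum.inl_ne_inr, ← Nat.card_sum]

/-- `(X, g)` is geometric if `G = (g - b + 1) / 2` is a natural number, where `b` is the number of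
parts of `X`. -/
def IsGeometric (X : MultCyc) (g : ℕ) : Prop := ∃ G : ℕ, g + 1 = 2 * G + Nat.card X.index

theorem IsGeometric.of_iso {X Y : MultCyc} (f : X ⟶ Y) {g : ℕ} (h : X.IsGeometric g) :
    Y.IsGeometric g := by
  unfold IsGeometric
  rw [← Nat.card_congr f.indexEquiv]
  exact h

theorem IsGeometric.cut {X : MultCyc} {g : ℕ} (h : X.IsGeometric g) {u v : X.carrier}
    (huv : u ≠ v) : (X.cut u v).IsGeometric (g + 1) := by
  obtain ⟨G, hG⟩ := h
  by_cases e : X.part u = X.part v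
  · exact ⟨G, by rw [card_cut_of_eq X huv e]; omega⟩
  · exact ⟨G + 1, by have := card_cut_of_ne X e; omega⟩

theorem IsGeometric.merge {X Y : MultCyc} {g' g'' g : ℕ} (hX : X.IsGeometric g')
    (hY : Y.IsGeometric g'') (hg : g' + g'' = g) (u : X.carrier) (v : Y.carrier) :
    (X.merge Y u v).IsGeometric g := by
  obtain ⟨G, hG⟩ := hX
  obtain ⟨H, hH⟩ := hY
  exact ⟨G + H, by have := card_merge X Y u v; omega⟩

end MultCyc

/-- A finite set. -/
structure FinSet where
  carrier : Type
  [finite : Finite carrier]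

attribute [instance] FinSet.finite

namespace FinSet

/-- Finite sets and their bijections. -/
instance : Category FinSet where
  Hom X Y := X.carrier ≃ Y.carrier
  id X := Equiv.refl _
  comp f g := Equiv.trans f g

/-- The disjoint union. -/
abbrev sum (X Y : FinSet) : FinSet := ⟨X.carrier ⊕ Y.carrier⟩

/-- The set with two elements removed. -/
abbrev cut (X : FinSet) (u v : X.carrier) : FinSet := ⟨{x : X.carrier // x ≠ u ∧ x ≠ v}⟩

/-- The disjoint union with an element of each set removed. -/
abbrev merge (X Y : FinSet) (u : X.carrier) (v : Y.carrier) : FinSet :=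
  (X.sum Y).cut (Sum.inl u) (Sum.inr v)

/-- The canonical bijection between iterated mergings. -/
def mergeAssoc (X Y Z : FinSet) (a : X.carrier) (b c : Y.carrier) (d : Z.carrier) (h : b ≠ c) :
    X.merge (Y.merge Z c d) a ⟨Sum.inl b, Sum.inl_injective.ne h, Sum.inl_ne_inr⟩ ⟶
      (X.merge Y a b).merge Z ⟨Sum.inr c, Sum.inr_ne_inl, Sum.inr_injective.ne h.symm⟩ d :=
  have h1 : (Sum.inr (Sum.inl c) : X.carrier ⊕ (Y.carrier ⊕ Z.carrier)) ≠ Sum.inl a := Sum.inr_ne_inl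
  have h2 : (Sum.inr (Sum.inl c) : X.carrier ⊕ (Y.carrier ⊕ Z.carrier)) ≠ Sum.inr (Sum.inl b) :=
    fun e => h (Sum.inl_injective (Sum.inr_injective e)).symm
  have h3 : (Sum.inr (Sum.inr d) : X.carrier ⊕ (Y.carrier ⊕ Z.carrier)) ≠ Sum.inl a := Sum.inr_ne_inl
  have h4 : (Sum.inr (Sum.inr d) : X.carrier ⊕ (Y.carrier ⊕ Z.carrier)) ≠ Sum.inr (Sum.inl b) :=
    fun e => Sum.inr_ne_inl (Sum.inr_injective e)
  (cutEquiv (((Equiv.sumComm _ _).trans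
      (cutSumEquiv (Sum.inl c) (Sum.inr d) X.carrier).symm).trans
      (cutEquiv (Equiv.sumComm _ _) rfl rfl)) (u' := ⟨Sum.inl a, h1.symm, h3.symm⟩)
      (v' := ⟨Sum.inr (Sum.inl b), h2.symm, h4.symm⟩) rfl rfl).trans <|
    (cutCommEquiv h1 h2 h3 h4).trans <|
    (cutEquiv (cutEquiv (Equiv.sumAssoc X.carrier Y.carrier Z.carrier).symm rfl rfl) rfl rfl).trans <|
    cutEquiv (cutSumEquiv (Sum.inl a) (Sum.inr b) Z.carrier) rfl rfl

end FinSet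

/-- The bookkeeping needed to state the axioms of cyclic operads whose components are indexed by a
groupoid `G` of finite sets with additional structure: the underlying set `El X` of an object, the
merging `merge X Y u v` of two objects at elements `u` and `v` (its underlying set is
`El X ⊔ El Y ∖ {u, v}`), and the canonical isomorphisms between iterated mergings. -/
class MergeBase (G : Type*) [Category G] where
  El : G → Type
  act {X Y : G} : (X ⟶ Y) → El X → El Y
  merge (X Y : G) (u : El X) (v : El Y) : G
  left {X Y : G} {u : El X} {v : El Y} (x : El X) (h : x ≠ u) : El (merge X Y u v)
  right {X Y : G} {u : El X} {v : El Y} (y : El Y) (h : y ≠ v) : El (merge X Y u v)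
  mergeMap {X X' Y Y' : G} (f : X ⟶ X') (g : Y ⟶ Y') (u : El X) (v : El Y) :
    merge X Y u v ⟶ merge X' Y' (act f u) (act g v)
  mergeSwap (X Y : G) (u : El X) (v : El Y) : merge X Y u v ⟶ merge Y X v u
  mergeAssoc (X Y Z : G) (a : El X) (b c : El Y) (d : El Z) (h : b ≠ c) :
    merge X (merge Y Z c d) a (left b h) ⟶ merge (merge X Y a b) Z (right c h.symm) d

/-- The analogous bookkeeping for modular operads: in addition, the object `cut X u v` obtained by
gluing two elements `u ≠ v` of the same object `X` (its underlying set is `El X ∖ {u, v}`). -/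
class CutBase (G : Type*) [Category G] extends MergeBase G where
  cut (X : G) (u v : El X) : G
  keep {X : G} {u v : El X} (x : El X) (hu : x ≠ u) (hv : x ≠ v) : El (cut X u v)
  keep_ne {X : G} {u v : El X} {x y : El X} (hxu : x ≠ u) (hxv : x ≠ v) (hyu : y ≠ u) (hyv : y ≠ v) :
    x ≠ y → keep x hxu hxv ≠ keep y hyu hyv
  left_ne {X Y : G} {u : El X} {v : El Y} {x y : El X} (hx : x ≠ u) (hy : y ≠ u) :
    x ≠ y → (left x hx : El (merge X Y u v)) ≠ left y hy
  left_ne_right {X Y : G} {u : El X} {v : El Y} {x : El X} {y : El Y} (hx : x ≠ u) (hy : y ≠ v) :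
    (left x hx : El (merge X Y u v)) ≠ right y hy
  cutMap {X Y : G} (f : X ⟶ Y) (u v : El X) : cut X u v ⟶ cut Y (act f u) (act f v)
  cutSwap (X : G) (u v : El X) : cut X u v ⟶ cut X v u
  cutCut (X : G) (a b c d : El X) (hac : a ≠ c) (had : a ≠ d) (hbc : b ≠ c) (hbd : b ≠ d) :
    cut (cut X a b) (keep c hac.symm hbc.symm) (keep d had.symm hbd.symm) ⟶
      cut (cut X c d) (keep a hac had) (keep b hbc hbd)
  cutMerge (X Y : G) (a c : El X) (b d : El Y) (hac : a ≠ c) (hbd : b ≠ d) :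
    cut (merge X Y c d) (left a hac) (right b hbd) ⟶
      cut (merge X Y a b) (left c hac.symm) (right d hbd.symm)
  mergeCut (X Y : G) (a c d : El X) (b : El Y) (hac : a ≠ c) (had : a ≠ d) :
    merge (cut X c d) Y (keep a hac had) b ⟶ cut (merge X Y a b) (left c hac.symm) (left d had.symm)

section
variable {α β : Type}

theorem inl_ne_cut {c x : α} {e : β} (h : x ≠ c) :
    (Sum.inl x : α ⊕ β) ≠ Sum.inl c ∧ (Sum.inl x : α ⊕ β) ≠ Sum.inr e :=
  ⟨Sum.inl_injective.ne h, Sum.inl_ne_inr⟩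

theorem inr_ne_cut {c : α} {e y : β} (h : y ≠ e) :
    (Sum.inr y : α ⊕ β) ≠ Sum.inl c ∧ (Sum.inr y : α ⊕ β) ≠ Sum.inr e :=
  ⟨Sum.inr_ne_inl, Sum.inr_injective.ne h⟩

end

instance : CutBase FinSet where
  El X := X.carrier
  act f := f.toFun
  merge := FinSet.merge
  left x h := ⟨Sum.inl x, inl_ne_cut h⟩
  right y h := ⟨Sum.inr y, inr_ne_cut h⟩
  mergeMap f g u v := cutEquiv (Equiv.sumCongr f g) rfl rfl
  mergeSwap X Y u v := (cutEquiv (Equiv.sumComm _ _) rfl rfl).trans (cutSwapEquiv _ _)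
  mergeAssoc := FinSet.mergeAssoc
  cut := FinSet.cut
  keep x hu hv := ⟨x, hu, hv⟩
  keep_ne _ _ _ _ h e := h (congrArg Subtype.val e)
  left_ne _ _ h e := h (Sum.inl_injective (congrArg Subtype.val e))
  left_ne_right _ _ e := Sum.inl_ne_inr (congrArg Subtype.val e)
  cutMap f u v := cutEquiv f rfl rfl
  cutSwap X u v := cutSwapEquiv u v
  cutCut X a b c d hac had hbc hbd := cutCommEquiv hac had hbc hbd
  cutMerge X Y a c b d hac hbd := cutCommEquiv (Sum.inl_injective.ne hac.symm) Sum.inl_ne_inr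
    Sum.inr_ne_inl (Sum.inr_injective.ne hbd.symm)
  mergeCut X Y a c d b hac had :=
    (cutEquiv (cutSumEquiv c d Y.carrier).symm
      (u' := ⟨Sum.inl a, Sum.inl_injective.ne hac, Sum.inl_injective.ne had⟩)
      (v' := ⟨Sum.inr b, Sum.inr_ne_inl, Sum.inr_ne_inl⟩) rfl rfl).trans
    (cutCommEquiv (Sum.inl_injective.ne hac.symm) Sum.inl_ne_inr
      (Sum.inl_injective.ne had.symm) Sum.inl_ne_inr)

instance : CutBase MultCyc where
  El X := X.carrier
  act f := f.toEquiv
  merge := MultCyc.merge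
  left x h := ⟨Sum.inl x, inl_ne_cut h⟩
  right y h := ⟨Sum.inr y, inr_ne_cut h⟩
  mergeMap f g u v := MultCyc.cutMap (MultCyc.sumMap f g) rfl rfl
  mergeSwap X Y u v := MultCyc.cutMap (MultCyc.sumSwap X Y) rfl rfl ≫ MultCyc.cutSwap _ _ _
  mergeAssoc := MultCyc.mergeAssoc
  cut := MultCyc.cut
  keep x hu hv := ⟨x, hu, hv⟩
  keep_ne _ _ _ _ h e := h (congrArg Subtype.val e)
  left_ne _ _ h e := h (Sum.inl_injective (congrArg Subtype.val e))
  left_ne_right _ _ e := Sum.inl_ne_inr (congrArg Subtype.val e)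
  cutMap f u v := MultCyc.cutMap f rfl rfl
  cutSwap X u v := X.cutSwap u v
  cutCut X a b c d hac had hbc hbd := MultCyc.cutComm hac had hbc hbd
  cutMerge X Y a c b d hac hbd := MultCyc.cutComm (X := X.sum Y) (Sum.inl_injective.ne hac.symm)
    Sum.inl_ne_inr Sum.inr_ne_inl (Sum.inr_injective.ne hbd.symm)
  mergeCut X Y a c d b hac had :=
    MultCyc.cutMap (MultCyc.inv (MultCyc.cutSum X Y c d))
      (u' := ⟨Sum.inl a, Sum.inl_injective.ne hac, Sum.inl_injective.ne had⟩)
      (v' := ⟨Sum.inr b, Sum.inr_ne_inl, Sum.inr_ne_inl⟩) rfl rfl ≫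
    MultCyc.cutComm (X := X.sum Y) (Sum.inl_injective.ne hac.symm) Sum.inl_ne_inr
      (Sum.inl_injective.ne had.symm) Sum.inl_ne_inr

/-- Cyclically ordered finite sets: multicyclically ordered sets with exactly one part. -/
abbrev Cyc : Type 1 := ObjectProperty.FullSubcategory (fun X : MultCyc => Nat.card X.index = 1)

instance : MergeBase Cyc where
  El C := C.obj.carrier
  act f := f.hom.toEquiv
  merge C D u v := ⟨C.obj.merge D.obj u v, by
    have := MultCyc.card_merge C.obj D.obj u v
    rw [C.property, D.property] at this
    exact Nat.succ_injective this⟩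
  left x h := ⟨Sum.inl x, inl_ne_cut h⟩
  right y h := ⟨Sum.inr y, inr_ne_cut h⟩
  mergeMap f g u v := ObjectProperty.homMk (MergeBase.mergeMap f.hom g.hom u v)
  mergeSwap C D u v := ObjectProperty.homMk (MergeBase.mergeSwap C.obj D.obj u v)
  mergeAssoc C D E a b c d h := ObjectProperty.homMk (MergeBase.mergeAssoc C.obj D.obj E.obj a b c d h)

open MergeBase CutBase

/-- A cyclic operad with components indexed by `G` in the symmetric monoidal category `M`. -/
structure CyclicOperad (G : Type*) [Category G] [MergeBase G] (M : Type*) [Category M]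
    [MonoidalCategory M] [BraidedCategory M] where
  obj : G ⥤ M
  comp (X Y : G) (u : El X) (v : El Y) : obj.obj X ⊗ obj.obj Y ⟶ obj.obj (merge X Y u v)
  comp_swap (X Y : G) (u : El X) (v : El Y) :
    comp X Y u v ≫ obj.map (mergeSwap X Y u v) = (β_ _ _).hom ≫ comp Y X v u
  comp_assoc (X Y Z : G) (a : El X) (b c : El Y) (d : El Z) (h : b ≠ c) :
    obj.obj X ◁ comp Y Z c d ≫ comp X (merge Y Z c d) a (left b h) ≫
        obj.map (mergeAssoc X Y Z a b c d h) =
      (α_ _ _ _).inv ≫ comp X Y a b ▷ obj.obj Z ≫ comp (merge X Y a b) Z (right c h.symm) d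
  comp_natural {X X' Y Y' : G} (f : X ⟶ X') (g : Y ⟶ Y') (u : El X) (v : El Y) :
    comp X Y u v ≫ obj.map (mergeMap f g u v) =
      (obj.map f ⊗ₘ obj.map g) ≫ comp X' Y' (act f u) (act g v)

/-- A modular operad with components indexed by `G` in the symmetric monoidal category `M`. The
component of genus `g` at `X` is `(obj g).obj X`. -/
structure ModularOperad (G : Type*) [Category G] [CutBase G] (M : Type*) [Category M]
    [MonoidalCategory M] [BraidedCategory M] where
  obj : ℕ → G ⥤ M
  comp {g' g'' g : ℕ} (hg : g' + g'' = g) (X Y : G) (u : El X) (v : El Y) :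
    (obj g').obj X ⊗ (obj g'').obj Y ⟶ (obj g).obj (merge X Y u v)
  contr (g : ℕ) (X : G) {u v : El X} (h : u ≠ v) : (obj g).obj X ⟶ (obj (g + 1)).obj (cut X u v)
  contr_symm (g : ℕ) (X : G) {u v : El X} (h : u ≠ v) :
    contr g X h ≫ (obj (g + 1)).map (cutSwap X u v) = contr g X h.symm
  comp_swap {g' g'' g : ℕ} (hg : g' + g'' = g) (hg' : g'' + g' = g) (X Y : G) (u : El X) (v : El Y) :
    comp hg X Y u v ≫ (obj g).map (mergeSwap X Y u v) = (β_ _ _).hom ≫ comp hg' Y X v u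
  comp_assoc {g₁ g₂ g₃ g₁₂ g₂₃ g : ℕ} (h₁₂ : g₁ + g₂ = g₁₂) (h₂₃ : g₂ + g₃ = g₂₃)
      (hg : g₁ + g₂₃ = g) (hg' : g₁₂ + g₃ = g) (X Y Z : G) (a : El X) (b c : El Y) (d : El Z)
      (h : b ≠ c) :
    (obj g₁).obj X ◁ comp h₂₃ Y Z c d ≫ comp hg X (merge Y Z c d) a (left b h) ≫
        (obj g).map (mergeAssoc X Y Z a b c d h) =
      (α_ _ _ _).inv ≫ comp h₁₂ X Y a b ▷ (obj g₃).obj Z ≫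
        comp hg' (merge X Y a b) Z (right c h.symm) d
  contr_contr (g : ℕ) (X : G) {a b c d : El X} (hab : a ≠ b) (hcd : c ≠ d) (hac : a ≠ c) (had : a ≠ d)
      (hbc : b ≠ c) (hbd : b ≠ d) :
    contr g X hab ≫ contr (g + 1) (cut X a b) (keep_ne hac.symm hbc.symm had.symm hbd.symm hcd) ≫
        (obj (g + 1 + 1)).map (cutCut X a b c d hac had hbc hbd) =
      contr g X hcd ≫ contr (g + 1) (cut X c d) (keep_ne hac had hbc hbd hab)
  contr_comp {g' g'' g : ℕ} (hg : g' + g'' = g) (X Y : G) {a c : El X} {b d : El Y} (hac : a ≠ c)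
      (hbd : b ≠ d) :
    comp hg X Y c d ≫ contr g (merge X Y c d) (left_ne_right hac hbd) ≫
        (obj (g + 1)).map (cutMerge X Y a c b d hac hbd) =
      comp hg X Y a b ≫ contr g (merge X Y a b) (left_ne_right hac.symm hbd.symm)
  comp_contr {g' g'' g : ℕ} (hg : g' + g'' = g) (hg' : g' + 1 + g'' = g + 1) (X Y : G)
      {a c d : El X} (b : El Y) (hac : a ≠ c) (had : a ≠ d) (hcd : c ≠ d) :
    contr g' X hcd ▷ (obj g'').obj Y ≫ comp hg' (cut X c d) Y (keep a hac had) b ≫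
        (obj (g + 1)).map (mergeCut X Y a c d b hac had) =
      comp hg X Y a b ≫ contr g (merge X Y a b) (left_ne hac.symm had.symm hcd)
  comp_natural {g' g'' g : ℕ} (hg : g' + g'' = g) {X X' Y Y' : G} (f : X ⟶ X') (f' : Y ⟶ Y')
      (u : El X) (v : El Y) :
    comp hg X Y u v ≫ (obj g).map (mergeMap f f' u v) =
      ((obj g').map f ⊗ₘ (obj g'').map f') ≫ comp hg X' Y' (act f u) (act f' v)
  contr_natural (g : ℕ) {X Y : G} (f : X ⟶ Y) {u v : El X} (h : u ≠ v) (h' : act f u ≠ act f v) :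
    contr g X h ≫ (obj (g + 1)).map (cutMap f u v) = (obj g).map f ≫ contr g Y h'


namespace CyclicOperad

variable {G : Type*} [Category G] [MergeBase G] {M : Type*} [Category M] [MonoidalCategory M]
  [BraidedCategory M]

/-- Morphisms of cyclic operads. -/
@[ext]
structure Hom (P Q : CyclicOperad G M) where
  app : P.obj ⟶ Q.obj
  app_comp (X Y : G) (u : El X) (v : El Y) :
    P.comp X Y u v ≫ app.app (merge X Y u v) = (app.app X ⊗ₘ app.app Y) ≫ Q.comp X Y u v

instance : Category (CyclicOperad G M) where
  Hom := Hom
  id P := ⟨𝟙 _, fun X Y u v => by simp⟩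
  comp {P Q R} f g := ⟨f.app ≫ g.app, fun X Y u v => by
    rw [NatTrans.comp_app, ← Category.assoc, f.app_comp, Category.assoc, g.app_comp,
      NatTrans.comp_app, NatTrans.comp_app, ← MonoidalCategory.tensorHom_comp_tensorHom,
      Category.assoc]⟩

/-- The image of a cyclic operad under a lax symmetric monoidal functor. -/
def mapLax {N : Type*} [Category N] [MonoidalCategory N] [BraidedCategory N]
    (F : M ⥤ N) [F.LaxBraided] (P : CyclicOperad G M) : CyclicOperad G N where
  obj := P.obj ⋙ F
  comp X Y u v := Functor.LaxMonoidal.μ F _ _ ≫ F.map (P.comp X Y u v)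
  comp_swap X Y u v := by
    dsimp only [Functor.comp_obj, Functor.comp_map]
    rw [Category.assoc, ← F.map_comp, P.comp_swap, F.map_comp,
      ← Functor.LaxBraided.braided_assoc]
  comp_assoc X Y Z a b c d h := by
    dsimp only [Functor.comp_obj, Functor.comp_map]
    have := congrArg F.map (P.comp_assoc X Y Z a b c d h)
    simp only [F.map_comp] at this
    simp only [MonoidalCategory.whiskerLeft_comp, MonoidalCategory.comp_whiskerRight, Category.assoc,
      Functor.LaxMonoidal.μ_natural_right_assoc, Functor.LaxMonoidal.μ_natural_left_assoc, this]
    rw [Functor.LaxMonoidal.associativity_inv_assoc]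
  comp_natural {X X' Y Y'} f g u v := by
    dsimp only [Functor.comp_obj, Functor.comp_map]
    rw [Category.assoc, ← F.map_comp, P.comp_natural, F.map_comp,
      Functor.LaxMonoidal.μ_natural_assoc]

end CyclicOperad

namespace ModularOperad

variable {G : Type*} [Category G] [CutBase G] {M : Type*} [Category M] [MonoidalCategory M]
  [BraidedCategory M]

/-- Morphisms of modular operads. -/
@[ext]
structure Hom (P Q : ModularOperad G M) where
  app (g : ℕ) : P.obj g ⟶ Q.obj g
  app_comp {g' g'' g : ℕ} (hg : g' + g'' = g) (X Y : G) (u : El X) (v : El Y) :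
    P.comp hg X Y u v ≫ (app g).app (merge X Y u v) =
      ((app g').app X ⊗ₘ (app g'').app Y) ≫ Q.comp hg X Y u v
  app_contr (g : ℕ) (X : G) {u v : El X} (h : u ≠ v) :
    P.contr g X h ≫ (app (g + 1)).app (cut X u v) = (app g).app X ≫ Q.contr g X h

instance : Category (ModularOperad G M) where
  Hom := Hom
  id P := ⟨fun _ => 𝟙 _, fun _ X Y u v => by simp, fun g X u v h => by simp⟩
  comp {P Q R} f g := ⟨fun n => f.app n ≫ g.app n, fun hg X Y u v => by
    rw [NatTrans.comp_app, ← Category.assoc, f.app_comp, Category.assoc, g.app_comp,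
      NatTrans.comp_app, NatTrans.comp_app, ← MonoidalCategory.tensorHom_comp_tensorHom,
      Category.assoc], fun n X u v h => by
    rw [NatTrans.comp_app, ← Category.assoc, f.app_contr, Category.assoc, g.app_contr,
      NatTrans.comp_app, Category.assoc]⟩

/-- The image of a modular operad under a lax symmetric monoidal functor. -/
def mapLax {N : Type*} [Category N] [MonoidalCategory N] [BraidedCategory N]
    (F : M ⥤ N) [F.LaxBraided] (P : ModularOperad G M) : ModularOperad G N where
  obj g := P.obj g ⋙ F
  comp hg X Y u v := Functor.LaxMonoidal.μ F _ _ ≫ F.map (P.comp hg X Y u v)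
  contr g X u v h := F.map (P.contr g X h)
  contr_symm g X u v h := by
    dsimp only [Functor.comp_obj, Functor.comp_map]
    rw [← F.map_comp, P.contr_symm]
  comp_swap hg hg' X Y u v := by
    dsimp only [Functor.comp_obj, Functor.comp_map]
    rw [Category.assoc, ← F.map_comp, P.comp_swap hg hg', F.map_comp,
      ← Functor.LaxBraided.braided_assoc]
  comp_assoc h₁₂ h₂₃ hg hg' X Y Z a b c d h := by
    dsimp only [Functor.comp_obj, Functor.comp_map]
    have := congrArg F.map (P.comp_assoc h₁₂ h₂₃ hg hg' X Y Z a b c d h)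
    simp only [F.map_comp] at this
    simp only [MonoidalCategory.whiskerLeft_comp, MonoidalCategory.comp_whiskerRight, Category.assoc,
      Functor.LaxMonoidal.μ_natural_right_assoc, Functor.LaxMonoidal.μ_natural_left_assoc, this]
    rw [Functor.LaxMonoidal.associativity_inv_assoc]
  contr_contr g X a b c d hab hcd hac had hbc hbd := by
    dsimp only [Functor.comp_obj, Functor.comp_map]
    rw [← F.map_comp, ← F.map_comp, ← F.map_comp, P.contr_contr]
  contr_comp hg X Y a c b d hac hbd := by
    dsimp only [Functor.comp_obj, Functor.comp_map]
    rw [Category.assoc, Category.assoc, ← F.map_comp, ← F.map_comp, ← F.map_comp, P.contr_comp]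
  comp_contr hg hg' X Y a c d b hac had hcd := by
    dsimp only [Functor.comp_obj, Functor.comp_map]
    rw [Category.assoc, Category.assoc, ← F.map_comp, ← F.map_comp,
      ← P.comp_contr hg hg' X Y b hac had hcd, Functor.LaxMonoidal.μ_natural_left_assoc,
      F.map_comp, F.map_comp, F.map_comp]
  comp_natural hg X X' Y Y' f f' u v := by
    dsimp only [Functor.comp_obj, Functor.comp_map]
    rw [Category.assoc, ← F.map_comp, P.comp_natural, F.map_comp,
      Functor.LaxMonoidal.μ_natural_assoc]
  contr_natural g X Y f u v h h' := by
    dsimp only [Functor.comp_obj, Functor.comp_map]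
    rw [← F.map_comp, ← F.map_comp, P.contr_natural]

end ModularOperad

section Categories
variable (M : Type*) [Category M] [MonoidalCategory M] [BraidedCategory M]

/-- Non-Σ cyclic operads. -/
abbrev NsCycOp := CyclicOperad Cyc M

/-- Cyclic operads. -/
abbrev CycOp := CyclicOperad FinSet M

/-- Modular operads. -/
abbrev ModOp := ModularOperad FinSet M

variable {M} in
/-- A non-Σ modular operad is geometric if its components at non-geometric `(X, g)` are initial. -/
def IsGeometricOperad (P : ModularOperad MultCyc M) : Prop :=
  ∀ (g : ℕ) (X : MultCyc), ¬ X.IsGeometric g → Nonempty (Limits.IsInitial ((P.obj g).obj X))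

/-- (Geometric) non-Σ modular operads. -/
abbrev NsModOp := ObjectProperty.FullSubcategory (fun P : ModularOperad MultCyc M => IsGeometricOperad P)

/-- The forgetful functor from modular operads to cyclic operads: the part of genus `0`. -/
def box : ModOp M ⥤ CycOp M where
  obj P :=
    { obj := P.obj 0
      comp := P.comp (zero_add 0)
      comp_swap := P.comp_swap _ _
      comp_assoc := P.comp_assoc _ _ _ _
      comp_natural := P.comp_natural _ }
  map f := ⟨f.app 0, f.app_comp _⟩

/-- The forgetful functor from non-Σ modular operads to non-Σ cyclic operads: the components of
genus `0` at the multicyclically ordered sets with one part. -/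
def nsBox : NsModOp M ⥤ NsCycOp M where
  obj P :=
    { obj := ObjectProperty.ι _ ⋙ P.obj.obj 0
      comp C D := P.obj.comp (zero_add 0) C.obj D.obj
      comp_swap C D := P.obj.comp_swap _ _ C.obj D.obj
      comp_assoc C D E := P.obj.comp_assoc _ _ _ _ C.obj D.obj E.obj
      comp_natural f g := P.obj.comp_natural _ f.hom g.hom }
  map f := ⟨Functor.whiskerLeft _ (f.hom.app 0), fun C D => f.hom.app_comp _ C.obj D.obj⟩

/-- The underlying set of a multicyclically ordered set. -/
def forgetOrder : MultCyc ⥤ FinSet where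
  obj X := ⟨X.carrier⟩
  map f := f.toEquiv

/-- Desymmetrization of modular operads: `Des P (X; g) = P (S; g)`, where `S` is the underlying set
of `X`. -/
def des : ModOp M ⥤ ModularOperad MultCyc M where
  obj P :=
    { obj := fun g => forgetOrder ⋙ P.obj g
      comp := fun hg X Y => P.comp hg (forgetOrder.obj X) (forgetOrder.obj Y)
      contr := fun g X => P.contr g (forgetOrder.obj X)
      contr_symm := fun g X => P.contr_symm g (forgetOrder.obj X)
      comp_swap := fun h h' X Y => P.comp_swap h h' (forgetOrder.obj X) (forgetOrder.obj Y)
      comp_assoc := fun h1 h2 h3 h4 X Y Z =>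
        P.comp_assoc h1 h2 h3 h4 (forgetOrder.obj X) (forgetOrder.obj Y) (forgetOrder.obj Z)
      contr_contr := fun g X => P.contr_contr g (forgetOrder.obj X)
      contr_comp := fun h X Y => P.contr_comp h (forgetOrder.obj X) (forgetOrder.obj Y)
      comp_contr := fun h h' X Y => P.comp_contr h h' (forgetOrder.obj X) (forgetOrder.obj Y)
      comp_natural := fun h _ _ _ _ f f' => P.comp_natural h (forgetOrder.map f) (forgetOrder.map f')
      contr_natural := fun g _ _ f => P.contr_natural g (forgetOrder.map f) }
  map f :=
    { app := fun g => Functor.whiskerLeft _ (f.app g)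
      app_comp := fun hg X Y => f.app_comp hg (forgetOrder.obj X) (forgetOrder.obj Y)
      app_contr := fun g X => f.app_contr g (forgetOrder.obj X) }

end Categories


section Span
universe u
variable (k : Type u) [CommRing k]

/-- The `k`-linear span is a symmetric monoidal functor from sets to `k`-modules. -/
instance freeLaxBraided : (ModuleCat.free k).LaxBraided where
  toLaxMonoidal := inferInstance
  braided X Y := by
    rw [← cancel_epi (ModuleCat.FreeMonoidal.μIso k X Y).inv]
    refine ModuleCat.free_hom_ext ?_
    rintro ⟨x, y⟩
    rw [ModuleCat.comp_apply, ModuleCat.comp_apply, ModuleCat.comp_apply, ModuleCat.comp_apply,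
      ModuleCat.FreeMonoidal.μIso_inv_freeMk]
    refine (congrArg _ (ModuleCat.free_μ_freeMk_tmul_freeMk k x y)).trans ?_
    refine (ModuleCat.free_map_apply _ _).trans ?_
    exact (ModuleCat.free_μ_freeMk_tmul_freeMk k y x).symm

/-- The terminal non-Σ cyclic operad in the category of sets: a one-point set for each cyclically
ordered set. -/
def starC : NsCycOp (Type u) where
  obj := (Functor.const _).obj PUnit
  comp _ _ _ _ := TypeCat.ofHom (fun _ => PUnit.unit)
  comp_swap _ _ _ _ := by ext; rfl
  comp_assoc _ _ _ _ _ _ _ _ := by ext; rfl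
  comp_natural _ _ _ _ := by ext; rfl

/-- The terminal non-Σ modular operad in the category of sets: a one-point set for each geometric
`(X, g)`, and the empty set otherwise. -/
def starM : NsModOp (Type u) where
  obj :=
    { obj := fun g =>
        { obj := fun X => ULift.{u} (PLift (X.IsGeometric g))
          map := fun f => TypeCat.ofHom (fun x => ⟨⟨x.down.down.of_iso f⟩⟩)
          map_id := fun _ => by ext; rfl
          map_comp := fun _ _ => by ext; rfl }
      comp := fun hg X Y u v =>
        TypeCat.ofHom (fun p => ⟨⟨p.1.down.down.merge p.2.down.down hg u v⟩⟩)
      contr := fun g X _ _ h => TypeCat.ofHom (fun x => ⟨⟨x.down.down.cut h⟩⟩)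
      contr_symm := fun _ _ _ _ _ => by ext; rfl
      comp_swap := fun _ _ _ _ _ _ => by ext; rfl
      comp_assoc := fun _ _ _ _ _ _ _ _ _ _ _ _ => by ext; rfl
      contr_contr := fun _ _ _ _ _ _ _ _ _ _ _ _ => by ext; rfl
      contr_comp := fun _ _ _ _ _ _ _ _ _ => by ext; rfl
      comp_contr := fun _ _ _ _ _ _ _ _ _ _ _ => by ext; rfl
      comp_natural := fun _ _ _ _ _ _ _ _ _ => by ext; rfl
      contr_natural := fun _ _ _ _ _ _ _ _ => by ext; rfl }
  property g X h := ⟨Limits.IsInitial.ofUniqueHom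
    (fun Y => TypeCat.ofHom (fun x => (h x.down.down).elim))
    (fun Y f => by ext x; exact (h x.down.down).elim)⟩

/-- The `k`-linear span of a cyclic operad in the category of sets. -/
abbrev spanCyc {G : Type*} [Category G] [MergeBase G] (P : CyclicOperad G (Type u)) :
    CyclicOperad G (ModuleCat.{u} k) :=
  P.mapLax (ModuleCat.free k)

/-- The `k`-linear span of a modular operad in the category of sets. -/
abbrev spanMod {G : Type*} [Category G] [CutBase G] (P : ModularOperad G (Type u)) :
    ModularOperad G (ModuleCat.{u} k) :=
  P.mapLax (ModuleCat.free k)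

/-- The `k`-linear span of a non-Σ modular operad in the category of sets. -/
def spanNsMod (P : NsModOp (Type u)) : NsModOp (ModuleCat.{u} k) where
  obj := spanMod k P.obj
  property g X h := by
    obtain ⟨hP⟩ := P.property g X h
    have : (ModuleCat.free.{u} k).IsLeftAdjoint := (ModuleCat.adj k).isLeftAdjoint
    exact ⟨hP.isInitialObj (ModuleCat.free k)⟩

/-- The non-Σ cyclic operad for associative algebras: the span of the terminal non-Σ cyclic operad
in the category of sets. -/
def nsAss : NsCycOp (ModuleCat.{u} k) := spanCyc k starC

end Span

/-- A multicyclic order on a set `S`, up to relabelling of the parts: the successor permutation, whose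
cycles are the nonempty parts, and the number of empty parts. There has to be at least one part. -/
@[ext]
structure MultOrd (S : Type) where
  next : Perm S
  empties : ℕ
  nonempty_parts : Nonempty S ∨ 0 < empties

namespace MultOrd

/-- The set `S` with a multicyclic order. -/
def toMultCyc {S : FinSet} (o : MultOrd S.carrier) : MultCyc where
  carrier := S.carrier
  index := Orb o.next ⊕ Fin o.empties
  nonempty_index := by
    rcases o.nonempty_parts with ⟨⟨x⟩⟩ | h
    exacts [⟨.inl (Quotient.mk _ x)⟩, ⟨.inr ⟨0, h⟩⟩]
  part x := .inl (Quotient.mk _ x)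
  next := o.next
  sameCycle_iff x y := by rw [Sum.inl.injEq, orb_eq]

/-- The transport of multicyclic orders along a bijection. -/
def map {S T : Type} (e : S ≃ T) (o : MultOrd S) : MultOrd T where
  next := (e.symm.trans o.next).trans e
  empties := o.empties
  nonempty_parts := o.nonempty_parts.imp_left (fun ⟨x⟩ => ⟨e x⟩)

theorem map_refl {S : Type} (o : MultOrd S) : o.map (Equiv.refl S) = o := rfl

theorem map_map {S T U : Type} (e : S ≃ T) (e' : T ≃ U) (o : MultOrd S) :
    (o.map e).map e' = o.map (e.trans e') := rfl

end MultOrd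

/-- The multicyclic order of a multicyclically ordered set. -/
def MultCyc.order (X : MultCyc) : MultOrd X.carrier where
  next := X.next
  empties := Nat.card X.Empties
  nonempty_parts := by
    by_cases h : Nonempty X.carrier
    · exact .inl h
    · obtain ⟨i⟩ := X.nonempty_index
      have : Nonempty X.Empties := ⟨⟨i, fun x => (h ⟨x⟩).elim⟩⟩
      exact .inr Nat.card_pos

namespace MultOrd

theorem order_map {X Y : MultCyc} (f : X ⟶ Y) : X.order.map f.toEquiv = Y.order := by
  have h : ∀ i : X.index, (∀ x, X.part x ≠ i) ↔ ∀ y, Y.part y ≠ f.indexEquiv i := by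
    intro i
    constructor
    · intro h y hy
      apply h (f.toEquiv.symm y)
      apply f.indexEquiv.injective
      rw [← hy, ← f.part_eq, apply_symm_apply]
    · intro h x hx
      exact h (f.toEquiv x) (by rw [f.part_eq, hx])
  refine MultOrd.ext (Equiv.ext fun y => ?_) (Nat.card_congr (f.indexEquiv.subtypeEquiv h))
  change f.toEquiv (X.next (f.toEquiv.symm y)) = Y.next y
  rw [f.next_eq, apply_symm_apply]

theorem order_toMultCyc {S : FinSet} (o : MultOrd S.carrier) : o.toMultCyc.order = o := by
  refine MultOrd.ext rfl ?_
  have : o.toMultCyc.Empties ≃ Fin o.empties :=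
    { toFun := fun i => match i with
        | ⟨.inl q, h⟩ => (h q.out (congrArg Sum.inl q.out_eq)).elim
        | ⟨.inr j, _⟩ => j
      invFun := fun j => ⟨.inr j, fun x hx => Sum.inl_ne_inr hx⟩
      left_inv := by
        rintro ⟨q | j, h⟩
        · exact (h q.out (congrArg Sum.inl q.out_eq)).elim
        · rfl
      right_inv := fun _ => rfl }
  exact (Nat.card_congr this).trans (by simp)

/-- An isomorphism over the identity of the underlying set. -/
def ofOrder (X : MultCyc) : toMultCyc (S := ⟨X.carrier⟩) X.order ⟶ X where
  toEquiv := Equiv.refl _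
  indexEquiv := ((Equiv.sumComm _ _).trans
    (Equiv.sumCongr (Finite.equivFin X.Empties).symm (Equiv.refl _))).trans
    (Equiv.ofBijective _ X.indexOfOrder_bijective)
  part_eq _ := rfl
  next_eq _ := rfl

def mapHom {S T : FinSet} (e : S ⟶ T) (o : MultOrd S.carrier) :
    o.toMultCyc ⟶ toMultCyc (S := T) (o.map e) where
  toEquiv := e
  indexEquiv := Equiv.sumCongr (Quotient.congr e (fun x y =>
    sameCycle_semiconj _ (fun z => by simp [map]) x y)) (Equiv.refl _)
  part_eq _ := rfl
  next_eq x := by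
    change e.toFun (o.next x) = e.toFun (o.next (e.symm.toFun (e.toFun x)))
    exact congrArg (fun y => e.toFun (o.next y)) (e.left_inv x).symm

/-- The multicyclic order obtained by merging. -/
def merge {S T : FinSet} (o : MultOrd S.carrier) (o' : MultOrd T.carrier) (u : S.carrier)
    (v : T.carrier) : MultOrd (S.merge T u v).carrier :=
  (o.toMultCyc.merge o'.toMultCyc u v).order

/-- The multicyclic order obtained by gluing. -/
def cut {S : FinSet} (o : MultOrd S.carrier) (u v : S.carrier) : MultOrd (S.cut u v).carrier :=
  (o.toMultCyc.cut u v).order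

theorem merge_order_left (X : MultCyc) {T : FinSet} (o : MultOrd T.carrier) (u : X.carrier)
    (v : T.carrier) :
    merge (S := ⟨X.carrier⟩) X.order o u v = (X.merge o.toMultCyc u v).order := by
  have h := order_map (MultCyc.cutMap (MultCyc.sumMap (ofOrder X) (𝟙 o.toMultCyc))
    (u := Sum.inl u) (v := Sum.inr v) rfl rfl)
  refine Eq.trans ?_ h
  refine Eq.trans (map_refl _).symm ?_
  congr 1
  ext x
  rcases x with ⟨x | x, hx⟩ <;> rfl

theorem merge_order_right (X : MultCyc) {T : FinSet} (o : MultOrd T.carrier) (u : T.carrier)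
    (v : X.carrier) :
    merge (T := ⟨X.carrier⟩) o X.order u v = (o.toMultCyc.merge X u v).order := by
  have h := order_map (MultCyc.cutMap (MultCyc.sumMap (𝟙 o.toMultCyc) (ofOrder X))
    (u := Sum.inl u) (v := Sum.inr v) rfl rfl)
  refine Eq.trans ?_ h
  refine Eq.trans (map_refl _).symm ?_
  congr 1
  ext x
  rcases x with ⟨x | x, hx⟩ <;> rfl

theorem cut_order (X : MultCyc) (u v : X.carrier) :
    cut (S := ⟨X.carrier⟩) X.order u v = (X.cut u v).order :=
  order_map (MultCyc.cutMap (ofOrder X) (u := u) (v := v) rfl rfl)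

end MultOrd

section Symmetric
universe u

theorem ulift_hom_ext {α : Type u} {β : Type} {p : β → Prop} {f g : α ⟶ ULift.{u} {o : β // p o}}
    (h : ∀ x : α, (f x).down.1 = (g x).down.1) : f = g := by
  refine TypeCat.Hom.ext (TypeCat.Fun.ext (funext fun x => ?_))
  exact congrArg ULift.up (Subtype.ext (h x))

/-- The symmetrization of the terminal non-Σ modular operad: its component of genus `g` at `S` is the
set of the multicyclic orders on `S` (up to relabelling of the parts) that are geometric for `g`. -/
def multOrders : ModOp (Type u) where
  obj g :=
    { obj := fun S => ULift.{u} {o : MultOrd S.carrier // o.toMultCyc.IsGeometric g}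
      map := fun {S T} e => TypeCat.ofHom (fun o =>
        ⟨⟨o.down.1.map e, o.down.2.of_iso (MultOrd.mapHom e o.down.1)⟩⟩)
      map_id := fun _ => ulift_hom_ext fun _ => rfl
      map_comp := fun _ _ => ulift_hom_ext fun _ => rfl }
  comp hg S T u v := TypeCat.ofHom (fun p => ⟨⟨p.1.down.1.merge p.2.down.1 u v,
    (p.1.down.2.merge p.2.down.2 hg u v).of_iso (MultCyc.inv (MultOrd.ofOrder _))⟩⟩)
  contr g S _ _ h := TypeCat.ofHom (fun o => ⟨⟨o.down.1.cut _ _,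
    (o.down.2.cut h).of_iso (MultCyc.inv (MultOrd.ofOrder _))⟩⟩)
  contr_symm g S u v h := ulift_hom_ext fun o =>
    MultOrd.order_map (o.down.1.toMultCyc.cutSwap u v)
  comp_swap hg hg' S T u v := ulift_hom_ext fun o =>
    MultOrd.order_map
      (MergeBase.mergeSwap o.1.down.1.toMultCyc o.2.down.1.toMultCyc u v)
  comp_assoc h₁₂ h₂₃ hg hg' S T U a b c d h := by
    refine ulift_hom_ext fun o => ?_
    have h1 := MultOrd.order_map (MultCyc.mergeAssoc o.1.down.1.toMultCyc o.2.1.down.1.toMultCyc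
      o.2.2.down.1.toMultCyc a b c d h)
    refine Eq.trans ?_ (h1.trans ?_)
    · exact congrArg (MultOrd.map _) (MultOrd.merge_order_right _ _ _ _)
    · exact (MultOrd.merge_order_left _ _ _ _).symm
  contr_contr g S a b c d hab hcd hac had hbc hbd := by
    refine ulift_hom_ext fun o => ?_
    have h1 := MultOrd.order_map (MultCyc.cutComm (X := o.down.1.toMultCyc) hac had hbc hbd)
    refine Eq.trans ?_ (h1.trans ?_)
    · exact congrArg (MultOrd.map _) (MultOrd.cut_order _ _ _)
    · exact (MultOrd.cut_order _ _ _).symm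
  contr_comp hg S T a c b d hac hbd := by
    refine ulift_hom_ext fun o => ?_
    have h1 := MultOrd.order_map
      (CutBase.cutMerge o.1.down.1.toMultCyc o.2.down.1.toMultCyc a c b d hac hbd)
    refine Eq.trans ?_ (h1.trans ?_)
    · exact congrArg (MultOrd.map _) (MultOrd.cut_order _ _ _)
    · exact (MultOrd.cut_order _ _ _).symm
  comp_contr hg hg' S T a c d b hac had hcd := by
    refine ulift_hom_ext fun o => ?_
    have h1 := MultOrd.order_map
      (CutBase.mergeCut o.1.down.1.toMultCyc o.2.down.1.toMultCyc a c d b hac had)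
    refine Eq.trans ?_ (h1.trans ?_)
    · exact congrArg (MultOrd.map _) (MultOrd.merge_order_left _ _ _ _)
    · exact (MultOrd.cut_order _ _ _).symm
  comp_natural hg S S' T T' e e' u v := ulift_hom_ext fun o =>
    MultOrd.order_map
      (MergeBase.mergeMap (MultOrd.mapHom e o.1.down.1) (MultOrd.mapHom e' o.2.down.1) u v)
  contr_natural g S T e u v h h' := ulift_hom_ext fun o =>
    MultOrd.order_map
      (CutBase.cutMap (MultOrd.mapHom e o.down.1) u v)

/-- A multicyclic order is a cyclic order if it has exactly one part. -/
abbrev MultOrd.IsCyclic {S : FinSet} (o : MultOrd S.carrier) : Prop := Nat.card o.toMultCyc.index = 1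

theorem MultOrd.IsCyclic.merge {S T : FinSet} {o : MultOrd S.carrier} {o' : MultOrd T.carrier}
    (h : o.IsCyclic) (h' : o'.IsCyclic) (u : S.carrier) (v : T.carrier) :
    (o.merge o' u v).IsCyclic := by
  have := MultCyc.card_merge o.toMultCyc o'.toMultCyc u v
  rw [h, h', ← Nat.card_congr (MultOrd.ofOrder _).indexEquiv] at this
  exact Nat.succ_injective this

/-- The cyclic operad in the category of sets whose component at `S` is the set of total cyclic orders
on `S`. -/
def cycOrders : CycOp (Type u) where
  obj :=
    { obj := fun S => ULift.{u} {o : MultOrd S.carrier // o.IsCyclic}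
      map := fun {S T} e => TypeCat.ofHom (fun o => ⟨⟨o.down.1.map e, by
        have := Nat.card_congr (MultOrd.mapHom e o.down.1).indexEquiv
        exact this.symm.trans o.down.2⟩⟩)
      map_id := fun _ => ulift_hom_ext fun _ => rfl
      map_comp := fun _ _ => ulift_hom_ext fun _ => rfl }
  comp S T u v := TypeCat.ofHom (fun p => ⟨⟨p.1.down.1.merge p.2.down.1 u v,
    p.1.down.2.merge p.2.down.2 u v⟩⟩)
  comp_swap S T u v := ulift_hom_ext fun o =>
    MultOrd.order_map
      (MergeBase.mergeSwap o.1.down.1.toMultCyc o.2.down.1.toMultCyc u v)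
  comp_assoc S T U a b c d h := by
    refine ulift_hom_ext fun o => ?_
    have h1 := MultOrd.order_map (MultCyc.mergeAssoc o.1.down.1.toMultCyc o.2.1.down.1.toMultCyc
      o.2.2.down.1.toMultCyc a b c d h)
    refine Eq.trans ?_ (h1.trans ?_)
    · exact congrArg (MultOrd.map _) (MultOrd.merge_order_right _ _ _ _)
    · exact (MultOrd.merge_order_left _ _ _ _).symm
  comp_natural {S S' T T'} e e' u v := ulift_hom_ext fun o =>
    MultOrd.order_map
      (MergeBase.mergeMap (MultOrd.mapHom e o.1.down.1) (MultOrd.mapHom e' o.2.down.1) u v)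

variable (k : Type u) [CommRing k]

/-- The cyclic operad for associative algebras: its component at `S` is the span of the total cyclic
orders on `S`. -/
def ass : CycOp (ModuleCat.{u} k) := spanCyc k cycOrders

end Symmetric

/-- `d` is the value at `c` of the left adjoint of `R`: there is a morphism from `c` to `R d` through
which every morphism from `c` to some `R d'` factors uniquely. -/
def IsLeftAdjointValue {C D : Type*} [Category C] [Category D] (R : D ⥤ C) (c : C) (d : D) : Prop :=
  ∃ η : c ⟶ R.obj d, ∀ (d' : D) (f : c ⟶ R.obj d'), ∃! f' : d ⟶ d', η ≫ R.map f' = f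

end ModEnv

end

open CategoryTheory MonoidalCategory ModEnv

universe u

/-! The heart is the universal property of `starM` among non-Σ modular operads `Q` in sets; the rest
is formal. A morphism from `starC` to the genus-zero part of `Q` is a family of elements of genus 0
at the cyclically ordered sets, compatible with isomorphisms and compositions (`CycFamily`). An
extension to `starM` is forced on everything obtained from this family by contractions, the
reachable elements (`Reach`). So it has to be shown that exactly one element is reachable at every
geometric pair, and that compositions of reachable elements are reachable (`compReach`).

Existence (`exists_reach`) undoes one gluing at a time: ungluing two places in different parts
merges these parts, and ungluing two places in one part splits it; one of the two always leads to a
geometric pair of smaller genus.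

Uniqueness (`uniqueReach`) is the main work. A multicyclically ordered set is encoded by a
permutation `f` of a finite set `N` containing its elements and some dummy elements; parts are
cycles, and empty parts are cycles of dummies (`IsModel`). Gluing two elements multiplies `f` by
their transposition and turns them into dummies (`IsModel.exists_cut`); ungluing at two dummies is
the same multiplication. Isomorphisms compatible with models are unique (`IsModel.hom_ext`), so
canonical isomorphisms are compared without computing composites. By induction on the genus, a pair
of dummies determines at most one contraction (`IsVal.unique`), and two contractions at `X` can be
placed in a common model (`IsModel.amalgamate`). It remains to pass from one pair of dummies to
another (`IsVal.move`). Disjoint pairs are exchanged because contractions commute, as long as the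
set unglued at both pairs is geometric in the lower genus; neighbouring dummies are exchanged by
renaming; and a new dummy inserted beside `u` reduces the passage from `(u, v)` to `(u, s)` to these
two moves. When the number of parts is the largest possible, the set unglued twice may fail to be
geometric. It is then cut into two sets, and the interchange of contraction with composition is used
instead (`IsVal.interchange_comp`).

For the formal part, multicyclic orders form the symmetrization of `starM` and cyclic orders that of
`starC`, so cancellation of left adjoints gives the envelope of the operad of cyclic orders. Linear
span is left adjoint to the forgetful functor from linear operads to operads in sets, which commutes
with all functors involved; hence every statement passes from sets to modules
(`IsLeftAdjointValue.transfer`). -/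

noncomputable section
namespace ModEnv
open Equiv
open scoped Classical

/-! ### Removing points from cycles and multiplying by transpositions. -/

section

section SkipAll
variable {α β : Type}

instance : RightCommutative (skip : Perm α → α → Perm α) := ⟨skip_comm⟩

/-- Remove all points of the finite set `D` from their cycles. -/
def skipAll (f : Perm α) (D : Finset α) : Perm α := D.val.foldl skip f

theorem skip_of_fixed {f : Perm α} {a : α} (h : f a = a) : skip f a = f := by
  rw [skip, h, swap_self]; rfl

@[simp] theorem skipAll_empty (f : Perm α) : skipAll f ∅ = f := rfl

theorem foldl_skip_skip (f : Perm α) (a : α) (s : Multiset α) :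
    s.foldl skip (skip f a) = skip (s.foldl skip f) a := by
  induction s using Multiset.induction_on generalizing f with
  | empty => rfl
  | cons b s ih => rw [Multiset.foldl_cons, Multiset.foldl_cons, skip_comm, ih]

theorem skipAll_insert_of_notMem (f : Perm α) {a : α} {D : Finset α} (h : a ∉ D) :
    skipAll f (insert a D) = skip (skipAll f D) a := by
  unfold skipAll
  rw [Finset.insert_val_of_notMem h, Multiset.foldl_cons, foldl_skip_skip]

theorem skipAll_skip (f : Perm α) (a : α) (D : Finset α) :
    skipAll (skip f a) D = skip (skipAll f D) a := foldl_skip_skip f a D.val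

theorem skipAll_fix {f : Perm α} {b : α} (D : Finset α) (h : f b = b) : skipAll f D b = b := by
  induction D using Finset.induction_on with
  | empty => exact h
  | insert a D ha ih => rw [skipAll_insert_of_notMem f ha]; exact skip_fix _ ih

theorem skipAll_mem (f : Perm α) {D : Finset α} {a : α} (h : a ∈ D) : skipAll f D a = a := by
  induction D using Finset.induction_on with
  | empty => simp at h
  | insert b D hb ih =>
    rw [skipAll_insert_of_notMem f hb]
    by_cases e : a = b
    · subst e; exact skip_self _ _
    · exact skip_fix _ (ih (Finset.mem_of_mem_insert_of_ne h e))

theorem skipAll_insert (f : Perm α) (a : α) (D : Finset α) :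
    skipAll f (insert a D) = skip (skipAll f D) a := by
  by_cases h : a ∈ D
  · rw [Finset.insert_eq_of_mem h, skip_of_fixed (skipAll_mem f h)]
  · exact skipAll_insert_of_notMem f h

@[simp] theorem skipAll_singleton (f : Perm α) (a : α) : skipAll f {a} = skip f a := by
  rw [← insert_empty_eq, skipAll_insert, skipAll_empty]

theorem skipAll_union (f : Perm α) (D E : Finset α) :
    skipAll f (D ∪ E) = skipAll (skipAll f D) E := by
  induction E using Finset.induction_on with
  | empty => simp
  | insert a E ha ih => rw [Finset.union_insert, skipAll_insert, skipAll_insert, ih]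

theorem skipAll_of_fixed {f : Perm α} {D : Finset α} (h : ∀ a ∈ D, f a = a) : skipAll f D = f := by
  induction D using Finset.induction_on with
  | empty => rfl
  | insert a D ha ih =>
    rw [skipAll_insert, ih (fun b hb => h b (Finset.mem_insert_of_mem hb)),
      skip_of_fixed (h a (Finset.mem_insert_self _ _))]

theorem sameCycle_skipAll (f : Perm α) {D : Finset α} {x y : α} (hx : x ∉ D) (hy : y ∉ D) :
    (skipAll f D).SameCycle x y ↔ f.SameCycle x y := by
  induction D using Finset.induction_on with
  | empty => rfl
  | insert a D ha ih =>
    rw [Finset.mem_insert, not_or] at hx hy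
    rw [skipAll_insert, sameCycle_skip _ hx.1 hy.1, ih hx.2 hy.2]

theorem skipAll_glue (f : Perm α) {D : Finset α} {c d : α} (hc : c ∉ D) (hd : d ∉ D) :
    skipAll (glue f c d) D = glue (skipAll f D) c d := by
  induction D using Finset.induction_on with
  | empty => rfl
  | insert a D ha ih =>
    rw [Finset.mem_insert, not_or] at hc hd
    rw [skipAll_insert, skipAll_insert, ih hc.2 hd.2, skip_glue _ (Ne.symm hc.1) (Ne.symm hd.1)]

theorem skipAll_semiconj {f : Perm α} {g : Perm β} (e : α ≃ β) (h : ∀ x, e (f x) = g (e x))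
    (D : Finset α) (x : α) : e (skipAll f D x) = skipAll g (D.map e.toEmbedding) (e x) := by
  induction D using Finset.induction_on generalizing x with
  | empty => exact h x
  | insert a D ha ih =>
    rw [skipAll_insert, Finset.map_insert, skipAll_insert]
    exact skip_semiconj e ih a x

/-- Gluing `q` with a fixed point inserts that point directly after `q`. This lemma and
`skip_glue_of_fixed` say that insertion and removal are inverse to each other. -/
theorem glue_skip {f : Perm α} {q a : α} (h : f q = a) : glue (skip f a) q a = f := by
  ext x
  have h1 : ∀ y z, f y = f z → y = z := fun y z h => f.injective h
  simp only [skip_apply, glue_apply]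
  grind

theorem skip_glue_of_fixed {f : Perm α} {q c : α} (h : f c = c) (hq : q ≠ c) :
    skip (glue f q c) c = f := by
  ext x
  have h1 : ∀ y z, f y = f z → y = z := fun y z h => f.injective h
  simp only [skip_apply, glue_apply]
  grind

theorem glue_fix {f : Perm α} {u v x : α} (h : f x = x) (hu : x ≠ u) (hv : x ≠ v) :
    glue f u v x = x := by rw [glue_apply, if_neg hu, if_neg hv, h]

/-- A cycle avoiding `c` and `d` is untouched by the transposition. The converse of `sameCycle_glue`
is the same statement for `glue f c d`, since gluing twice gives back `f`. -/
theorem sameCycle_glue_avoid {f : Perm α} {c d y : α}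
    (h : ∀ z, f.SameCycle y z → z ≠ c ∧ z ≠ d) (z : α) :
    (glue f c d).SameCycle y z ↔ f.SameCycle y z := by
  refine ⟨sameCycle_glue h z, fun hz => ?_⟩
  have h' : ∀ z, (glue f c d).SameCycle y z → z ≠ c ∧ z ≠ d :=
    fun w hw => h w (sameCycle_glue h w hw)
  rw [← glue_glue f c d] at hz
  exact sameCycle_glue h' z hz

/-- Elements of the cycles of `u` and `v` stay in these cycles after gluing. -/
theorem sameCycle_glue_or {f : Perm α} {u v x : α} (h : f.SameCycle x u ∨ f.SameCycle x v) :
    (glue f u v).SameCycle x u ∨ (glue f u v).SameCycle x v := by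
  by_contra hc
  rw [not_or] at hc
  -- A cycle of the glued permutation that avoids `u` and `v` is already a cycle of `f`.
  have h' : ∀ z, (glue f u v).SameCycle x z → z ≠ u ∧ z ≠ v := fun z hz =>
    ⟨fun e => hc.1 (e ▸ hz), fun e => hc.2 (e ▸ hz)⟩
  have h2 := sameCycle_glue_avoid h'
  rw [glue_glue] at h2
  rcases h with h | h
  · exact hc.1 ((h2 u).1 h)
  · exact hc.2 ((h2 v).1 h)

end SkipAll

/-! ### Permutations of a possibly infinite set with finite support. -/

section FiniteSupport
variable {α : Type}

/-- The restriction of a permutation to a finite set containing its support. -/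
theorem exists_restrict {f : Perm α} {N : Finset α} (h : ∀ n ∉ N, f n = n) :
    ∃ g : Perm {x // x ∈ N}, ∀ x, (g x : α) = f x :=
  ⟨f.subtypePerm (fun x => by
    constructor
    · intro hx
      by_contra hn
      rw [h x hn] at hx; exact hn hx
    · intro hx
      by_contra hn
      have := f.injective (h _ hn)
      rw [this] at hn; exact hn hx), fun _ => rfl⟩

/-- A transposition splits a finite cycle containing both points and joins two different ones.
Finiteness is essential, so the permutation is first restricted to its support together with `u` and
`v`. -/
theorem glue_sameCycle_iff {f : Perm α} {N : Finset α} (h : ∀ n ∉ N, f n = n) {u v : α}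
    (huv : u ≠ v) : (glue f u v).SameCycle u v ↔ ¬ f.SameCycle u v := by
  have h' : ∀ n ∉ insert u (insert v N), f n = n := fun n hn => h n (by simp at hn; tauto)
  obtain ⟨g, hg⟩ := exists_restrict h'
  let u' : {x // x ∈ insert u (insert v N)} := ⟨u, by simp⟩
  let v' : {x // x ∈ insert u (insert v N)} := ⟨v, by simp⟩
  have h1 := sameCycle_lift hg u' v'
  have h2 := sameCycle_lift (glue_lift hg u' v') u' v'
  change _ ↔ f.SameCycle u v at h1
  change _ ↔ (glue f u v).SameCycle u v at h2
  rw [← h1, ← h2]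
  constructor
  · intro a b
    exact not_sameCycle_glue b (fun e => huv (congrArg Subtype.val e)) a
  · intro a
    exact (sameCycle_glue_of_not a).symm

/-- Every cycle of `glue f u v` meets a set containing `u` and `v` that all cycles of `f` meet. -/
theorem glue_meets {f : Perm α} {u v : α} {N : Finset α} (hu : u ∈ N) (hv : v ∈ N) {n : α}
    (h : ∃ m ∈ N, f.SameCycle n m) : ∃ m ∈ N, (glue f u v).SameCycle n m := by
  by_contra hc
  push Not at hc
  have h' : ∀ z, (glue f u v).SameCycle n z → z ≠ u ∧ z ≠ v := fun z hz =>
    ⟨fun e => hc u hu (e ▸ hz), fun e => hc v hv (e ▸ hz)⟩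
  have h2 := sameCycle_glue_avoid h'
  rw [glue_glue] at h2
  obtain ⟨m, hm, hm'⟩ := h
  exact hc m hm ((h2 m).1 hm')

end FiniteSupport

end

/-! ### Models of multicyclically ordered sets by permutations with dummy elements. -/

section

variable {B : Type}

/-- The multicyclically ordered set `X` is modelled by the permutation `f` of the finite set `N`: its
elements correspond under `e` to some elements of `N`, its parts correspond under `l` to the cycles of
`f` in `N`, and its cyclic orders are obtained from these cycles by removing the other elements of
`N`. -/
structure IsModel (X : MultCyc) (f : Perm B) (N : Finset B) (e : X.carrier → B) (l : B → X.index) :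
    Prop where
  fix : ∀ n ∉ N, f n = n
  inj : Function.Injective e
  mem : ∀ x, e x ∈ N
  surj : ∀ i, ∃ n ∈ N, l n = i
  lab : ∀ m ∈ N, ∀ n ∈ N, l m = l n ↔ f.SameCycle m n
  part : ∀ x, l (e x) = X.part x
  next : ∀ x, e (X.next x) = skipAll f (N.filter (· ∉ Set.range e)) (e x)

/-- An isomorphism compatible with the embeddings of the underlying sets and the labels of the parts. -/
structure IsModelHom {X Y : MultCyc} (φ : X ⟶ Y) (N : Finset B) (e : X.carrier → B)
    (l : B → X.index) (e' : Y.carrier → B) (l' : B → Y.index) : Prop where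
  emb : ∀ x, e' (φ.toEquiv x) = e x
  lab : ∀ n ∈ N, φ.indexEquiv (l n) = l' n

theorem MultCyc.hom_ext {X Y : MultCyc} {φ ψ : X ⟶ Y} (h : ∀ x, φ.toEquiv x = ψ.toEquiv x)
    (h' : ∀ i, φ.indexEquiv i = ψ.indexEquiv i) : φ = ψ :=
  MultCyc.Hom.ext (Equiv.ext h) (Equiv.ext h')

@[simp] theorem MultCyc.comp_indexEquiv {X Y Z : MultCyc} (φ : X ⟶ Y) (ψ : Y ⟶ Z) (i : X.index) :
    (φ ≫ ψ).indexEquiv i = ψ.indexEquiv (φ.indexEquiv i) := rfl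

theorem MultCyc.hom_inv {X Y : MultCyc} (φ : X ⟶ Y) : φ ≫ MultCyc.inv φ = 𝟙 X :=
  MultCyc.hom_ext (fun x => φ.toEquiv.symm_apply_apply x) (fun i => φ.indexEquiv.symm_apply_apply i)

namespace IsModel
variable {X Y : MultCyc} {f : Perm B} {N : Finset B} {e : X.carrier → B} {l : B → X.index}
  {e' : Y.carrier → B} {l' : B → Y.index}

theorem mem_dummies {n : B} :
    n ∈ N.filter (· ∉ Set.range e) ↔ n ∈ N ∧ ∀ x, e x ≠ n := by
  simp

theorem notMem_dummies (x : X.carrier) : e x ∉ N.filter (· ∉ Set.range e) := by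
  simp

/-- A model determines the multicyclically ordered set: parts are recovered as cycles of `f`, and
cyclic orders by skipping the dummies, which are the same on both sides. -/
theorem exists_hom (h : IsModel X f N e l) (h' : IsModel Y f N e' l')
    (hr : Set.range e = Set.range e') : ∃ φ : X ⟶ Y, IsModelHom φ N e l e' l' := by
  choose p hp using fun x => (hr ▸ Set.mem_range_self x : e x ∈ Set.range e')
  choose q hq using fun y => (hr ▸ Set.mem_range_self y : e' y ∈ Set.range e)
  choose s hs hsl using h.surj
  choose t ht htl using h'.surj
  -- Both labellings have the cycles of `f` as fibres, so the chosen representatives `s` and `t` of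
  -- the parts do not matter.
  have key : ∀ m ∈ N, ∀ n ∈ N, l m = l n ↔ l' m = l' n := fun m hm n hn => by
    rw [h.lab m hm n hn, h'.lab m hm n hn]
  refine ⟨⟨⟨p, q, fun x => h.inj ?_, fun y => h'.inj ?_⟩,
    ⟨fun i => l' (s i), fun j => l (t j), fun i => ?_, fun j => ?_⟩, fun x => ?_, fun x => h'.inj ?_⟩,
    fun x => hp x, fun n hn => ?_⟩
  · rw [hq, hp]
  · rw [hp, hq]
  · rw [← hsl i, key _ (ht _) _ (hs _), htl, hsl]
  · rw [← htl j, ← key _ (hs _) _ (ht _), hsl, htl]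
  · change Y.part (p x) = l' (s (X.part x))
    rw [← h'.part, hp, ← key _ (h.mem x) _ (hs _), hsl, h.part]
  · change e' (p (X.next x)) = e' (Y.next (p x))
    rw [hp, h'.next, h.next, hp, hr]
  · change l' (s (l n)) = l' n
    rw [← key _ (hs _) _ hn, hsl]

/-- Rigidity. Automorphisms of `X` may permute its empty parts, but every part carries a label
coming from `N`, and this pins the isomorphism down. Composites of canonical isomorphisms are
identified this way. -/
theorem hom_ext (h : IsModel X f N e l) (h' : IsModel Y f N e' l') {φ ψ : X ⟶ Y}
    (hφ : IsModelHom φ N e l e' l') (hψ : IsModelHom ψ N e l e' l') : φ = ψ := by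
  refine MultCyc.hom_ext (fun x => h'.inj ?_) (fun i => ?_)
  · rw [hφ.emb, hψ.emb]
  · obtain ⟨n, hn, rfl⟩ := h.surj i
    rw [hφ.lab n hn, hψ.lab n hn]

theorem transport (h : IsModel X f N e l) (φ : X ⟶ Y) :
    IsModel Y f N (e ∘ φ.toEquiv.symm) (φ.indexEquiv ∘ l) where
  fix := h.fix
  inj := h.inj.comp φ.toEquiv.symm.injective
  mem _ := h.mem _
  surj i := by
    obtain ⟨n, hn, hl⟩ := h.surj (φ.indexEquiv.symm i)
    exact ⟨n, hn, by simp [hl]⟩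
  lab m hm n hn := by simp [h.lab m hm n hn]
  part y := by
    obtain ⟨x, rfl⟩ := φ.toEquiv.surjective y
    simp [h.part, φ.part_eq]
  next y := by
    obtain ⟨x, rfl⟩ := φ.toEquiv.surjective y
    have : Set.range (e ∘ φ.toEquiv.symm) = Set.range e := φ.toEquiv.symm.surjective.range_comp e
    rw [this, ← φ.next_eq]
    simp [h.next]

theorem congr (h : IsModel X f N e l) {l₁ : B → X.index} (hl : ∀ n ∈ N, l₁ n = l n) :
    IsModel X f N e l₁ where
  fix := h.fix
  inj := h.inj
  mem := h.mem
  surj i := by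
    obtain ⟨n, hn, h'⟩ := h.surj i
    exact ⟨n, hn, (hl n hn).trans h'⟩
  lab m hm n hn := by rw [hl m hm, hl n hn, h.lab m hm n hn]
  part x := by rw [hl _ (h.mem x), h.part]
  next := h.next

theorem rename (h : IsModel X f N e l) (σ : Perm B) :
    IsModel X (σ * f * σ⁻¹) (N.map σ.toEmbedding) (σ ∘ e) (l ∘ σ.symm) where
  fix n hn := by
    have : σ.symm n ∉ N := fun hc => hn (by
      rw [Finset.mem_map_equiv]; exact hc)
    rw [Perm.mul_apply, Perm.mul_apply]
    change σ (f (σ.symm n)) = n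
    rw [h.fix _ this, apply_symm_apply]
  inj := σ.injective.comp h.inj
  mem x := by simpa using h.mem x
  surj i := by
    obtain ⟨n, hn, hl⟩ := h.surj i
    exact ⟨σ n, by simpa using hn, by simp [hl]⟩
  lab m hm n hn := by
    rw [Finset.mem_map_equiv] at hm hn
    rw [Function.comp_apply, Function.comp_apply, h.lab _ hm _ hn]
    exact (sameCycle_semiconj (f := f) (g := σ * f * σ⁻¹) σ (fun x => by simp) _ _).trans (by simp)
  part x := by simp [h.part]
  next x := by
    have hD : ((N.map σ.toEmbedding).filter (· ∉ Set.range (σ ∘ e))) =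
        (N.filter (· ∉ Set.range e)).map σ.toEmbedding := by
      ext n
      rw [Finset.mem_map_equiv, mem_dummies, mem_dummies, Finset.mem_map_equiv]
      refine and_congr_right fun _ => forall_congr' fun x => not_congr ?_
      rw [Function.comp_apply, ← eq_symm_apply]
    rw [hD, Function.comp_apply, h.next]
    exact skipAll_semiconj (f := f) (g := σ * f * σ⁻¹) σ (fun x => by simp) _ _

/-- The number of parts is the number of cycles of `f` in `N`, whichever elements of `N` are
regarded as dummies. -/
theorem card_index_eq (h : IsModel X f N e l) (h' : IsModel Y f N e' l') :
    Nat.card X.index = Nat.card Y.index := by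
  choose s hs hsl using h.surj
  choose t ht htl using h'.surj
  have key : ∀ m ∈ N, ∀ n ∈ N, l m = l n ↔ l' m = l' n := fun m hm n hn => by
    rw [h.lab m hm n hn, h'.lab m hm n hn]
  exact Nat.card_congr ⟨fun i => l' (s i), fun j => l (t j),
    fun i => by rw [← hsl i, key _ (ht _) _ (hs _), htl, hsl],
    fun j => by rw [← htl j, ← key _ (hs _) _ (ht _), hsl, htl]⟩

/-- Removing superfluous elements from a model. -/
theorem restrict {N' : Finset B} (h : IsModel X f N' e l) (hN : N ⊆ N') (he : ∀ x, e x ∈ N)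
    (hm : ∀ n ∈ N', ∃ m ∈ N, f.SameCycle n m) :
    IsModel X (skipAll f (N' \ N)) N e l where
  fix n hn := by
    by_cases h' : n ∈ N'
    · exact skipAll_mem _ (by simp [h', hn])
    · exact skipAll_fix _ (h.fix n h')
  inj := h.inj
  mem := he
  surj i := by
    obtain ⟨n, hn, rfl⟩ := h.surj i
    obtain ⟨m, hm, hnm⟩ := hm n hn
    exact ⟨m, hm, ((h.lab n hn m (hN hm)).2 hnm).symm⟩
  lab m hm n hn := by
    rw [h.lab m (hN hm) n (hN hn), sameCycle_skipAll] <;> simp [hm, hn]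
  part := h.part
  next x := by
    rw [h.next, ← skipAll_union]
    congr 2
    ext n
    simp only [Finset.mem_filter, Finset.mem_union, Finset.mem_sdiff]
    constructor
    · rintro ⟨a, b⟩
      by_cases c : n ∈ N
      · exact .inr ⟨c, b⟩
      · exact .inl ⟨a, c⟩
    · rintro (⟨a, b⟩ | ⟨a, b⟩)
      · exact ⟨a, by rintro ⟨y, rfl⟩; exact b (he y)⟩
      · exact ⟨hN a, b⟩

/-- Adding elements to a model. -/
theorem extend {N' : Finset B} (h : IsModel X (skipAll f (N' \ N)) N e l) (hN : N ⊆ N')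
    (hf : ∀ n ∉ N', f n = n) (hm : ∀ n ∈ N', ∃ m ∈ N, f.SameCycle n m) :
    ∃ l' : B → X.index, IsModel X f N' e l' ∧ ∀ n ∈ N, l' n = l n := by
  have hm' : ∀ n, ∃ m, n ∈ N' → m ∈ N ∧ f.SameCycle n m := fun n => by
    by_cases hn : n ∈ N'
    · obtain ⟨m, h1, h2⟩ := hm n hn
      exact ⟨m, fun _ => ⟨h1, h2⟩⟩
    · exact ⟨n, fun hc => (hn hc).elim⟩
  choose r hr using hm'
  have lab : ∀ m ∈ N, ∀ n ∈ N, l m = l n ↔ f.SameCycle m n := fun m hm n hn => by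
    rw [h.lab m hm n hn, sameCycle_skipAll] <;> simp [hm, hn]
  have hl : ∀ n ∈ N, l (r n) = l n := fun n hn =>
    (lab _ (hr n (hN hn)).1 _ hn).2 (hr n (hN hn)).2.symm
  refine ⟨fun n => l (r n), ⟨hf, h.inj, fun x => hN (h.mem x), fun i => ?_, fun m hm n hn => ?_,
    fun x => ?_, fun x => ?_⟩, hl⟩
  · obtain ⟨n, hn, rfl⟩ := h.surj i
    exact ⟨n, hN hn, hl n hn⟩
  · rw [lab _ (hr m hm).1 _ (hr n hn).1]
    exact ⟨fun a => (hr m hm).2.trans (a.trans (hr n hn).2.symm),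
      fun a => (hr m hm).2.symm.trans (a.trans (hr n hn).2)⟩
  · rw [hl _ (h.mem x), h.part]
  · rw [h.next, ← skipAll_union]
    congr 2
    ext n
    simp only [Finset.mem_filter, Finset.mem_union, Finset.mem_sdiff]
    constructor
    · rintro (⟨a, b⟩ | ⟨a, b⟩)
      · exact ⟨a, by rintro ⟨y, rfl⟩; exact b (h.mem y)⟩
      · exact ⟨hN a, b⟩
    · rintro ⟨a, b⟩
      by_cases c : n ∈ N
      · exact .inr ⟨c, b⟩
      · exact .inl ⟨a, c⟩

/-- Inserting a new element `c` after `q`. -/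
theorem exists_insert (h : IsModel X f N e l) {q c : B} (hq : q ∈ N) (hc : c ∉ N) :
    ∃ l' : B → X.index, IsModel X (glue f q c) (insert c N) e l' ∧ (∀ n ∈ N, l' n = l n) ∧
      l' c = l q := by
  have hqc : q ≠ c := fun e => hc (e ▸ hq)
  have hs : insert c N \ N = {c} := by
    ext n; simp only [Finset.mem_sdiff, Finset.mem_insert, Finset.mem_singleton]
    constructor
    · rintro ⟨a | a, b⟩
      exacts [a, (b a).elim]
    · rintro rfl; exact ⟨.inl rfl, hc⟩
  have hcq : (glue f q c).SameCycle c q := by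
    have : glue f q c q = c := by rw [glue_apply, if_pos rfl, h.fix c hc]
    have h2 : (glue f q c).SameCycle (glue f q c q) q := Perm.sameCycle_apply_left.2 Perm.SameCycle.rfl
    rwa [this] at h2
  have h1 : IsModel X (skipAll (glue f q c) (insert c N \ N)) N e l := by
    rw [hs, skipAll_singleton, skip_glue_of_fixed (h.fix c hc) hqc]
    exact h
  obtain ⟨l', h2, h3⟩ := h1.extend (Finset.subset_insert _ _) (fun n hn => by
      rw [Finset.mem_insert, not_or] at hn
      exact glue_fix (h.fix n hn.2) (fun e => hn.2 (e ▸ hq)) hn.1) (fun n hn => by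
      rcases Finset.mem_insert.1 hn with rfl | hn
      · exact ⟨q, hq, hcq⟩
      · exact ⟨n, hn, Perm.SameCycle.rfl⟩)
  refine ⟨l', h2, h3, ?_⟩
  rw [← h3 q hq]
  exact (h2.lab _ (Finset.mem_insert_self _ _) _ (Finset.mem_insert_of_mem hq)).2 hcq

end IsModel

/-- The multicyclically ordered set with a given model. -/
theorem exists_of_model {f : Perm B} {N T : Finset B} (hf : ∀ n ∉ N, f n = n) (hT : T ⊆ N)
    (hN : N.Nonempty) : ∃ (X : MultCyc) (e : X.carrier → B) (l : B → X.index),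
      IsModel X f N e l ∧ Set.range e = T := by
  obtain ⟨g, hg⟩ := exists_restrict hf
  have hfix : ∀ n ∉ T, skipAll f (N \ T) n = n := fun n hn => by
    by_cases h : n ∈ N
    · exact skipAll_mem _ (by simp [h, hn])
    · exact skipAll_fix _ (hf n h)
  obtain ⟨p, hp⟩ := exists_restrict hfix
  obtain ⟨n₀, hn₀⟩ := hN
  let X : MultCyc :=
    { carrier := {x // x ∈ T}
      index := Orb g
      nonempty_index := ⟨Quotient.mk _ ⟨n₀, hn₀⟩⟩
      part := fun x => Quotient.mk _ ⟨x.1, hT x.2⟩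
      next := p
      sameCycle_iff := fun x y => by
        rw [orb_eq, sameCycle_lift hp, sameCycle_lift hg, sameCycle_skipAll] <;> simp }
  -- Labels matter only on `N`; the class of `n₀` is a default value elsewhere.
  refine ⟨X, Subtype.val, fun n => if h : n ∈ N then Quotient.mk _ ⟨n, h⟩ else Quotient.mk _ ⟨n₀, hn₀⟩,
    ⟨hf, Subtype.val_injective, fun x => hT x.2, fun i => ?_, fun m hm n hn => ?_, fun x => ?_,
      fun x => ?_⟩, by simp [X]⟩
  · induction i using Quotient.inductionOn with | _ n =>
    exact ⟨n.1, n.2, by simp [n.2]⟩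
  · simp only [hm, hn, dif_pos]
    exact orb_eq.trans (sameCycle_lift hg _ _)
  · simp only [hT x.2, dif_pos]
    rfl
  · refine (hp x).trans ?_
    congr 2
    ext n
    simp [X]

/-- Every multicyclically ordered set has a model, with a given embedding of the set and of its empty
parts. -/
theorem exists_model (X : MultCyc) (j : X.carrier ⊕ X.Empties → B) (hj : Function.Injective j) :
    ∃ (f : Perm B) (N : Finset B) (l : B → X.index), IsModel X f N (j ∘ Sum.inl) l ∧
      ∀ n, n ∈ N ↔ n ∈ Set.range j := by
  have := Fintype.ofFinite (X.carrier ⊕ X.Empties)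
  let e : X.carrier ⊕ X.Empties ≃ Set.range j := Equiv.ofInjective j hj
  -- Each empty part is represented by a dummy that is a fixed point of `f`.
  let f : Perm B := (Perm.sumCongr X.next (Equiv.refl X.Empties)).extendDomain e
  have hfj : ∀ z, f (j z) = j (Perm.sumCongr X.next (Equiv.refl X.Empties) z) := fun z =>
    Perm.extendDomain_apply_image _ e z
  obtain ⟨i₀⟩ := X.nonempty_index
  let lz : X.carrier ⊕ X.Empties → X.index := Sum.elim X.part Subtype.val
  have hlz : ∀ z w, lz z = lz w ↔ f.SameCycle (j z) (j w) := by
    intro z w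
    constructor
    · intro h
      rcases z with x | i <;> rcases w with y | k
      · exact sameCycle_of_step (r := (Perm.SameCycle.setoid f).comap (j ∘ Sum.inl)) (fun z => by
          change f.SameCycle (j (.inl z)) (j (.inl (X.next z)))
          have : j (.inl (X.next z)) = f (j (.inl z)) := (hfj (.inl z)).symm
          rw [this, Perm.sameCycle_apply_right]) ((X.sameCycle_iff x y).2 h)
      · exact (k.2 _ h).elim
      · exact (i.2 _ h.symm).elim
      · have : i = k := Subtype.ext h
        subst this; exact Perm.SameCycle.rfl
    · intro h
      -- With the value `none` off the image of `j`, the label is invariant under `f` on all of `B`,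
      -- hence constant on its cycles.
      let l : B → Option X.index := fun n => if h : n ∈ Set.range j then some (lz h.choose) else none
      have hl : ∀ z, l (j z) = some (lz z) := fun z => by
        have h1 : j z ∈ Set.range j := ⟨z, rfl⟩
        simp only [l, dif_pos h1]
        rw [hj h1.choose_spec]
      have := sameCycle_of_step (r := Setoid.comap l ⊥) (fun n => by
        change l n = l (f n)
        by_cases hn : n ∈ Set.range j
        · obtain ⟨z, rfl⟩ := hn
          rw [hfj, hl, hl]
          rcases z with x | i
          · exact congrArg some ((X.sameCycle_iff _ _).1 (Perm.sameCycle_apply_right.2 Perm.SameCycle.rfl))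
          · rfl
        · rw [Perm.extendDomain_apply_not_subtype _ e hn]) h
      change l (j z) = l (j w) at this
      rw [hl, hl] at this
      exact Option.some_injective _ this
  refine ⟨f, Finset.univ.map ⟨j, hj⟩,
    fun n => if h : n ∈ Set.range j then lz h.choose else i₀, ?_, fun n => by simp⟩
  have hl : ∀ z, (fun n => if h : n ∈ Set.range j then lz h.choose else i₀) (j z) = lz z := fun z => by
    have h1 : j z ∈ Set.range j := ⟨z, rfl⟩
    simp only [dif_pos h1]
    rw [hj h1.choose_spec]
  generalize (fun n => if h : n ∈ Set.range j then lz h.choose else i₀) = l at hl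
  refine ⟨fun n hn => Perm.extendDomain_apply_not_subtype _ e (by simpa using hn),
    hj.comp Sum.inl_injective, fun x => by simp, fun i => ?_, fun m hm n hn => ?_, fun x => hl _,
    fun x => ?_⟩
  · rcases MultCyc.part_surj_or i with ⟨x, rfl⟩ | h
    · exact ⟨j (.inl x), by simp, hl _⟩
    · exact ⟨j (.inr ⟨i, h⟩), by simp, hl _⟩
  · rw [Finset.mem_map] at hm hn
    obtain ⟨z, -, rfl⟩ := hm
    obtain ⟨w, -, rfl⟩ := hn
    change l (j z) = l (j w) ↔ f.SameCycle (j z) (j w)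
    rw [hl, hl, hlz]
  · rw [skipAll_of_fixed, Function.comp_apply, Function.comp_apply, hfj]
    · rfl
    · intro a ha
      rw [IsModel.mem_dummies, Finset.mem_map] at ha
      obtain ⟨⟨z, -, rfl⟩, h2⟩ := ha
      rcases z with x | i
      · exact (h2 x rfl).elim
      · exact hfj _

/-- Infinitely many elements of `B` lie outside `N`, so the points outside `K` can be sent to fresh
ones. This makes the dummies of a second model disjoint from a first model. -/
theorem exists_extension [Infinite B] {γ : Type} [Finite γ] (K : Set γ) (e : γ → B)
    (he : Set.InjOn e K) (N : Finset B) (hN : ∀ z ∈ K, e z ∈ N) :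
    ∃ j : γ → B, Function.Injective j ∧ (∀ z ∈ K, j z = e z) ∧ ∀ z ∉ K, j z ∉ N := by
  have hinf : Infinite {b : B // b ∉ N} := (Finset.finite_toSet N).infinite_compl.to_subtype
  let k : γ ↪ {b : B // b ∉ N} := ((Finite.equivFin γ).toEmbedding.trans Fin.valEmbedding).trans
    (Infinite.natEmbedding _)
  refine ⟨fun z => if z ∈ K then e z else k z, fun z w h => ?_, fun z hz => if_pos hz, fun z hz => ?_⟩
  · dsimp only at h
    split_ifs at h with h1 h2 h2
    · exact he h1 h2 h
    · exact ((k w).2 (h ▸ hN z h1)).elim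
    · exact ((k z).2 (h ▸ hN w h2)).elim
    · exact k.injective (Subtype.ext h)
  · simp only [if_neg hz]
    exact (k z).2

end

/-! ### Gluing in terms of models. -/

section

section Embedding
variable {α β : Type}

theorem sameCycle_embedding {f : Perm α} {g : Perm β} {e : α → β} (he : Function.Injective e)
    (h : ∀ x, e (f x) = g (e x)) (x y : α) : f.SameCycle x y ↔ g.SameCycle (e x) (e y) := by
  let e' : α ≃ {b // b ∈ Set.range e} := Equiv.ofInjective e he
  let g' : Perm {b // b ∈ Set.range e} := (e'.symm.trans f).trans e'
  have hg' : ∀ b, (g' b : β) = g b := fun b => by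
    obtain ⟨x, rfl⟩ := e'.surjective b
    change (e' (f (e'.symm (e' x))) : β) = _
    rw [symm_apply_apply]
    exact h x
  rw [sameCycle_semiconj (g := g') e' (fun x => by simp [g']), sameCycle_lift hg']
  rfl

theorem glue_embedding {f : Perm α} {g : Perm β} {e : α → β} (he : Function.Injective e)
    (h : ∀ x, e (f x) = g (e x)) (c d x : α) : e (glue f c d x) = glue g (e c) (e d) (e x) := by
  simp only [glue_apply, ← h, he.eq_iff]
  split_ifs <;> rfl

end Embedding

variable {B : Type}

namespace IsModel
variable {X Y : MultCyc} {f : Perm B} {N : Finset B} {e : X.carrier → B} {l : B → X.index}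
  {e' : Y.carrier → B} {l' : B → Y.index}

theorem sameCycle_glue_iff (h : IsModel X f N e l) (u v x y : X.carrier) :
    (glue X.next u v).SameCycle x y ↔ (glue f (e u) (e v)).SameCycle (e x) (e y) := by
  rw [sameCycle_embedding h.inj (glue_embedding h.inj h.next u v),
    ← skipAll_glue _ (notMem_dummies _) (notMem_dummies _),
    sameCycle_skipAll _ (notMem_dummies _) (notMem_dummies _)]

theorem sameCycle_glue_glue_iff (h : IsModel X f N e l) (a b c d x y : X.carrier) :
    (glue (glue X.next a b) c d).SameCycle x y ↔
      (glue (glue f (e a) (e b)) (e c) (e d)).SameCycle (e x) (e y) := by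
  rw [sameCycle_embedding h.inj (glue_embedding h.inj (glue_embedding h.inj h.next a b) c d),
    ← skipAll_glue _ (notMem_dummies _) (notMem_dummies _),
    ← skipAll_glue _ (notMem_dummies _) (notMem_dummies _),
    sameCycle_skipAll _ (notMem_dummies _) (notMem_dummies _)]

/-- The labels of the parts of the multicyclically ordered set obtained by gluing. -/
structure IsCutLabel {X : MultCyc} (f : Perm B) (N : Finset B) (e : X.carrier → B)
    (l : B → X.index) (u v : X.carrier) (l' : B → (X.cut u v).index) : Prop where
  inr : ∀ n ∈ N, ∀ y, (glue f (e u) (e v)).SameCycle n (e y) → l' n = Sum.inr (Quotient.mk _ y)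
  inl : ∀ n ∈ N, (¬ ∃ y, (glue f (e u) (e v)).SameCycle n (e y)) → ∃ h, l' n = Sum.inl ⟨l n, h⟩

/-- Nothing is removed from the model when gluing: `u` and `v` merely become dummies, and `f` is
multiplied by a transposition. A cycle left without elements of `X` other than `u` and `v` is then a
cycle of dummies, that is, a new empty part. -/
theorem exists_cut (h : IsModel X f N e l) {u v : X.carrier} :
    ∃ l', IsModel (X.cut u v) (glue f (e u) (e v)) N (fun x => e x.1) l' ∧
      IsCutLabel f N e l u v l' := by
  set F := glue f (e u) (e v) with hF
  -- A cycle containing an element of `X` is labelled by its class; any other one is an empty part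
  -- of `X` and keeps its label. The last alternative is a default value that does not occur on `N`.
  let l' : B → (X.cut u v).index := fun n =>
    if H : ∃ y, F.SameCycle n (e y) then Sum.inr (Quotient.mk _ H.choose)
    else if H' : ∀ x, X.part x ≠ l n then Sum.inl ⟨l n, H'⟩ else Sum.inr (Quotient.mk _ u)
  have havoid : ∀ n, (¬ ∃ y, F.SameCycle n (e y)) → ∀ m, f.SameCycle n m ↔ F.SameCycle n m := by
    intro n hn
    have h1 : ∀ z, F.SameCycle n z → z ≠ e u ∧ z ≠ e v := fun z hz =>
      ⟨fun hc => hn ⟨u, hc ▸ hz⟩, fun hc => hn ⟨v, hc ▸ hz⟩⟩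
    intro m
    have := sameCycle_glue_avoid h1 m
    rwa [hF, glue_glue] at this
  have hr : ∀ n ∈ N, ∀ y, F.SameCycle n (e y) → l' n = Sum.inr (Quotient.mk _ y) := by
    intro n hn y hy
    have H : ∃ y, F.SameCycle n (e y) := ⟨y, hy⟩
    simp only [l', dif_pos H]
    refine congrArg Sum.inr (orb_eq.2 ?_)
    rw [h.sameCycle_glue_iff]
    exact H.choose_spec.symm.trans hy
  have hl : ∀ n ∈ N, (¬ ∃ y, F.SameCycle n (e y)) → ∃ h, l' n = Sum.inl ⟨l n, h⟩ := by
    intro n hn H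
    have H' : ∀ x, X.part x ≠ l n := fun x hx => H ⟨x, by
      rw [← havoid n H]
      rw [← h.part, h.lab _ (h.mem x) _ hn] at hx
      exact hx.symm⟩
    exact ⟨H', by simp only [l', dif_neg H, dif_pos H']⟩
  have hfix : ∀ n ∉ N, F n = n := fun n hn => glue_fix (h.fix n hn)
    (fun hc => hn (hc ▸ h.mem u)) (fun hc => hn (hc ▸ h.mem v))
  refine ⟨l', ⟨hfix, fun x y hxy => Subtype.ext (h.inj hxy), fun x => h.mem _, ?_, ?_, fun x => ?_,
    fun x => ?_⟩, ⟨hr, hl⟩⟩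
  · rintro (⟨i, hi⟩ | q)
    · obtain ⟨n, hn, rfl⟩ := h.surj i
      refine ⟨n, hn, ?_⟩
      obtain ⟨_, h1⟩ := hl n hn (fun ⟨y, hy⟩ => by
        have h1 : ∀ z, f.SameCycle n z → z ≠ e u ∧ z ≠ e v := fun z hz =>
          ⟨fun hc => hi u (by rw [← h.part, eq_comm, h.lab _ hn _ (h.mem _), ← hc]; exact hz),
            fun hc => hi v (by rw [← h.part, eq_comm, h.lab _ hn _ (h.mem _), ← hc]; exact hz)⟩
        have := (sameCycle_glue_avoid h1 _).1 hy
        exact hi y (by rw [← h.part, eq_comm, h.lab _ hn _ (h.mem _)]; exact this))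
      exact h1
    · induction q using Quotient.inductionOn with | _ y =>
      exact ⟨e y, h.mem y, hr _ (h.mem y) y Perm.SameCycle.rfl⟩
  · intro m hm n hn
    by_cases H : ∃ y, F.SameCycle m (e y)
    · obtain ⟨y, hy⟩ := H
      rw [hr m hm y hy]
      constructor
      · intro hh
        by_cases H' : ∃ y, F.SameCycle n (e y)
        · obtain ⟨z, hz⟩ := H'
          rw [hr n hn z hz, Sum.inr.injEq, orb_eq, h.sameCycle_glue_iff] at hh
          exact hy.trans (hh.trans hz.symm)
        · obtain ⟨_, h1⟩ := hl n hn H'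
          rw [h1] at hh; cases hh
      · intro hh
        exact (hr n hn y (hh.symm.trans hy)).symm
    · obtain ⟨_, h1⟩ := hl m hm H
      rw [h1]
      by_cases H' : ∃ y, F.SameCycle n (e y)
      · obtain ⟨z, hz⟩ := H'
        rw [hr n hn z hz]
        exact ⟨fun hh => (Sum.inl_ne_inr hh).elim, fun hh => (H ⟨z, hh.trans hz⟩).elim⟩
      · obtain ⟨_, h2⟩ := hl n hn H'
        rw [h2, Sum.inl.injEq, Subtype.mk.injEq, h.lab m hm n hn]
        exact havoid m H n
  · exact hr _ (h.mem _) _ Perm.SameCycle.rfl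
  -- The dummies after gluing are the old ones together with `u` and `v`, so skipping them is
  -- skipping the old ones and then performing the gluing of `X`.
  · have hD : N.filter (· ∉ Set.range (fun x : (X.cut u v).carrier => e x.1)) =
        insert (e v) (insert (e u) (N.filter (· ∉ Set.range e))) := by
      ext n
      rw [mem_dummies, Finset.mem_insert, Finset.mem_insert, mem_dummies]
      constructor
      · rintro ⟨h1, h2⟩
        by_cases hv : n = e v
        · exact .inl hv
        by_cases hu : n = e u
        · exact .inr (.inl hu)
        refine .inr (.inr ⟨h1, fun x hx => h2 ⟨x, ?_, ?_⟩ hx⟩)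
        · rintro rfl; exact hu hx.symm
        · rintro rfl; exact hv hx.symm
      · rintro (rfl | rfl | ⟨h1, h2⟩)
        · exact ⟨h.mem v, fun x hx => x.2.2 (h.inj hx)⟩
        · exact ⟨h.mem u, fun x hx => x.2.1 (h.inj hx)⟩
        · exact ⟨h1, fun x => h2 x.1⟩
    rw [hD, skipAll_insert, skipAll_insert, skipAll_glue _ (notMem_dummies _) (notMem_dummies _)]
    have h1 := glue_embedding h.inj h.next u v
    have h2 : ∀ x, e (skip (glue X.next u v) u x) =
        skip (glue (skipAll f (N.filter (· ∉ Set.range e))) (e u) (e v)) (e u) (e x) := fun x => by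
      simp only [skip_apply, ← h1, h.inj.eq_iff]
      split_ifs <;> rfl
    change e (skip (skip (glue X.next u v) u) v x.1) = _
    rw [skip_apply, skip_apply _ (e v)]
    simp only [← h2, h.inj.eq_iff]
    split_ifs <;> rfl

/-- The canonical isomorphism between the two ways of gluing two pairs preserves the labels. -/
theorem isModelHom_cutComm (h : IsModel X f N e l) {a b c d : X.carrier} (hac : a ≠ c) (had : a ≠ d)
    (hbc : b ≠ c) (hbd : b ≠ d) {l₁ : B → (X.cut a b).index} {l₂ : B → (X.cut c d).index}
    {l₁₂ : B → ((X.cut a b).cut ⟨c, hac.symm, hbc.symm⟩ ⟨d, had.symm, hbd.symm⟩).index}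
    {l₂₁ : B → ((X.cut c d).cut ⟨a, hac, had⟩ ⟨b, hbc, hbd⟩).index}
    (h₁ : IsCutLabel f N e l a b l₁)
    (h₁₂ : IsCutLabel (X := X.cut a b) (glue f (e a) (e b)) N (fun x => e x.1) l₁
      ⟨c, hac.symm, hbc.symm⟩ ⟨d, had.symm, hbd.symm⟩ l₁₂)
    (h₂ : IsCutLabel f N e l c d l₂)
    (h₂₁ : IsCutLabel (X := X.cut c d) (glue f (e c) (e d)) N (fun x => e x.1) l₂
      ⟨a, hac, had⟩ ⟨b, hbc, hbd⟩ l₂₁) :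
    IsModelHom (MultCyc.cutComm (X := X) hac had hbc hbd) N (fun x => e x.1.1) l₁₂
      (fun x => e x.1.1) l₂₁ := by
  -- `cutComm` is defined by mapping both index sets to a common one with `cutcutIndex`. There the
  -- label of `n` depends only on its cycle under the doubly glued permutation and on `l n`, hence
  -- not on the order of the gluings.
  have key : ∀ {a b c d : X.carrier} (hac : a ≠ c) (had : a ≠ d)
      (hbc : b ≠ c) (hbd : b ≠ d) {l₁ : B → (X.cut a b).index}
      {l₁₂ : B → ((X.cut a b).cut ⟨c, hac.symm, hbc.symm⟩ ⟨d, had.symm, hbd.symm⟩).index}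
      (h₁ : IsCutLabel f N e l a b l₁)
      (h₁₂ : IsCutLabel (X := X.cut a b) (glue f (e a) (e b)) N (fun x => e x.1) l₁
        ⟨c, hac.symm, hbc.symm⟩ ⟨d, had.symm, hbd.symm⟩ l₁₂),
      ∀ n ∈ N, (∀ z, (glue (glue f (e a) (e b)) (e c) (e d)).SameCycle n (e z) →
        MultCyc.cutcutIndex hac had hbc hbd (l₁₂ n) = Sum.inr (Quotient.mk _ z)) ∧
      ((¬ ∃ z, (glue (glue f (e a) (e b)) (e c) (e d)).SameCycle n (e z)) → ∃ hh,
        MultCyc.cutcutIndex hac had hbc hbd (l₁₂ n) = Sum.inl ⟨l n, hh⟩) := by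
    intro a b c d hac had hbc hbd l₁ l₁₂ h₁ h₁₂ n hn
    constructor
    · intro z hz
      by_cases H : ∃ y : (X.cut a b).carrier, (glue (glue f (e a) (e b)) (e c) (e d)).SameCycle n (e y.1)
      · obtain ⟨y, hy⟩ := H
        rw [h₁₂.inr n hn y hy]
        refine congrArg Sum.inr (orb_eq.2 ?_)
        rw [h.sameCycle_glue_glue_iff]
        exact hy.symm.trans hz
      -- Among the elements of `X`, this cycle contains none but `a` and `b`; the part has already
      -- become empty with the first gluing and is unaffected by the second.
      · obtain ⟨hh, h3⟩ := h₁₂.inl n hn H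
        have hav : ∀ w, (glue (glue f (e a) (e b)) (e c) (e d)).SameCycle n w → w ≠ e c ∧ w ≠ e d :=
          fun w hw => ⟨fun hc => H ⟨⟨c, hac.symm, hbc.symm⟩, hc ▸ hw⟩,
            fun hc => H ⟨⟨d, had.symm, hbd.symm⟩, hc ▸ hw⟩⟩
        have hav' := sameCycle_glue_avoid hav
        rw [glue_glue] at hav'
        have h4 := h₁.inr n hn z ((hav' _).2 hz)
        rw [h3]
        have h5 : ∀ (i : (X.cut a b).index) (hi : ∀ x, (X.cut a b).part x ≠ i),
            i = Sum.inr (Quotient.mk _ z) →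
            MultCyc.cutcutIndex hac had hbc hbd (Sum.inl ⟨i, hi⟩) = Sum.inr (Quotient.mk _ z) := by
          rintro i hi rfl
          refine congrArg Sum.inr (orb_eq.2 ?_)
          rw [h.sameCycle_glue_glue_iff]
          have h6 := (orb_eq (f := glue X.next a b)).1 (Quotient.out_eq (Quotient.mk _ z))
          rw [h.sameCycle_glue_iff] at h6
          exact ((hav' _).1 (((hav' _).2 hz).trans h6.symm)).symm.trans hz
        exact h5 _ _ h4
    · intro H
      obtain ⟨h3, h4⟩ := h₁₂.inl n hn (fun ⟨y, hy⟩ => H ⟨y.1, hy⟩)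
      have hav : ∀ w, (glue (glue f (e a) (e b)) (e c) (e d)).SameCycle n w → w ≠ e c ∧ w ≠ e d :=
        fun w hw => ⟨fun hc => H ⟨c, hc ▸ hw⟩, fun hc => H ⟨d, hc ▸ hw⟩⟩
      have hav' := sameCycle_glue_avoid hav
      rw [glue_glue] at hav'
      obtain ⟨h5, h6⟩ := h₁.inl n hn (fun ⟨y, hy⟩ => H ⟨y, (hav' _).1 hy⟩)
      refine ⟨h5, ?_⟩
      rw [h4]
      have h7 : ∀ (i : (X.cut a b).index) (hi : ∀ x, (X.cut a b).part x ≠ i),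
          i = Sum.inl ⟨l n, h5⟩ →
          MultCyc.cutcutIndex hac had hbc hbd (Sum.inl ⟨i, hi⟩) = Sum.inl ⟨l n, h5⟩ := by
        rintro i hi rfl; rfl
      exact h7 _ _ h6
  refine ⟨fun _ => rfl, fun n hn => ?_⟩
  apply (Equiv.ofBijective _ (MultCyc.cutcutIndex_bijective hac.symm hbc.symm had.symm hbd.symm)).injective
  refine (Equiv.apply_symm_apply (Equiv.ofBijective _
    (MultCyc.cutcutIndex_bijective hac.symm hbc.symm had.symm hbd.symm)) _).trans ?_
  change _ = MultCyc.cutcutIndex hac.symm hbc.symm had.symm hbd.symm (l₂₁ n)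
  obtain ⟨k1, k2⟩ := key hac had hbc hbd h₁ h₁₂ n hn
  obtain ⟨k3, k4⟩ := key hac.symm hbc.symm had.symm hbd.symm h₂ h₂₁ n hn
  rw [glue_comm _ (h.inj.ne hac.symm) (h.inj.ne hbc.symm) (h.inj.ne had.symm) (h.inj.ne hbd.symm)]
    at k3 k4
  by_cases H : ∃ z, (glue (glue f (e a) (e b)) (e c) (e d)).SameCycle n (e z)
  · obtain ⟨z, hz⟩ := H
    rw [k3 z hz]
    refine (congrArg _ (k1 z hz)).trans ?_
    rfl
  · obtain ⟨_, h3⟩ := k4 H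
    obtain ⟨_, h4⟩ := k2 H
    rw [h3]
    refine (congrArg _ h4).trans ?_
    rfl

end IsModel

end

/-! ### Amalgamation of two models. -/

section

variable {B : Type}

namespace IsModel
variable {X : MultCyc} {f f' : Perm B} {N N' : Finset B} {e : X.carrier → B} {l l' : B → X.index}

/-- Without dummies, every model is the successor map of `X` on the image of `e` and the identity
elsewhere. -/
theorem skipAll_dummies_eq (h : IsModel X f N e l) (h' : IsModel X f' N' e l') :
    skipAll f (N.filter (· ∉ Set.range e)) = skipAll f' (N'.filter (· ∉ Set.range e)) := by
  have key : ∀ {f : Perm B} {N : Finset B} {l : B → X.index}, IsModel X f N e l →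
      ∀ n ∉ Set.range e, skipAll f (N.filter (· ∉ Set.range e)) n = n := by
    intro f N l h n hn
    by_cases hN : n ∈ N
    · exact skipAll_mem _ (Finset.mem_filter.2 ⟨hN, hn⟩)
    · exact skipAll_fix _ (h.fix n hN)
  ext n
  by_cases hn : n ∈ Set.range e
  · obtain ⟨x, rfl⟩ := hn
    rw [← h.next, ← h'.next]
  · rw [key h n hn, key h' n hn]

/-- The dummies of the second model are inserted into the first one at a time, `K` being the set of
those already inserted. The two equations with `skipAll F` are the invariants: removing `K` gives
back the first model, and removing the dummies of the first model gives the second one without its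
dummies outside `K`. -/
theorem amalgamate_aux (h : IsModel X f N e l) (h' : IsModel X f' N' e l')
    (hd : ∀ n ∈ N, n ∈ N' → n ∈ Set.range e) (K : Finset B)
    (hK : K ⊆ N'.filter (· ∉ Set.range e)) :
    ∃ (F : Perm B) (L : B → X.index), IsModel X F (N ∪ K) e L ∧ skipAll F K = f ∧
      (∀ n ∈ N, L n = l n) ∧ (∀ n ∈ K, L n = l' n) ∧
      skipAll F (N.filter (· ∉ Set.range e)) = skipAll f' (N'.filter (· ∉ Set.range e) \ K) := by
  induction K using Finset.induction_on with
  | empty =>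
    refine ⟨f, l, by simpa using h, rfl, fun _ _ => rfl, by simp, ?_⟩
    rw [Finset.sdiff_empty]
    exact h.skipAll_dummies_eq h'
  | insert c K hcK ih =>
    obtain ⟨F, L, hF, hFK, hLl, hLl', hFD⟩ := ih ((Finset.subset_insert _ _).trans hK)
    set D := N.filter (· ∉ Set.range e) with hD
    set D' := N'.filter (· ∉ Set.range e) with hD'
    have hcD' : c ∈ D' := hK (Finset.mem_insert_self _ _)
    have hKN' : ∀ n ∈ K, n ∈ N' := fun n hn =>
      (Finset.mem_filter.1 (hK (Finset.mem_insert_of_mem hn))).1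
    have hKN : ∀ n ∈ D', n ∉ N := fun n hn hN =>
      (Finset.mem_filter.1 hn).2 (hd n hN (Finset.mem_filter.1 hn).1)
    have hc : c ∉ N ∪ K := by
      rw [Finset.mem_union, not_or]; exact ⟨hKN c hcD', hcK⟩
    have hcN' : c ∈ N' := (Finset.mem_filter.1 hcD').1
    have hcD : c ∉ D := fun hh => hKN c hcD' (Finset.mem_filter.1 hh).1
    have hcE : c ∉ D' \ insert c K := by simp
    have hins : D' \ K = insert c (D' \ insert c K) := by
      ext n
      simp only [Finset.mem_sdiff, Finset.mem_insert, not_or]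
      constructor
      · rintro ⟨a, b⟩
        by_cases hn : n = c
        · exact .inl hn
        · exact .inr ⟨a, hn, b⟩
      · rintro (rfl | ⟨a, -, b⟩)
        exacts [⟨hcD', hcK⟩, ⟨a, b⟩]
    have hU : insert c (N ∪ K) = N ∪ insert c K := (Finset.union_insert _ _ _).symm
    have hLT : ∀ n ∈ Set.range e, L n = l' n := by
      rintro _ ⟨x, rfl⟩
      rw [hF.part, h'.part]
    rw [hins, skipAll_insert] at hFD
    set p := skipAll f' (D' \ insert c K) with hp
    have hE : ∀ n, n ∈ Set.range e ∨ n ∈ K → n ∈ N' ∧ n ∉ D' \ insert c K ∧ L n = l' n := by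
      rintro n (hn | hn)
      · refine ⟨?_, fun hh => ?_, hLT n hn⟩
        · obtain ⟨x, rfl⟩ := hn; exact h'.mem x
        · exact (Finset.mem_filter.1 (Finset.mem_sdiff.1 hh).1).2 hn
      · exact ⟨hKN' n hn, by simp [hn], hLl' n hn⟩
    -- `p` is the second model with only `K` and `c` left among its dummies. If `c` is isolated
    -- there, only its label constrains its place: it may follow any element of `N` with that label.
    by_cases hpc : p c = c
    · rw [skip_of_fixed hpc] at hFD
      obtain ⟨r, hr, hlr⟩ := h.surj (l' c)
      obtain ⟨L₂, h2, hL2, hL2c⟩ := hF.exists_insert (q := r) (Finset.mem_union_left _ hr) hc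
      have hrc : r ≠ c := fun hh => hKN c hcD' (hh ▸ hr)
      have hskip : skip (glue F r c) c = F := skip_glue_of_fixed (hF.fix c hc) hrc
      rw [hU] at h2
      have hL2c' : L₂ c = l' c := by rw [hL2c, hLl r hr, hlr]
      refine ⟨_, L₂, h2, ?_, fun n hn => ?_, fun n hn => ?_, ?_⟩
      · rw [skipAll_insert, ← skipAll_skip, hskip, hFK]
      · rw [hL2 n (Finset.mem_union_left _ hn), hLl n hn]
      · rcases Finset.mem_insert.1 hn with rfl | hn
        · exact hL2c'
        · rw [hL2 n (Finset.mem_union_right _ hn), hLl' n hn]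
      -- When the dummies of the first model are removed, `c` has to become isolated. A successor `w
      -- ≠ c` would be an element of `X` or of `K` with the same label, hence on the cycle of `c`
      -- under `p`.
      · have hfix : skipAll (glue F r c) D c = c := by
          by_contra hw
          set w := skipAll (glue F r c) D c with hwdef
          have hw2 : skipAll (glue F r c) D w ≠ w := fun hh =>
            hw ((skipAll (glue F r c) D).injective hh)
          have hwD : w ∉ D := fun hh => hw2 (skipAll_mem _ hh)
          have hwN : w ∈ N ∪ insert c K := by
            by_contra hh; exact hw2 (skipAll_fix _ (h2.fix w hh))
          have hwTK : w ∈ Set.range e ∨ w ∈ K := by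
            rcases Finset.mem_union.1 hwN with h3 | h3
            · by_contra hh
              rw [not_or] at hh
              exact hwD (Finset.mem_filter.2 ⟨h3, hh.1⟩)
            · exact .inr ((Finset.mem_insert.1 h3).resolve_left hw)
          obtain ⟨hwN', hwE, hLw⟩ := hE w hwTK
          have hsc : (glue F r c).SameCycle c w := by
            rw [← sameCycle_skipAll _ hcD hwD, hwdef, Perm.sameCycle_apply_right]
          rw [← h2.lab c (by simp) w hwN, hL2c', hL2 w (by
            rcases Finset.mem_union.1 hwN with h3 | h3
            · exact Finset.mem_union_left _ h3
            · exact Finset.mem_union_right _ ((Finset.mem_insert.1 h3).resolve_left hw)), hLw,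
            h'.lab c hcN' w hwN', ← sameCycle_skipAll f' hcE hwE] at hsc
          exact hw (hsc.eq_of_left hpc).symm
        rw [← skip_of_fixed hfix, ← skipAll_skip, hskip, hFD]
    -- Otherwise `c` is inserted directly after its predecessor under `p`, which is an element of
    -- `X` or of `K` and thus already present.
    · set q := p.symm c with hq
      have hpq : p q = c := apply_symm_apply _ _
      have hqc : q ≠ c := fun hh => hpc (by rw [← hh, hpq, hh])
      have hqp : p q ≠ q := by rw [hpq]; exact hqc.symm
      have hqTK : q ∈ Set.range e ∨ q ∈ K := by
        by_contra hh
        rw [not_or] at hh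
        by_cases hqN' : q ∈ N'
        · exact hqp (skipAll_mem _ (by
            rw [Finset.mem_sdiff, Finset.mem_insert, not_or]
            exact ⟨Finset.mem_filter.2 ⟨hqN', hh.1⟩, hqc, hh.2⟩))
        · exact hqp (skipAll_fix _ (h'.fix q hqN'))
      obtain ⟨hqN', hqE, hLq⟩ := hE q hqTK
      have hqNK : q ∈ N ∪ K := by
        rcases hqTK with ⟨x, hx⟩ | hh
        · exact Finset.mem_union_left _ (hx ▸ h.mem x)
        · exact Finset.mem_union_right _ hh
      have hqD : q ∉ D := fun hh => by
        rcases hqTK with h3 | h3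
        · exact (Finset.mem_filter.1 hh).2 h3
        · exact hKN q (hK (Finset.mem_insert_of_mem h3)) (Finset.mem_filter.1 hh).1
      obtain ⟨L₂, h2, hL2, hL2c⟩ := hF.exists_insert hqNK hc
      have hskip : skip (glue F q c) c = F := skip_glue_of_fixed (hF.fix c hc) hqc
      rw [hU] at h2
      refine ⟨_, L₂, h2, ?_, fun n hn => ?_, fun n hn => ?_, ?_⟩
      · rw [skipAll_insert, ← skipAll_skip, hskip, hFK]
      · rw [hL2 n (Finset.mem_union_left _ hn), hLl n hn]
      · rcases Finset.mem_insert.1 hn with rfl | hn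
        · rw [hL2c, hLq, h'.lab q hqN' n hcN', ← sameCycle_skipAll f' hqE hcE]
          change p.SameCycle q n
          have h9 : p.SameCycle q (p q) := Perm.sameCycle_apply_right.2 Perm.SameCycle.rfl
          rwa [hpq] at h9
        · rw [hL2 n (Finset.mem_union_right _ hn), hLl' n hn]
      · rw [skipAll_glue _ hqD hcD, hFD, glue_skip hpq]

/-- Two models of `X` with the same embedding of its elements, but otherwise disjoint, have a common
refinement. -/
theorem amalgamate (h : IsModel X f N e l) (h' : IsModel X f' N' e l')
    (hd : ∀ n ∈ N, n ∈ N' → n ∈ Set.range e) :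
    ∃ (F : Perm B) (L : B → X.index), IsModel X F (N ∪ N') e L ∧
      skipAll F ((N ∪ N') \ N) = f ∧ skipAll F ((N ∪ N') \ N') = f' ∧
      (∀ n ∈ N, L n = l n) ∧ (∀ n ∈ N', L n = l' n) := by
  obtain ⟨F, L, hF, h1, h2, h3, h4⟩ := h.amalgamate_aux h' hd _ (Finset.Subset.refl _)
  have e1 : N ∪ N'.filter (· ∉ Set.range e) = N ∪ N' := by
    ext n
    simp only [Finset.mem_union, Finset.mem_filter]
    constructor
    · rintro (a | ⟨a, -⟩)
      exacts [.inl a, .inr a]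
    · rintro (a | a)
      · exact .inl a
      · by_cases hn : n ∈ Set.range e
        · obtain ⟨x, rfl⟩ := hn; exact .inl (h.mem x)
        · exact .inr ⟨a, hn⟩
  have e2 : (N ∪ N') \ N = N'.filter (· ∉ Set.range e) := by
    ext n
    simp only [Finset.mem_union, Finset.mem_filter, Finset.mem_sdiff]
    constructor
    · rintro ⟨a, b⟩
      exact ⟨a.resolve_left b, by rintro ⟨x, rfl⟩; exact b (h.mem x)⟩
    · rintro ⟨a, b⟩
      exact ⟨.inr a, fun hh => b (hd n hh a)⟩
  have e3 : (N ∪ N') \ N' = N.filter (· ∉ Set.range e) := by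
    ext n
    simp only [Finset.mem_union, Finset.mem_filter, Finset.mem_sdiff]
    constructor
    · rintro ⟨a, b⟩
      exact ⟨a.resolve_right b, by rintro ⟨x, rfl⟩; exact b (h'.mem x)⟩
    · rintro ⟨a, b⟩
      exact ⟨.inl a, fun hh => b (hd n a hh)⟩
  rw [e1] at hF
  refine ⟨F, L, hF, by rw [e2, h1], by rw [e3, h4, Finset.sdiff_self, skipAll_empty], h2, fun n hn => ?_⟩
  by_cases hr : n ∈ Set.range e
  · obtain ⟨x, rfl⟩ := hr
    rw [hF.part, h'.part]
  · exact h3 n (Finset.mem_filter.2 ⟨hn, hr⟩)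

end IsModel

end

open MergeBase CutBase

/-! ### Reachable elements and their compositions. -/

section

section Elementwise
variable {G : Type*} [Category G]

theorem type_congr_hom {α β : Type u} {f g : α ⟶ β} (h : f = g) (a : α) : f a = g a := by rw [h]

theorem functor_map_map (F : G ⥤ Type u) {X Y Z : G} (φ : X ⟶ Y) (ψ : Y ⟶ Z) (x : F.obj X) :
    F.map ψ (F.map φ x) = F.map (φ ≫ ψ) x := by
  rw [F.map_comp]; rfl

theorem functor_map_id (F : G ⥤ Type u) {X : G} (x : F.obj X) : F.map (𝟙 X) x = x := by
  rw [F.map_id]; rfl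

variable [CutBase G] (Q : ModularOperad G (Type u))

theorem contr_symm_apply (g : ℕ) (X : G) {u v : El X} (h : u ≠ v) (x : (Q.obj g).obj X) :
    (Q.obj (g + 1)).map (cutSwap X u v) (Q.contr g X h x) = Q.contr g X h.symm x :=
  type_congr_hom (Q.contr_symm g X h) x

theorem contr_contr_apply (g : ℕ) (X : G) {a b c d : El X} (hab : a ≠ b) (hcd : c ≠ d) (hac : a ≠ c)
    (had : a ≠ d) (hbc : b ≠ c) (hbd : b ≠ d) (x : (Q.obj g).obj X) :
    (Q.obj (g + 1 + 1)).map (cutCut X a b c d hac had hbc hbd)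
      (Q.contr (g + 1) (cut X a b) (keep_ne hac.symm hbc.symm had.symm hbd.symm hcd)
        (Q.contr g X hab x)) =
      Q.contr (g + 1) (cut X c d) (keep_ne hac had hbc hbd hab) (Q.contr g X hcd x) :=
  type_congr_hom (Q.contr_contr g X hab hcd hac had hbc hbd) x

theorem contr_comp_apply {g' g'' g : ℕ} (hg : g' + g'' = g) (X Y : G) {a c : El X} {b d : El Y}
    (hac : a ≠ c) (hbd : b ≠ d) (x : (Q.obj g').obj X) (y : (Q.obj g'').obj Y) :
    (Q.obj (g + 1)).map (cutMerge X Y a c b d hac hbd)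
      (Q.contr g (merge X Y c d) (left_ne_right hac hbd) (Q.comp hg X Y c d (x, y))) =
      Q.contr g (merge X Y a b) (left_ne_right hac.symm hbd.symm) (Q.comp hg X Y a b (x, y)) :=
  let p : _ × _ := (x, y); type_congr_hom (Q.contr_comp hg X Y hac hbd) p

theorem comp_contr_apply {g' g'' g : ℕ} (hg : g' + g'' = g) (hg' : g' + 1 + g'' = g + 1) (X Y : G)
    {a c d : El X} (b : El Y) (hac : a ≠ c) (had : a ≠ d) (hcd : c ≠ d) (x : (Q.obj g').obj X)
    (y : (Q.obj g'').obj Y) :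
    (Q.obj (g + 1)).map (mergeCut X Y a c d b hac had)
      (Q.comp hg' (cut X c d) Y (keep a hac had) b (Q.contr g' X hcd x, y)) =
      Q.contr g (merge X Y a b) (left_ne hac.symm had.symm hcd) (Q.comp hg X Y a b (x, y)) :=
  let p : _ × _ := (x, y); type_congr_hom (Q.comp_contr hg hg' X Y b hac had hcd) p

theorem comp_natural_apply {g' g'' g : ℕ} (hg : g' + g'' = g) {X X' Y Y' : G} (f : X ⟶ X')
    (f' : Y ⟶ Y') (u : El X) (v : El Y) (x : (Q.obj g').obj X) (y : (Q.obj g'').obj Y) :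
    (Q.obj g).map (mergeMap f f' u v) (Q.comp hg X Y u v (x, y)) =
      Q.comp hg X' Y' (act f u) (act f' v) ((Q.obj g').map f x, (Q.obj g'').map f' y) :=
  let p : _ × _ := (x, y); type_congr_hom (Q.comp_natural hg f f' u v) p

theorem comp_swap_apply {g' g'' g : ℕ} (hg : g' + g'' = g) (hg' : g'' + g' = g) (X Y : G) (u : El X)
    (v : El Y) (x : (Q.obj g').obj X) (y : (Q.obj g'').obj Y) :
    (Q.obj g).map (mergeSwap X Y u v) (Q.comp hg X Y u v (x, y)) = Q.comp hg' Y X v u (y, x) :=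
  let p : _ × _ := (x, y); type_congr_hom (Q.comp_swap hg hg' X Y u v) p

theorem contr_natural_apply (g : ℕ) {X Y : G} (f : X ⟶ Y) {u v : El X} (h : u ≠ v)
    (h' : act f u ≠ act f v) (x : (Q.obj g).obj X) :
    (Q.obj (g + 1)).map (cutMap f u v) (Q.contr g X h x) = Q.contr g Y h' ((Q.obj g).map f x) :=
  type_congr_hom (Q.contr_natural g f h h') x

end Elementwise

variable (Q : ModularOperad MultCyc (Type u))

/-- A family of elements of genus `0` at the cyclically ordered sets, compatible with isomorphisms
and compositions. -/
structure CycFamily where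
  elem (C : Cyc) : (Q.obj 0).obj C.obj
  map_elem {C D : Cyc} (φ : C ⟶ D) : (Q.obj 0).map φ.hom (elem C) = elem D
  comp_elem (C D : Cyc) (u : El C) (v : El D) :
    Q.comp (zero_add 0) C.obj D.obj u v (elem C, elem D) = elem (merge C D u v)

variable {Q} (m : CycFamily Q)

/-- The elements of genus `g` obtained from a family of elements at the cyclically ordered sets by
`g` contractions. -/
def Reach : (g : ℕ) → (X : MultCyc) → (Q.obj g).obj X → Prop
  | 0, X, x => ∃ h : Nat.card X.index = 1, x = m.elem ⟨X, h⟩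
  | g + 1, X, x => ∃ (Y : MultCyc) (u v : Y.carrier) (h : u ≠ v) (φ : Y.cut u v ⟶ X)
      (y : (Q.obj g).obj Y), Reach g Y y ∧ x = (Q.obj (g + 1)).map φ (Q.contr g Y h y)

variable {m}

theorem Reach.map {g : ℕ} {X Y : MultCyc} {x : (Q.obj g).obj X} (h : Reach m g X x) (φ : X ⟶ Y) :
    Reach m g Y ((Q.obj g).map φ x) := by
  cases g with
  | zero =>
    obtain ⟨h, rfl⟩ := h
    have h' : Nat.card Y.index = 1 := (Nat.card_congr φ.indexEquiv).symm.trans h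
    exact ⟨h', m.map_elem (C := ⟨X, h⟩) (D := ⟨Y, h'⟩) (ObjectProperty.homMk φ)⟩
  | succ g =>
    obtain ⟨Z, u, v, h, ψ, z, hz, rfl⟩ := h
    exact ⟨Z, u, v, h, ψ ≫ φ, z, hz, functor_map_map _ _ _ _⟩

theorem Reach.contr {g : ℕ} {X : MultCyc} {x : (Q.obj g).obj X} (h : Reach m g X x) {u v : X.carrier}
    (huv : u ≠ v) : Reach m (g + 1) (X.cut u v) (Q.contr g X huv x) :=
  ⟨X, u, v, huv, 𝟙 _, x, h, (functor_map_id _ _).symm⟩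

theorem Reach.isGeometric {g : ℕ} {X : MultCyc} {x : (Q.obj g).obj X} (h : Reach m g X x) :
    X.IsGeometric g := by
  induction g generalizing X with
  | zero =>
    obtain ⟨h, -⟩ := h
    exact ⟨0, by rw [h]⟩
  | succ g ih =>
    obtain ⟨Y, u, v, h, φ, y, hy, -⟩ := h
    exact ((ih hy).cut h).of_iso φ

theorem Reach.of_map {g : ℕ} {X Y : MultCyc} {x : (Q.obj g).obj X} (φ : X ⟶ Y)
    (h : Reach m g Y ((Q.obj g).map φ x)) : Reach m g X x := by
  have := h.map (MultCyc.inv φ)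
  rwa [functor_map_map, MultCyc.hom_inv, functor_map_id] at this

/-- The set of pairs of genera whose reachable elements have reachable compositions. -/
def CompReach (m : CycFamily Q) (g' g'' : ℕ) : Prop :=
  ∀ (g : ℕ) (hg : g' + g'' = g) (X Y : MultCyc) (u : X.carrier) (v : Y.carrier)
    (x : (Q.obj g').obj X) (y : (Q.obj g'').obj Y), Reach m g' X x → Reach m g'' Y y →
    Reach m g (X.merge Y u v) (Q.comp hg X Y u v (x, y))

theorem CompReach.symm {g' g'' : ℕ} (h : CompReach m g' g'') : CompReach m g'' g' := by
  intro g hg X Y u v x y hx hy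
  refine Reach.of_map (MergeBase.mergeSwap X Y u v) ?_
  have := comp_swap_apply Q hg ((add_comm _ _).trans hg) X Y u v x y
  rw [this]
  exact h _ _ _ _ _ _ _ _ hy hx

/-- The last contraction of the first factor is carried out of the composition by naturality and the
axiom `comp_contr`. -/
theorem CompReach.succ {g' g'' : ℕ} (h : CompReach m g' g'') : CompReach m (g' + 1) g'' := by
  intro g hg X Y u v x y hx hy
  obtain ⟨g, rfl⟩ : ∃ n, g = n + 1 := ⟨g' + g'', by omega⟩
  obtain ⟨Z, c, d, hcd, φ, z, hz, rfl⟩ := hx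
  obtain ⟨a, rfl⟩ := φ.toEquiv.surjective u
  have h1 := comp_natural_apply Q hg φ (𝟙 Y) a v (Q.contr g' Z hcd z) y
  rw [functor_map_id] at h1
  refine Eq.mp (congrArg (Reach m (g + 1) _) h1) (Reach.map ?_ _)
  refine Reach.of_map (CutBase.mergeCut Z Y a.1 c d v a.2.1 a.2.2) ?_
  have h2 := comp_contr_apply Q (by omega) hg Z Y v a.2.1 a.2.2 hcd z y
  refine Eq.mp (congrArg (Reach m (g + 1) _) h2.symm) (Reach.contr ?_ _)
  exact h _ _ _ _ _ _ _ _ hz hy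

/-- In genus 0 this is the compatibility of the family with compositions. The genera of the two
factors are then raised one after the other, with the symmetry of the composition giving access to
the second factor. -/
theorem compReach (m : CycFamily Q) (g' g'' : ℕ) : CompReach m g' g'' := by
  have h0 : CompReach m 0 0 := by
    rintro g hg X Y u v x y ⟨hx, rfl⟩ ⟨hy, rfl⟩
    obtain rfl : 0 = g := hg
    exact ⟨_, m.comp_elem ⟨X, hx⟩ ⟨Y, hy⟩ u v⟩
  have h1 : CompReach m 0 g'' := by
    apply CompReach.symm
    induction g'' with
    | zero => exact h0
    | succ n ih => exact ih.succ
  induction g' with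
  | zero => exact h1
  | succ n ih => exact ih.succ

end

/-! ### Contractions indexed by pairs of dummies of a model. -/

section

variable {B : Type}

theorem IsModelHom.comp {X Y Z : MultCyc} {φ : X ⟶ Y} {ψ : Y ⟶ Z} {N : Finset B} {e : X.carrier → B}
    {l : B → X.index} {e' : Y.carrier → B} {l' : B → Y.index} {e'' : Z.carrier → B}
    {l'' : B → Z.index} (h : IsModelHom φ N e l e' l') (h' : IsModelHom ψ N e' l' e'' l'') :
    IsModelHom (φ ≫ ψ) N e l e'' l'' :=
  ⟨fun x => (h'.emb _).trans (h.emb x), fun n hn => by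
    rw [MultCyc.comp_indexEquiv, h.lab n hn, h'.lab n hn]⟩

theorem IsModelHom.cutMap {X Y : MultCyc} {φ : X ⟶ Y} {f : Perm B} {N : Finset B}
    {e : X.carrier → B} {l : B → X.index} {e' : Y.carrier → B} {l' : B → Y.index}
    (h : IsModelHom φ N e l e' l') {u v : X.carrier} {c : B → (X.cut u v).index}
    {c' : B → (Y.cut (φ.toEquiv u) (φ.toEquiv v)).index} (hc : IsModel.IsCutLabel f N e l u v c)
    (hc' : IsModel.IsCutLabel f N e' l' (φ.toEquiv u) (φ.toEquiv v) c') :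
    IsModelHom (MultCyc.cutMap φ (u := u) (v := v) rfl rfl) N (fun x => e x.1) c
      (fun x => e' x.1) c' := by
  refine ⟨fun x => h.emb x.1, fun n hn => ?_⟩
  by_cases H : ∃ y, (glue f (e u) (e v)).SameCycle n (e y)
  · obtain ⟨y, hy⟩ := H
    rw [hc.inr n hn y hy, hc'.inr n hn (φ.toEquiv y) (by simpa only [h.emb] using hy)]
    rfl
  · obtain ⟨h1, h2⟩ := hc.inl n hn H
    obtain ⟨h3, h4⟩ := hc'.inl n hn (fun ⟨y, hy⟩ => H ⟨φ.toEquiv.symm y, by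
      rw [← h.emb (φ.toEquiv.symm y), apply_symm_apply, ← h.emb u, ← h.emb v]; exact hy⟩)
    rw [h2, h4]
    exact congrArg Sum.inl (Subtype.ext (h.lab n hn))

theorem IsModel.IsCutLabel.eq {X : MultCyc} {f : Perm B} {N : Finset B} {e : X.carrier → B}
    {l : B → X.index} {u v : X.carrier} {c c' : B → (X.cut u v).index}
    (hc : IsModel.IsCutLabel f N e l u v c) (hc' : IsModel.IsCutLabel f N e l u v c') {n : B}
    (hn : n ∈ N) : c n = c' n := by
  by_cases H : ∃ y, (glue f (e u) (e v)).SameCycle n (e y)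
  · obtain ⟨y, hy⟩ := H
    rw [hc.inr n hn y hy, hc'.inr n hn y hy]
  · obtain ⟨h1, h2⟩ := hc.inl n hn H
    obtain ⟨h3, h4⟩ := hc'.inl n hn H
    rw [h2, h4]

/-- A presentation of `X` as the result of gluing two elements of `Y`, compatible with models. -/
structure IsPres {X Y : MultCyc} {y₁ y₂ : Y.carrier} (φ : Y.cut y₁ y₂ ⟶ X) (f : Perm B) (N : Finset B)
    (e : X.carrier → B) (l : B → X.index) (e' : Y.carrier → B) (l' : B → Y.index) : Prop where
  model : IsModel Y (glue f (e' y₁) (e' y₂)) N e' l'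
  hom : ∃ c, IsModel.IsCutLabel (glue f (e' y₁) (e' y₂)) N e' l' y₁ y₂ c ∧
    IsModelHom φ N (fun y => e' y.1) c e l

theorem IsModel.cut_of_glue {Y : MultCyc} {f : Perm B} {N : Finset B} {e : Y.carrier → B}
    {l : B → Y.index} {u v : Y.carrier} (h : IsModel Y (glue f (e u) (e v)) N e l)
    {c : B → (Y.cut u v).index} (hc : IsModel.IsCutLabel (glue f (e u) (e v)) N e l u v c) :
    IsModel (Y.cut u v) f N (fun x => e x.1) c := by
  obtain ⟨c', h1, h2⟩ := h.exists_cut (u := u) (v := v)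
  rw [glue_glue] at h1
  exact h1.congr (fun n hn => hc.eq h2 hn)

theorem exists_isPres {X Y : MultCyc} {f : Perm B} {N : Finset B} {e : X.carrier → B}
    {l : B → X.index} {e' : Y.carrier → B} {l' : B → Y.index} (hX : IsModel X f N e l)
    {y₁ y₂ : Y.carrier} (hY : IsModel Y (glue f (e' y₁) (e' y₂)) N e' l')
    (hr : ∀ n, n ∈ Set.range e ↔ n ∈ Set.range e' ∧ n ≠ e' y₁ ∧ n ≠ e' y₂) :
    ∃ φ : Y.cut y₁ y₂ ⟶ X, IsPres φ f N e l e' l' := by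
  obtain ⟨c, h1, h2⟩ := hY.exists_cut (u := y₁) (v := y₂)
  rw [glue_glue] at h1
  obtain ⟨φ, hφ⟩ := h1.exists_hom hX (by
    ext n
    rw [hr]
    constructor
    · rintro ⟨y, rfl⟩
      exact ⟨⟨y.1, rfl⟩, hY.inj.ne y.2.1, hY.inj.ne y.2.2⟩
    · rintro ⟨⟨y, rfl⟩, h3, h4⟩
      exact ⟨⟨y, fun h => h3 (h ▸ rfl), fun h => h4 (h ▸ rfl)⟩, rfl⟩)
  exact ⟨φ, hY, c, h2, hφ⟩

theorem IsPres.range {X Y : MultCyc} {y₁ y₂ : Y.carrier} {φ : Y.cut y₁ y₂ ⟶ X} {f : Perm B}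
    {N : Finset B} {e : X.carrier → B} {l : B → X.index} {e' : Y.carrier → B} {l' : B → Y.index}
    (h : IsPres φ f N e l e' l') (n : B) :
    n ∈ Set.range e' ↔ n ∈ Set.range e ∨ n = e' y₁ ∨ n = e' y₂ := by
  obtain ⟨c, h1, h2⟩ := h.hom
  constructor
  · rintro ⟨y, rfl⟩
    by_cases hu : y = y₁
    · subst hu; exact .inr (.inl rfl)
    by_cases hv : y = y₂
    · subst hv; exact .inr (.inr rfl)
    exact .inl ⟨φ.toEquiv ⟨y, hu, hv⟩, h2.emb _⟩
  · rintro (⟨x, rfl⟩ | rfl | rfl)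
    · obtain ⟨y, rfl⟩ := φ.toEquiv.surjective x
      exact ⟨y.1, (h2.emb y).symm⟩
    · exact ⟨_, rfl⟩
    · exact ⟨_, rfl⟩

theorem IsPres.ne {X Y : MultCyc} {y₁ y₂ : Y.carrier} {φ : Y.cut y₁ y₂ ⟶ X} {f : Perm B}
    {N : Finset B} {e : X.carrier → B} {l : B → X.index} {e' : Y.carrier → B} {l' : B → Y.index}
    (h : IsPres φ f N e l e' l') (x : X.carrier) : e x ≠ e' y₁ ∧ e x ≠ e' y₂ := by
  obtain ⟨c, h1, h2⟩ := h.hom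
  obtain ⟨y, rfl⟩ := φ.toEquiv.surjective x
  rw [h2.emb]
  exact ⟨h.model.inj.ne y.2.1, h.model.inj.ne y.2.2⟩

variable {Q : ModularOperad MultCyc (Type u)} (m : CycFamily Q)

/-- The element `x` at `X` is the contraction at `u` and `v` of a reachable element of genus `g`, where
`u` and `v` are two elements of a model of `X`. -/
def IsVal (g : ℕ) {X : MultCyc} (f : Perm B) (N : Finset B) (e : X.carrier → B) (l : B → X.index)
    (u v : B) (x : (Q.obj (g + 1)).obj X) : Prop :=
  ∃ (Y : MultCyc) (e' : Y.carrier → B) (l' : B → Y.index) (y₁ y₂ : Y.carrier) (h : y₁ ≠ y₂)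
    (φ : Y.cut y₁ y₂ ⟶ X) (y : (Q.obj g).obj Y), IsPres φ f N e l e' l' ∧ e' y₁ = u ∧ e' y₂ = v ∧
      Reach m g Y y ∧ x = (Q.obj (g + 1)).map φ (Q.contr g Y h y)

/-- There is at most one reachable element of genus `g` at every `X`. -/
def UniqueReach (g : ℕ) : Prop :=
  ∀ (X : MultCyc) (x x' : (Q.obj g).obj X), Reach m g X x → Reach m g X x' → x = x'

variable {m} {g : ℕ} {X : MultCyc} {f : Perm B} {N : Finset B} {e : X.carrier → B} {l : B → X.index}
  {u v : B} {x x' : (Q.obj (g + 1)).obj X}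

/-- The unglued set is determined by its model up to a compatible isomorphism, and `hU` matches the
reachable elements under it. The two resulting isomorphisms onto `X` agree by rigidity. -/
theorem IsVal.unique (hU : UniqueReach m g) (hX : IsModel X f N e l) (h : IsVal m g f N e l u v x)
    (h' : IsVal m g f N e l u v x') : x = x' := by
  obtain ⟨Y, eY, lY, y₁, y₂, hy, φ, y, hφ, rfl, rfl, hyr, rfl⟩ := h
  obtain ⟨Y', eY', lY', y₁', y₂', hy', φ', y', hφ', h1, h2, hyr', rfl⟩ := h'
  have hm := hφ'.model
  obtain ⟨α, hα⟩ := hφ.model.exists_hom (h1 ▸ h2 ▸ hm) (Set.ext fun n => by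
    rw [hφ.range, hφ'.range, h1, h2])
  obtain rfl : α.toEquiv y₁ = y₁' := hm.inj (by rw [hα.emb, h1])
  obtain rfl : α.toEquiv y₂ = y₂' := hm.inj (by rw [hα.emb, h2])
  obtain rfl : (Q.obj g).map α y = y' := hU _ _ _ (hyr.map α) hyr'
  have h3 := contr_natural_apply Q g α hy hy' y
  rw [← h3, functor_map_map]
  refine congrArg (fun ψ => (Q.obj (g + 1)).map ψ (Q.contr g Y hy y)) ?_
  obtain ⟨c, hc, hc'⟩ := hφ.hom
  obtain ⟨d, hd, hd'⟩ := hφ'.hom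
  rw [h1, h2] at hd
  exact (hφ.model.cut_of_glue hc).hom_ext hX hc' ((hα.cutMap hc hd).comp hd')

theorem IsVal.mem (h : IsVal m g f N e l u v x) : u ∈ N ∧ v ∈ N ∧ u ≠ v ∧ u ∉ Set.range e ∧
    v ∉ Set.range e := by
  obtain ⟨Y, eY, lY, y₁, y₂, hy, φ, y, hφ, rfl, rfl, hyr, rfl⟩ := h
  exact ⟨hφ.model.mem _, hφ.model.mem _, hφ.model.inj.ne hy, fun ⟨x, hx⟩ => (hφ.ne x).1 hx,
    fun ⟨x, hx⟩ => (hφ.ne x).2 hx⟩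

theorem IsVal.symm (h : IsVal m g f N e l u v x) : IsVal m g f N e l v u x := by
  obtain ⟨Y, eY, lY, y₁, y₂, hy, φ, y, hφ, rfl, rfl, hyr, rfl⟩ := h
  obtain ⟨c, hc, hc'⟩ := hφ.hom
  have hm := hφ.model
  rw [glue_symm] at hm
  obtain ⟨d, hd, hd'⟩ := hm.exists_cut (u := y₂) (v := y₁)
  refine ⟨Y, eY, lY, y₂, y₁, hy.symm, Y.cutSwap y₂ y₁ ≫ φ, y, ⟨hm, d, hd', IsModelHom.comp ?_ hc'⟩,
    rfl, rfl, hyr, ?_⟩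
  · refine ⟨fun _ => rfl, fun n hn => ?_⟩
    have E : glue (glue f (eY y₂) (eY y₁)) (eY y₂) (eY y₁) =
        glue (glue f (eY y₁) (eY y₂)) (eY y₁) (eY y₂) := by
      rw [glue_glue, glue_glue]
    by_cases H : ∃ y, (glue (glue f (eY y₂) (eY y₁)) (eY y₂) (eY y₁)).SameCycle n (eY y)
    · obtain ⟨y, hy⟩ := H
      rw [hd'.inr n hn y hy]
      rw [E] at hy
      rw [hc.inr n hn y hy]
      rfl
    · obtain ⟨_, h2⟩ := hd'.inl n hn H
      rw [E] at H
      obtain ⟨_, h4⟩ := hc.inl n hn H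
      rw [h2, h4]
      rfl
  · have := contr_symm_apply Q g Y hy.symm y
    rw [← functor_map_map]
    exact congrArg _ this.symm

theorem IsVal.congr {l' : B → X.index} (h : IsVal m g f N e l u v x) (hl : ∀ n ∈ N, l' n = l n) :
    IsVal m g f N e l' u v x := by
  obtain ⟨Y, eY, lY, y₁, y₂, hy, φ, y, hφ, h1, h2, hyr, h3⟩ := h
  obtain ⟨c, hc, hc'⟩ := hφ.hom
  exact ⟨Y, eY, lY, y₁, y₂, hy, φ, y, ⟨hφ.model, c, hc, hc'.emb, fun n hn => by
    rw [hc'.lab n hn, hl n hn]⟩, h1, h2, hyr, h3⟩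

/-- With `IsVal.extend`, this shows that dummies other than `u` and `v` may be dropped or added
freely, provided that every cycle keeps a representative. -/
theorem IsVal.restrict {N' : Finset B} (h : IsVal m g f N' e l u v x)
    (hN : N ⊆ N') (he : ∀ x, e x ∈ N) (hu : u ∈ N) (hv : v ∈ N)
    (hm : ∀ n ∈ N', ∃ m ∈ N, f.SameCycle n m) :
    IsVal m g (skipAll f (N' \ N)) N e l u v x := by
  obtain ⟨Y, eY, lY, y₁, y₂, hy, φ, y, hφ, rfl, rfl, hyr, h3⟩ := h
  obtain ⟨c, hc, hc'⟩ := hφ.hom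
  have hin : ∀ y, eY y ∈ N := fun y => by
    rcases (hφ.range (eY y)).1 ⟨y, rfl⟩ with ⟨x, hx⟩ | h | h
    · rw [← hx]; exact he x
    · rw [h]; exact hu
    · rw [h]; exact hv
  have h1 := hφ.model.restrict hN hin (fun n hn => glue_meets hu hv (hm n hn))
  have hnot : ∀ n ∈ N, n ∉ N' \ N := fun n hn h => (Finset.mem_sdiff.1 h).2 hn
  rw [skipAll_glue _ (hnot _ hu) (hnot _ hv)] at h1
  have hs : ∀ n ∈ N, ∀ y, (glue (glue (skipAll f (N' \ N)) (eY y₁) (eY y₂)) (eY y₁) (eY y₂)).SameCycle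
      n (eY y) ↔ (glue (glue f (eY y₁) (eY y₂)) (eY y₁) (eY y₂)).SameCycle n (eY y) := by
    intro n hn y
    rw [glue_glue, glue_glue, sameCycle_skipAll _ (hnot n hn) (hnot _ (hin y))]
  refine ⟨Y, eY, lY, y₁, y₂, hy, φ, y, ⟨h1, c, ⟨fun n hn y hy => hc.inr n (hN hn) y ((hs n hn y).1 hy),
    fun n hn H => hc.inl n (hN hn) (fun ⟨y, hy⟩ => H ⟨y, (hs n hn y).2 hy⟩)⟩, hc'.emb,
    fun n hn => hc'.lab n (hN hn)⟩, rfl, rfl, hyr, h3⟩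

theorem IsVal.extend {N' : Finset B} (hX : IsModel X f N' e l)
    (h : IsVal m g (skipAll f (N' \ N)) N e l u v x) (hN : N ⊆ N')
    (hm : ∀ n ∈ N', ∃ m ∈ N, f.SameCycle n m) : IsVal m g f N' e l u v x := by
  obtain ⟨hu, hv, -⟩ := h.mem
  obtain ⟨Y, eY, lY, y₁, y₂, hy, φ, y, hφ, rfl, rfl, hyr, h3⟩ := h
  obtain ⟨c, hc, hc'⟩ := hφ.hom
  have hnot : ∀ n ∈ N, n ∉ N' \ N := fun n hn h => (Finset.mem_sdiff.1 h).2 hn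
  have hin := hφ.model.mem
  have h1 := hφ.model
  rw [← skipAll_glue _ (hnot _ hu) (hnot _ hv)] at h1
  obtain ⟨lY', h4, h5⟩ := h1.extend hN (fun n hn => glue_fix (hX.fix n hn)
    (fun e => hn (e ▸ hN hu)) (fun e => hn (e ▸ hN hv))) (fun n hn => glue_meets hu hv (hm n hn))
  obtain ⟨c', h6, h7⟩ := h4.exists_cut (u := y₁) (v := y₂)
  rw [glue_glue] at h6
  refine ⟨Y, eY, lY', y₁, y₂, hy, φ, y, ⟨h4, c', h7, hc'.emb, fun n hn => ?_⟩, rfl, rfl, hyr, h3⟩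
  -- Labels are constant on cycles of `f`, so it is enough to compare them at a representative in
  -- `N`.
  obtain ⟨n₀, hn₀, hnn⟩ := hm n hn
  rw [(hX.lab n hn n₀ (hN hn₀)).2 hnn, (h6.lab n hn n₀ (hN hn₀)).2 hnn, ← hc'.lab n₀ hn₀]
  congr 1
  have hs : ∀ n ∈ N, ∀ y, (glue (glue (skipAll f (N' \ N)) (eY y₁) (eY y₂)) (eY y₁) (eY y₂)).SameCycle
      n (eY y) ↔ (glue (glue f (eY y₁) (eY y₂)) (eY y₁) (eY y₂)).SameCycle n (eY y) := by
    intro n hn y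
    rw [glue_glue, glue_glue, sameCycle_skipAll _ (hnot n hn) (hnot _ (hin y))]
  by_cases H : ∃ y, (glue (glue f (eY y₁) (eY y₂)) (eY y₁) (eY y₂)).SameCycle n₀ (eY y)
  · obtain ⟨y, hy⟩ := H
    rw [h7.inr n₀ (hN hn₀) y hy, hc.inr n₀ hn₀ y ((hs n₀ hn₀ y).2 hy)]
  · obtain ⟨_, h8⟩ := h7.inl n₀ (hN hn₀) H
    obtain ⟨_, h9⟩ := hc.inl n₀ hn₀ (fun ⟨y, hy⟩ => H ⟨y, (hs n₀ hn₀ y).1 hy⟩)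
    rw [h8, h9]
    exact congrArg Sum.inl (Subtype.ext (h5 n₀ hn₀))

theorem glue_conj (f σ : Perm B) (u v : B) :
    glue (σ * f * σ⁻¹) (σ u) (σ v) = σ * glue f u v * σ⁻¹ := by
  ext n
  obtain ⟨n, rfl⟩ := σ.surjective n
  rw [← glue_semiconj (f := f) (g := σ * f * σ⁻¹) σ (fun x => by simp)]
  simp

theorem IsVal.rename (h : IsVal m g f N e l u v x) (σ : Perm B) :
    IsVal m g (σ * f * σ⁻¹) (N.map σ.toEmbedding) (σ ∘ e) (l ∘ σ.symm) (σ u) (σ v) x := by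
  obtain ⟨Y, eY, lY, y₁, y₂, hy, φ, y, hφ, rfl, rfl, hyr, h3⟩ := h
  obtain ⟨c, hc, hc'⟩ := hφ.hom
  have h1 := hφ.model.rename σ
  rw [← glue_conj] at h1
  have hs : ∀ n y, (glue (glue (σ * f * σ⁻¹) (σ (eY y₁)) (σ (eY y₂))) (σ (eY y₁))
      (σ (eY y₂))).SameCycle n (σ (eY y)) ↔
      (glue (glue f (eY y₁) (eY y₂)) (eY y₁) (eY y₂)).SameCycle (σ.symm n) (eY y) := by
    intro n y
    rw [glue_glue, glue_glue]
    conv_lhs => rw [← σ.apply_symm_apply n]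
    exact (sameCycle_semiconj (f := f) (g := σ * f * σ⁻¹) σ (fun x => by simp) _ _).symm
  refine ⟨Y, σ ∘ eY, lY ∘ σ.symm, y₁, y₂, hy, φ, y, ⟨h1, c ∘ σ.symm, ⟨fun n hn y hy => ?_,
    fun n hn H => ?_⟩, fun z => congrArg σ (hc'.emb z), fun n hn => ?_⟩, rfl, rfl, hyr, h3⟩
  · rw [Finset.mem_map_equiv] at hn
    exact hc.inr _ hn y ((hs n y).1 hy)
  · rw [Finset.mem_map_equiv] at hn
    exact hc.inl _ hn (fun ⟨y, hy⟩ => H ⟨y, (hs n y).2 hy⟩)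
  · rw [Finset.mem_map_equiv] at hn
    exact hc'.lab _ hn

end

/-! ### Existence of reachable elements and interchange of contractions. -/

section

variable {B : Type}

theorem IsModel.card_glue {X Y : MultCyc} {f : Perm B} {N : Finset B} {e : X.carrier → B}
    {l : B → X.index} {e' : Y.carrier → B} {l' : B → Y.index} {u v : B} (hX : IsModel X f N e l)
    (hY : IsModel Y (glue f u v) N e' l') (hu : u ∈ N) (hv : v ∈ N) (huv : u ≠ v) :
    (f.SameCycle u v → Nat.card Y.index = Nat.card X.index + 1) ∧
      (¬ f.SameCycle u v → Nat.card Y.index + 1 = Nat.card X.index) := by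
  -- All dummies are turned into elements. This does not change the number of parts, and the
  -- transposition becomes an actual gluing in `W`, for which the count is known.
  obtain ⟨W, eW, lW, hW, hr⟩ := exists_of_model hY.fix (Finset.Subset.refl N) ⟨u, hu⟩
  obtain ⟨a, rfl⟩ : u ∈ Set.range eW := by rw [hr]; exact hu
  obtain ⟨b, rfl⟩ : v ∈ Set.range eW := by rw [hr]; exact hv
  have hab : a ≠ b := fun h => huv (h ▸ rfl)
  obtain ⟨c, hc, -⟩ := hW.exists_cut (u := a) (v := b)
  rw [glue_glue] at hc
  rw [hX.card_index_eq hc, hY.card_index_eq hW]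
  have key : W.part a = W.part b ↔ ¬ f.SameCycle (eW a) (eW b) := by
    rw [← hW.part, ← hW.part, hW.lab _ hu _ hv, glue_sameCycle_iff hX.fix huv]
  constructor
  · intro h
    exact (MultCyc.card_cut_of_ne W (fun h' => key.1 h' h)).symm
  · intro h
    exact (MultCyc.card_cut_of_eq W hab (key.2 h)).symm

theorem exists_fresh [Infinite B] (N : Finset B) : ∃ t, t ∉ N := Infinite.exists_notMem_finset N

/-- A new element can be inserted into a model so that it has a given label. -/
theorem IsModel.exists_insert_label [Infinite B] {X : MultCyc} {f : Perm B} {N : Finset B}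
    {e : X.carrier → B} {l : B → X.index} (h : IsModel X f N e l) (i : X.index) :
    ∃ (t : B) (f' : Perm B) (l' : B → X.index), t ∉ N ∧ IsModel X f' (insert t N) e l' ∧
      l' t = i ∧ ∀ n ∈ N, l' n = l n := by
  obtain ⟨t, ht⟩ := exists_fresh N
  obtain ⟨q, hq, rfl⟩ := h.surj i
  obtain ⟨l', h1, h2, h3⟩ := h.exists_insert hq ht
  exact ⟨t, _, l', ht, h1, h3, h2⟩

theorem IsModel.notMem_range {X : MultCyc} {f : Perm B} {N : Finset B}
    {e : X.carrier → B} {l : B → X.index} (h : IsModel X f N e l) {t : B} (ht : t ∉ N) :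
    t ∉ Set.range e := fun ⟨x, hx⟩ => ht (hx ▸ h.mem x)

variable {Q : ModularOperad MultCyc (Type u)} (m : CycFamily Q)

/-- The multicyclically ordered set obtained from `X` by undoing a gluing at two dummy elements of a
model. -/
theorem IsModel.exists_unglue {X : MultCyc} {f : Perm B} {N : Finset B} {e : X.carrier → B}
    {l : B → X.index} (h : IsModel X f N e l) {u v : B} (hu : u ∈ N) (hv : v ∈ N)
    (hu' : u ∉ Set.range e) (hv' : v ∉ Set.range e) :
    ∃ (Y : MultCyc) (e' : Y.carrier → B) (l' : B → Y.index) (y₁ y₂ : Y.carrier)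
      (φ : Y.cut y₁ y₂ ⟶ X), IsPres φ f N e l e' l' ∧ e' y₁ = u ∧ e' y₂ = v := by
  obtain ⟨Y, eY, lY, hY, hr⟩ := exists_of_model (f := glue f u v) (N := N)
    (T := N.filter (fun n => n ∈ Set.range e ∨ n = u ∨ n = v))
    (fun n hn => glue_fix (h.fix n hn) (fun e => hn (e ▸ hu)) (fun e => hn (e ▸ hv)))
    (Finset.filter_subset _ _) ⟨u, hu⟩
  obtain ⟨a, rfl⟩ : u ∈ Set.range eY := by rw [hr]; simp [hu]
  obtain ⟨b, rfl⟩ : v ∈ Set.range eY := by rw [hr]; simp [hv]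
  obtain ⟨φ, hφ⟩ := exists_isPres h hY (fun n => by
    rw [hr, Finset.mem_coe, Finset.mem_filter]
    constructor
    · rintro hn
      refine ⟨⟨?_, .inl hn⟩, ?_, ?_⟩
      · obtain ⟨x, rfl⟩ := hn; exact h.mem x
      · rintro rfl; exact hu' hn
      · rintro rfl; exact hv' hn
    · rintro ⟨⟨-, h1⟩, h2, h3⟩
      tauto)
  exact ⟨Y, eY, lY, a, b, φ, hφ, rfl, rfl⟩

theorem exists_reach (g : ℕ) (X : MultCyc) (hX : X.IsGeometric g) : ∃ x, Reach m g X x := by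
  induction g generalizing X with
  | zero =>
    have h : Nat.card X.index = 1 := by
      obtain ⟨G, hG⟩ := hX
      have := X.card_index_pos
      omega
    exact ⟨_, h, rfl⟩
  | succ g ih =>
    obtain ⟨B, hB, b₀⟩ : ∃ B : Type, Infinite B ∧ Nonempty B := ⟨ℕ, inferInstance, inferInstance⟩
    obtain ⟨j, hj, -⟩ := exists_extension (γ := X.carrier ⊕ X.Empties) ∅ (fun _ => b₀.some)
      (by simp) ∅ (by simp)
    obtain ⟨f, N, l, h, -⟩ := exists_model X j hj
    -- The two places to be unglued are put in different parts whenever there are at least two.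
    obtain ⟨i, k, hik⟩ : ∃ i k : X.index, 2 ≤ Nat.card X.index → i ≠ k := by
      obtain ⟨i⟩ := X.nonempty_index
      by_cases h : 2 ≤ Nat.card X.index
      · have : Nontrivial X.index := Finite.one_lt_card_iff_nontrivial.1 h
        obtain ⟨i, k, hik⟩ := exists_pair_ne X.index
        exact ⟨i, k, fun _ => hik⟩
      · exact ⟨i, i, fun hh => (h hh).elim⟩
    obtain ⟨u, f₁, l₁, hu, h1, hl1, -⟩ := h.exists_insert_label i
    obtain ⟨v, f₂, l₂, hv, h2, hl2, hl2'⟩ := h1.exists_insert_label k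
    have huv : u ≠ v := fun e => hv (by simp [e])
    have hu2 : u ∈ insert v (insert u N) := by simp
    have hv2 : v ∈ insert v (insert u N) := by simp
    have hlu : l₂ u = i := by rw [hl2' u (by simp), hl1]
    obtain ⟨Y, eY, lY, y₁, y₂, φ, hφ, rfl, rfl⟩ := h2.exists_unglue hu2 hv2
      (h.notMem_range hu) (h1.notMem_range hv)
    have hy : y₁ ≠ y₂ := fun h => huv (h ▸ rfl)
    obtain ⟨c1, c2⟩ := h2.card_glue hφ.model hu2 hv2 huv
    rw [← h2.lab _ hu2 _ hv2, hlu, hl2] at c1 c2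
    -- If the parts differ, ungluing merges them and `G` is unchanged. If there is only one part, it
    -- is split and `G` drops by one; here `G` is positive, since the genus is.
    obtain ⟨y, hyr⟩ := ih Y (by
      obtain ⟨G, hG⟩ := hX
      by_cases hc : 2 ≤ Nat.card X.index
      · have := c2 (hik hc)
        exact ⟨G, by omega⟩
      · have hc1 : Nat.card X.index = 1 := by have := X.card_index_pos; omega
        have hik' : i = k := by
          have := (Nat.card_eq_one_iff_unique.1 hc1).1
          exact Subsingleton.elim _ _
        have := c1 hik'
        exact ⟨G - 1, by omega⟩)
    exact ⟨_, Y, y₁, y₂, hy, φ, y, hyr, rfl⟩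

variable {m} {g : ℕ} {X : MultCyc} {f : Perm B} {N : Finset B} {e : X.carrier → B} {l : B → X.index}
  {u v : B} {x x' : (Q.obj (g + 1)).obj X}

/-- The common part of both interchange arguments. `Z` is `X` with both pairs unglued, `y₁` and `y₂`
are reachable after regluing one of them, and `E` is whatever operad axiom says that regluing the
other pair gives the same element. -/
theorem IsVal.interchange_of (hU : UniqueReach m g) {Z : MultCyc}
    {eZ : Z.carrier → B} {lZ : B → Z.index} {a b c d : Z.carrier} (hab : a ≠ b) (hcd : c ≠ d)
    (hac : a ≠ c) (had : a ≠ d) (hbc : b ≠ c) (hbd : b ≠ d)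
    (hZ : IsModel Z (glue (glue f (eZ a) (eZ b)) (eZ c) (eZ d)) N eZ lZ)
    (hr : ∀ n, n ∈ Set.range e ↔ ∃ z, (z ≠ a ∧ z ≠ b ∧ z ≠ c ∧ z ≠ d) ∧ eZ z = n)
    (y₁ : (Q.obj g).obj (Z.cut c d)) (y₂ : (Q.obj g).obj (Z.cut a b)) (h₁ : Reach m g _ y₁)
    (h₂ : Reach m g _ y₂)
    (E : (Q.obj (g + 1)).map (MultCyc.cutComm (X := Z) hac had hbc hbd)
        (Q.contr g (Z.cut a b) (u := ⟨c, hac.symm, hbc.symm⟩) (v := ⟨d, had.symm, hbd.symm⟩)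
          (fun h => hcd (congrArg Subtype.val h)) y₂) =
      Q.contr g (Z.cut c d) (u := ⟨a, hac, had⟩) (v := ⟨b, hbc, hbd⟩)
          (fun h => hab (congrArg Subtype.val h)) y₁)
    (h : IsVal m g f N e l (eZ a) (eZ b) x) : IsVal m g f N e l (eZ c) (eZ d) x := by
  obtain ⟨Y, eY, lY, yu, yv, hy, φ, y, hφ, hu, hv, hyr, rfl⟩ := h
  obtain ⟨cY, hcY, hcY'⟩ := hφ.hom
  obtain ⟨l₂, m₂, c₂⟩ := hZ.exists_cut (u := c) (v := d)
  rw [glue_glue] at m₂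
  obtain ⟨l₁, m₁, c₁⟩ := hZ.exists_cut (u := a) (v := b)
  have hne : ∀ {x y : Z.carrier}, x ≠ y → eZ x ≠ eZ y := fun h => hZ.inj.ne h
  have E1 : glue (glue (glue f (eZ a) (eZ b)) (eZ c) (eZ d)) (eZ a) (eZ b) = glue f (eZ c) (eZ d) := by
    rw [glue_comm f (hne hac) (hne had) (hne hbc) (hne hbd), glue_glue]
  rw [E1] at m₁
  have hmY := hφ.model
  have hmY' := hmY
  rw [hu, hv] at hmY
  have hranges : Set.range (fun x : (Z.cut c d).carrier => eZ x.1) = Set.range eY := by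
    ext n
    rw [hφ.range, hr, hu, hv]
    constructor
    · rintro ⟨z, rfl⟩
      by_cases h1 : z.1 = a
      · exact .inr (.inl (congrArg eZ h1))
      by_cases h2 : z.1 = b
      · exact .inr (.inr (congrArg eZ h2))
      exact .inl ⟨z.1, ⟨h1, h2, z.2⟩, rfl⟩
    · rintro (⟨z, ⟨-, -, h1⟩, rfl⟩ | rfl | rfl)
      exacts [⟨⟨z, h1⟩, rfl⟩, ⟨⟨a, hac, had⟩, rfl⟩, ⟨⟨b, hbc, hbd⟩, rfl⟩]
  -- `Z` glued at `c` and `d` has the same model as `Y`, so by `hU` the element contracted to `x` is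
  -- the image of `y₁`.
  obtain ⟨α, hα⟩ := m₂.exists_hom hmY hranges
  obtain rfl : α.toEquiv ⟨a, hac, had⟩ = yu := hmY.inj (by rw [hα.emb, hu])
  obtain rfl : α.toEquiv ⟨b, hbc, hbd⟩ = yv := hmY.inj (by rw [hα.emb, hv])
  obtain rfl : (Q.obj g).map α y₁ = y := hU _ _ _ (h₁.map α) hyr
  have h3 := contr_natural_apply Q g α (X := Z.cut c d) (u := ⟨a, hac, had⟩) (v := ⟨b, hbc, hbd⟩)
    (fun h => hab (congrArg Subtype.val h)) hy y₁
  obtain ⟨l₂₁, m₂₁, c₂₁⟩ := m₂.exists_cut (u := (⟨a, hac, had⟩ : (Z.cut c d).carrier))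
    (v := ⟨b, hbc, hbd⟩)
  obtain ⟨l₁₂, m₁₂, c₁₂⟩ := m₁.exists_cut
    (u := (⟨c, hac.symm, hbc.symm⟩ : (Z.cut a b).carrier)) (v := ⟨d, had.symm, hbd.symm⟩)
  rw [hu, hv] at hcY
  have hom1 := hα.cutMap c₂₁ hcY
  rw [← E1] at c₁₂
  have E2 : glue f (eZ a) (eZ b) = glue (glue (glue f (eZ a) (eZ b)) (eZ c) (eZ d)) (eZ c) (eZ d) := by
    rw [glue_glue]
  rw [E2] at c₂₁
  have hom2 := hZ.isModelHom_cutComm hac had hbc hbd c₁ c₁₂ c₂ c₂₁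
  rw [E1] at c₁₂
  refine ⟨Z.cut a b, fun z => eZ z.1, l₁, ⟨c, hac.symm, hbc.symm⟩, ⟨d, had.symm, hbd.symm⟩,
    fun h => hcd (congrArg Subtype.val h),
    MultCyc.cutComm (X := Z) hac had hbc hbd ≫ MultCyc.cutMap α rfl rfl ≫ φ, y₂,
    ⟨m₁, l₁₂, c₁₂, hom2.comp (hom1.comp hcY')⟩, rfl, rfl, h₂, ?_⟩
  rw [← functor_map_map, ← functor_map_map, E]
  exact congrArg _ h3.symm

theorem exists_double_unglue {s t : B} (hX : IsModel X f N e l)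
    (hu : u ∈ N) (hv : v ∈ N) (hs : s ∈ N) (ht : t ∈ N) (hu' : u ∉ Set.range e)
    (hv' : v ∉ Set.range e) (hs' : s ∉ Set.range e) (ht' : t ∉ Set.range e) :
    ∃ (Z : MultCyc) (eZ : Z.carrier → B) (lZ : B → Z.index) (a b c d : Z.carrier),
      IsModel Z (glue (glue f (eZ a) (eZ b)) (eZ c) (eZ d)) N eZ lZ ∧
      (∀ n, n ∈ Set.range e ↔ ∃ z, (z ≠ a ∧ z ≠ b ∧ z ≠ c ∧ z ≠ d) ∧ eZ z = n) ∧
      eZ a = u ∧ eZ b = v ∧ eZ c = s ∧ eZ d = t := by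
  obtain ⟨Z, eZ, lZ, hZ, hr⟩ := exists_of_model (f := glue (glue f u v) s t) (N := N)
    (T := N.filter (fun n => n ∈ Set.range e ∨ n = u ∨ n = v ∨ n = s ∨ n = t))
    (fun n hn => glue_fix (glue_fix (hX.fix n hn) (fun e => hn (e ▸ hu)) (fun e => hn (e ▸ hv)))
      (fun e => hn (e ▸ hs)) (fun e => hn (e ▸ ht)))
    (Finset.filter_subset _ _) ⟨u, hu⟩
  obtain ⟨a, rfl⟩ : u ∈ Set.range eZ := by rw [hr]; simp [hu]
  obtain ⟨b, rfl⟩ : v ∈ Set.range eZ := by rw [hr]; simp [hv]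
  obtain ⟨c, rfl⟩ : s ∈ Set.range eZ := by rw [hr]; simp [hs]
  obtain ⟨d, rfl⟩ : t ∈ Set.range eZ := by rw [hr]; simp [ht]
  refine ⟨Z, eZ, lZ, a, b, c, d, hZ, fun n => ⟨fun hn => ?_, ?_⟩, rfl, rfl, rfl, rfl⟩
  · have hn' : n ∈ Set.range eZ := by
      rw [hr, Finset.mem_coe, Finset.mem_filter]
      refine ⟨?_, .inl hn⟩
      obtain ⟨x, rfl⟩ := hn; exact hX.mem x
    obtain ⟨z, rfl⟩ := hn'
    refine ⟨z, ⟨?_, ?_, ?_, ?_⟩, rfl⟩ <;> rintro rfl <;> contradiction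
  · rintro ⟨z, ⟨h1, h2, h3, h4⟩, rfl⟩
    have : eZ z ∈ Set.range eZ := ⟨z, rfl⟩
    rw [hr, Finset.mem_coe, Finset.mem_filter, hZ.inj.eq_iff, hZ.inj.eq_iff, hZ.inj.eq_iff,
      hZ.inj.eq_iff] at this
    tauto

/-- Two contractions may be interchanged. -/
theorem IsVal.interchange {s t : B} (hU : UniqueReach m g) (hX : IsModel X f N e l)
    (h : IsVal m g f N e l u v x) (hs : s ∈ N) (ht : t ∈ N) (hs' : s ∉ Set.range e)
    (ht' : t ∉ Set.range e) (hst : s ≠ t) (hus : u ≠ s) (hut : u ≠ t) (hvs : v ≠ s) (hvt : v ≠ t)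
    (hZ : ∀ (Z : MultCyc) (eZ : Z.carrier → B) (lZ : B → Z.index),
      IsModel Z (glue (glue f u v) s t) N eZ lZ → ∃ g', g = g' + 1 ∧ Z.IsGeometric g') :
    IsVal m g f N e l s t x := by
  obtain ⟨hu, hv, huv, hu', hv'⟩ := h.mem
  obtain ⟨Z, eZ, lZ, a, b, c, d, hm, hr, rfl, rfl, rfl, rfl⟩ :=
    exists_double_unglue hX hu hv hs ht hu' hv' hs' ht'
  obtain ⟨g', rfl, hg⟩ := hZ Z eZ lZ hm
  obtain ⟨z, hz⟩ := exists_reach m g' Z hg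
  have hab : a ≠ b := fun h => huv (h ▸ rfl)
  have hcd : c ≠ d := fun h => hst (h ▸ rfl)
  have hac : a ≠ c := fun h => hus (h ▸ rfl)
  have had : a ≠ d := fun h => hut (h ▸ rfl)
  have hbc : b ≠ c := fun h => hvs (h ▸ rfl)
  have hbd : b ≠ d := fun h => hvt (h ▸ rfl)
  exact IsVal.interchange_of hU hab hcd hac had hbc hbd hm hr _ _ (hz.contr hcd) (hz.contr hab)
    (contr_contr_apply Q g' Z hab hcd hac had hbc hbd z) h

end

/-! ### Moving contractions, and uniqueness of reachable elements. -/

section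

/-- The parts of `X` satisfying `p`. -/
def MultCyc.filterParts (X : MultCyc) (p : X.index → Prop) [Nonempty {i // p i}] : MultCyc where
  carrier := {x // p (X.part x)}
  index := {i // p i}
  part x := ⟨X.part x.1, x.2⟩
  next := X.next.subtypePerm (fun x => by
    rw [(X.sameCycle_iff _ _).1 (Perm.sameCycle_apply_left.2 Perm.SameCycle.rfl)])
  sameCycle_iff x y := by
    rw [Perm.sameCycle_subtypePerm, X.sameCycle_iff, Subtype.mk.injEq]

/-- A multicyclically ordered set is the disjoint union of two complementary sets of its parts. -/
def MultCyc.splitParts (X : MultCyc) (p : X.index → Prop) [Nonempty {i // p i}]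
    [Nonempty {i // ¬ p i}] : (X.filterParts p).sum (X.filterParts (fun i => ¬ p i)) ⟶ X where
  toEquiv := Equiv.sumCompl (fun x => p (X.part x))
  indexEquiv := Equiv.sumCompl p
  part_eq x := by rcases x with x | x <;> rfl
  next_eq x := by rcases x with x | x <;> rfl

variable {B : Type}
variable {Q : ModularOperad MultCyc (Type u)} {m : CycFamily Q}
variable {g : ℕ} {X : MultCyc} {f : Perm B} {N : Finset B} {e : X.carrier → B} {l : B → X.index}
  {u v : B} {x x' : (Q.obj (g + 1)).obj X}

/-- Replaces `IsVal.interchange` when the set unglued at both pairs has too many parts to be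
geometric. It is then the disjoint union of a piece containing `u` and `s` and a piece containing
`v` and `t`, and either pair can serve for the composition of the two pieces and the other for the
contraction, by the axiom `contr_comp`. -/
theorem IsVal.interchange_comp {s t : B} (hU : UniqueReach m g) (hX : IsModel X f N e l)
    (h : IsVal m g f N e l u v x) (hs : s ∈ N) (ht : t ∈ N) (hs' : s ∉ Set.range e)
    (ht' : t ∉ Set.range e) (hst : s ≠ t) (hus : u ≠ s) (hut : u ≠ t) (hvs : v ≠ s) (hvt : v ≠ t)
    (hZ : ∀ (Z : MultCyc) (eZ : Z.carrier → B) (lZ : B → Z.index),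
      IsModel Z (glue (glue f u v) s t) N eZ lZ → Nat.card Z.index = g + 2)
    (c₁ : (glue (glue f u v) s t).SameCycle u s) (c₂ : (glue (glue f u v) s t).SameCycle v t)
    (c₃ : ¬ (glue (glue f u v) s t).SameCycle u v) :
    IsVal m g f N e l s t x := by
  obtain ⟨hu, hv, huv, hu', hv'⟩ := h.mem
  obtain ⟨Z, eZ, lZ, a, b, c, d, hm, hr, rfl, rfl, rfl, rfl⟩ :=
    exists_double_unglue hX hu hv hs ht hu' hv' hs' ht'
  have hcard := hZ Z eZ lZ hm
  rw [← hm.lab _ (hm.mem _) _ (hm.mem _), hm.part, hm.part] at c₁ c₂ c₃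
  let p : Z.index → Prop := fun i => i = Z.part a
  have : Nonempty {i // p i} := ⟨⟨Z.part a, rfl⟩⟩
  have : Nonempty {i // ¬ p i} := ⟨⟨Z.part b, fun h => c₃ h.symm⟩⟩
  let C := Z.filterParts p
  let D := Z.filterParts (fun i => ¬ p i)
  let a' : C.carrier := ⟨a, rfl⟩
  let c' : C.carrier := ⟨c, c₁.symm⟩
  let b' : D.carrier := ⟨b, fun h => c₃ h.symm⟩
  let d' : D.carrier := ⟨d, fun h => c₃ (h.symm.trans c₂.symm)⟩
  have hC : Nat.card C.index = 1 := Nat.card_unique (α := {i // i = Z.part a})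
  have hD : Nat.card C.index + Nat.card D.index = Nat.card Z.index := by
    rw [← Nat.card_sum]; exact Nat.card_congr (Z.splitParts p).indexEquiv
  -- `C` has one part and `D` has `g + 1`, so both are geometric, in genus 0 and `g`, with `G = 0`.
  obtain ⟨y, hy⟩ := exists_reach m 0 C ⟨0, by omega⟩
  obtain ⟨z, hz⟩ := exists_reach m g D ⟨0, by omega⟩
  have hac : a' ≠ c' := fun h => hus (congrArg (fun z => eZ z.1) h)
  have hbd : b' ≠ d' := fun h => hvt (congrArg (fun z => eZ z.1) h)
  have hm' := hm.transport (MultCyc.inv (Z.splitParts p))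
  have r := compReach m 0 g g (zero_add g) C D
  refine IsVal.interchange_of hU (Z := C.sum D)
    (eZ := eZ ∘ (MultCyc.inv (Z.splitParts p)).toEquiv.symm)
    (lZ := (MultCyc.inv (Z.splitParts p)).indexEquiv ∘ lZ) (a := .inl a') (b := .inr b') (c := .inl c')
    (d := .inr d') Sum.inl_ne_inr Sum.inl_ne_inr (Sum.inl_injective.ne hac) Sum.inl_ne_inr
    Sum.inr_ne_inl (Sum.inr_injective.ne hbd) hm' (fun n => ?_) _ _ (r c' d' y z hy hz)
    (r a' b' y z hy hz)
    (contr_comp_apply Q (zero_add g) C D (a := c') (c := a') (b := d') (d := b') hac.symm hbd.symm y z)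
    h
  rw [hr]
  constructor
  · rintro ⟨w, ⟨h1, h2, h3, h4⟩, rfl⟩
    obtain ⟨w, rfl⟩ := (Z.splitParts p).toEquiv.surjective w
    refine ⟨w, ⟨?_, ?_, ?_, ?_⟩, rfl⟩ <;> rintro rfl
    exacts [h1 rfl, h2 rfl, h3 rfl, h4 rfl]
  · rintro ⟨w, ⟨h1, h2, h3, h4⟩, rfl⟩
    refine ⟨(Z.splitParts p).toEquiv w, ⟨?_, ?_, ?_, ?_⟩, rfl⟩ <;> intro hw
    · exact h1 ((Z.splitParts p).toEquiv.injective hw)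
    · exact h2 ((Z.splitParts p).toEquiv.injective hw)
    · exact h3 ((Z.splitParts p).toEquiv.injective hw)
    · exact h4 ((Z.splitParts p).toEquiv.injective hw)

/-- For neighbours, removing `u` and renaming `t` to `u` has the same effect as removing `t`. -/
theorem skip_swap_conj {f : Perm B} {u t : B} (h : f u = t ∨ f t = u) :
    swap u t * skip f u * (swap u t)⁻¹ = skip f t := by
  have h1 : ∀ y z, f y = f z → y = z := fun y z h => f.injective h
  ext n
  rw [swap_inv, Perm.mul_apply, Perm.mul_apply]
  simp only [skip_apply, swap_apply_def]
  grind

/-- Neighbouring dummy elements are interchangeable. -/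
theorem IsVal.of_adjacent {s t : B} (hX : IsModel X f N e l) (h : IsVal m g f N e l t s x)
    (hu : u ∈ N) (hu' : u ∉ Set.range e) (hut : u ≠ t) (hus : u ≠ s) (hadj : f u = t ∨ f t = u) :
    IsVal m g f N e l u s x := by
  obtain ⟨ht, hs, hts, ht', hs'⟩ := h.mem
  have hsc : f.SameCycle u t := by
    rcases hadj with h | h
    · rw [← h, Perm.sameCycle_apply_right]
    · rw [← h, Perm.sameCycle_apply_left]
  have herase : ∀ {n}, n ∈ N → N \ N.erase n = {n} := by
    intro n hn
    ext k
    simp only [Finset.mem_sdiff, Finset.mem_erase, Finset.mem_singleton]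
    constructor
    · rintro ⟨a, b⟩; by_contra hc; exact b ⟨hc, a⟩
    · rintro rfl; exact ⟨hn, fun hh => hh.1 rfl⟩
  have h1 := h.restrict (Finset.erase_subset u N)
    (fun x => Finset.mem_erase.2 ⟨fun h => hu' ⟨x, h⟩, hX.mem x⟩)
    (Finset.mem_erase.2 ⟨hut.symm, ht⟩) (Finset.mem_erase.2 ⟨hus.symm, hs⟩) (fun n hn => by
      by_cases hnu : n = u
      · exact ⟨t, Finset.mem_erase.2 ⟨hut.symm, ht⟩, hnu ▸ hsc⟩
      · exact ⟨n, Finset.mem_erase.2 ⟨hnu, hn⟩, Perm.SameCycle.rfl⟩)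
  rw [herase hu, skipAll_singleton] at h1
  -- With `u` removed, `t` is renamed to `u`. The result is the model with `t` removed, into which
  -- `t` can be put back.
  have h2 := h1.rename (swap u t)
  have hmap : (N.erase u).map (swap u t).toEmbedding = N.erase t := by
    ext n
    rw [Finset.mem_map_equiv, symm_swap, Finset.mem_erase, Finset.mem_erase, swap_apply_def]
    split_ifs with a b
    · subst a; simp [hut, ht, hu, hut.symm]
    · subst b; simp
    · simp [a, b]
  have he : swap u t ∘ e = e := by
    funext x
    exact swap_apply_of_ne_of_ne (fun h => hu' ⟨x, h⟩) (fun h => ht' ⟨x, h⟩)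
  rw [skip_swap_conj hadj, hmap, he, swap_apply_right, swap_apply_of_ne_of_ne hus.symm hts.symm,
    ← skipAll_singleton, ← herase ht] at h2
  refine (h2.congr (l' := l) (fun n hn => ?_)).extend hX (Finset.erase_subset t N) (fun n hn => ?_)
  · rw [Function.comp_apply, symm_swap, swap_apply_def]
    split_ifs with a b
    · subst a; exact (hX.lab _ hu _ ht).2 hsc
    · exact ((Finset.mem_erase.1 hn).1 b).elim
    · rfl
  · by_cases hnt : n = t
    · exact ⟨u, Finset.mem_erase.2 ⟨hut, hu⟩, hnt ▸ hsc.symm⟩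
    · exact ⟨n, Finset.mem_erase.2 ⟨hnt, hn⟩, Perm.SameCycle.rfl⟩

/-- A fresh dummy `t` is inserted directly after or before `u`. An interchange `H` of `(u, v)` with
`(s, t)` suffices, since `t` can be replaced by its neighbour `u` and then be dropped. -/
theorem IsVal.move_of {s t q : B} (hX : IsModel X f N e l) (h : IsVal m g f N e l u v x)
    (hs : s ∈ N) (hsu : s ≠ u) (ht : t ∉ N) (hq : q ∈ N) (hqu : q = u ∨ f q = u)
    (H : ∀ l' : B → X.index, IsModel X (glue f q t) (insert t N) e l' →
      IsVal m g (glue f q t) (insert t N) e l' u v x →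
      IsVal m g (glue f q t) (insert t N) e l' s t x) :
    IsVal m g f N e l u s x := by
  obtain ⟨hu, hv, huv, hu', hv'⟩ := h.mem
  obtain ⟨l', h1, h2, -⟩ := hX.exists_insert hq ht
  have hqt : q ≠ t := fun h => ht (h ▸ hq)
  have hut : u ≠ t := fun h => ht (h ▸ hu)
  have hsd : insert t N \ N = {t} := by
    ext n; simp only [Finset.mem_sdiff, Finset.mem_insert, Finset.mem_singleton]
    constructor
    · rintro ⟨a | a, b⟩
      exacts [a, (b a).elim]
    · rintro rfl; exact ⟨.inl rfl, ht⟩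
  have hsk : skipAll (glue f q t) (insert t N \ N) = f := by
    rw [hsd, skipAll_singleton, skip_glue_of_fixed (hX.fix t ht) hqt]
  have hqt' : (glue f q t).SameCycle t q := by
    have h3 : (glue f q t).SameCycle (glue f q t q) q :=
      Perm.sameCycle_apply_left.2 Perm.SameCycle.rfl
    rwa [glue_apply, if_pos rfl, hX.fix t ht] at h3
  have hmeet : ∀ n ∈ insert t N, ∃ m ∈ N, (glue f q t).SameCycle n m := fun n hn => by
    rcases Finset.mem_insert.1 hn with rfl | hn
    · exact ⟨q, hq, hqt'⟩
    · exact ⟨n, hn, Perm.SameCycle.rfl⟩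
  have h3 : IsVal m g (glue f q t) (insert t N) e l' u v x := by
    refine IsVal.extend (N := N) h1 ?_ (Finset.subset_insert _ _) hmeet
    rw [hsk]
    exact h.congr h2
  have h4 := (H l' h1 h3).symm.of_adjacent h1 (Finset.mem_insert_of_mem hu) hu' hut hsu.symm (by
    rcases hqu with rfl | hqu
    · exact .inl (by rw [glue_apply, if_pos rfl, hX.fix t ht])
    · exact .inr (by rw [glue_apply, if_neg hqt.symm, if_pos rfl, hqu]))
  have h5 := h4.restrict (Finset.subset_insert t N) hX.mem hu hs hmeet
  rw [hsk] at h5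
  exact h5.congr (fun n hn => (h2 n hn).symm)

/-- Ungluing within one cycle would produce `g + 3` parts, while a geometric set of genus `g` has at
most `g + 1`. -/
theorem IsVal.not_sameCycle (hX : IsModel X f N e l) (h : IsVal m g f N e l u v x)
    (hc : Nat.card X.index = g + 2) : ¬ f.SameCycle u v := by
  obtain ⟨hu, hv, huv, hu', hv'⟩ := h.mem
  obtain ⟨Y, eY, lY, y₁, y₂, hy, φ, y, hφ, rfl, rfl, hyr, rfl⟩ := h
  intro hs
  have := (hX.card_glue hφ.model hu hv huv).1 hs
  obtain ⟨G, hG⟩ := hyr.isGeometric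
  omega

/-- The second element of a contraction can be moved. -/
theorem IsVal.move [Infinite B] {s : B} (hU : UniqueReach m g) (hX : IsModel X f N e l)
    (hG : X.IsGeometric (g + 1)) (h : IsVal m g f N e l u v x) (hs : s ∈ N)
    (hs' : s ∉ Set.range e) (hsu : s ≠ u) (hsv : s ≠ v)
    (hl : Nat.card X.index = g + 2 → ¬ f.SameCycle u s) : IsVal m g f N e l u s x := by
  obtain ⟨hu, hv, huv, hu', hv'⟩ := h.mem
  obtain ⟨t, ht⟩ := exists_fresh N
  have hut : u ≠ t := fun h => ht (h ▸ hu)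
  have hvt : v ≠ t := fun h => ht (h ▸ hv)
  have hst : s ≠ t := fun h => ht (h ▸ hs)
  have ht' : t ∉ Set.range e := hX.notMem_range ht
  have hb := X.card_index_pos
  -- The numbers of parts after undoing one or two gluings.
  have count : ∀ {q : B} {l' : B → X.index}, q ∈ N → IsModel X (glue f q t) (insert t N) e l' →
      ∀ (Z : MultCyc) (eZ : Z.carrier → B) (lZ : B → Z.index),
      IsModel Z (glue (glue (glue f q t) u v) s t) (insert t N) eZ lZ →
      ∃ w, 0 < w ∧ (f.SameCycle u v → w = Nat.card X.index + 1) ∧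
        (¬ f.SameCycle u v → w + 1 = Nat.card X.index) ∧
        ((glue (glue f q t) u v).SameCycle s t → Nat.card Z.index = w + 1) ∧
        (¬ (glue (glue f q t) u v).SameCycle s t → Nat.card Z.index + 1 = w) := by
    intro q l' hq h1 Z eZ lZ hZ
    have hqt : q ≠ t := fun h => ht (h ▸ hq)
    have hu2 := Finset.mem_insert_of_mem (a := u) (b := t) hu
    have hv2 := Finset.mem_insert_of_mem (a := v) (b := t) hv
    obtain ⟨W, eW, lW, hW, -⟩ := exists_of_model (f := glue (glue f q t) u v) (N := insert t N)
      (T := ∅) (fun n hn => glue_fix (h1.fix n hn) (fun e => hn (e ▸ hu2)) (fun e => hn (e ▸ hv2)))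
      (Finset.empty_subset _) ⟨u, hu2⟩
    obtain ⟨k1, k2⟩ := h1.card_glue hW hu2 hv2 huv
    obtain ⟨k3, k4⟩ := hW.card_glue hZ (Finset.mem_insert_of_mem hs) (Finset.mem_insert_self _ _) hst
    rw [← sameCycle_skip (glue f q t) hut hvt, skip_glue_of_fixed (hX.fix t ht) hqt] at k1 k2
    exact ⟨_, W.card_index_pos, k1, k2, k3, k4⟩
  have hs2 : s ∈ insert t N := Finset.mem_insert_of_mem hs
  have ht2 : t ∈ insert t N := Finset.mem_insert_self _ _
  have hutf : ∀ {F : Perm B} {a b : B}, F a = b → F.SameCycle a b := fun h => by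
    rw [← h, Perm.sameCycle_apply_right]
  have hf'u : glue f u t u = t := by rw [glue_apply, if_pos rfl, hX.fix t ht]
  have hF1v : glue (glue f u t) u v v = t := by rw [glue_apply, if_neg huv.symm, if_pos rfl, hf'u]
  have hskip : skip (glue f u t) t = f := skip_glue_of_fixed (hX.fix t ht) hut
  obtain ⟨G, hG⟩ := hG
  -- This is the case `G = 0`, with the largest number of parts that the genus allows; ungluing at
  -- `u` and `v` must then merge two parts.
  by_cases hc : Nat.card X.index = g + 2
  · have nuv := h.not_sameCycle hX hc
    have nus := hl hc
    refine h.move_of hX hs hsu ht hu (.inl rfl) (fun l' h1 h2 => ?_)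
    have nuv' : ¬ (glue f u t).SameCycle u v := by
      rwa [← sameCycle_skip (glue f u t) hut hvt, hskip]
    have nus' : ¬ (glue f u t).SameCycle u s := by
      rwa [← sameCycle_skip (glue f u t) hut hst, hskip]
    have F1uv := (glue_sameCycle_iff h1.fix huv).2 nuv'
    -- If `s` is on the cycle of `v`, the second ungluing splits what the first has merged. This
    -- leaves `g + 2` parts, too many for two successive contractions, and the composition is used
    -- instead.
    by_cases hvs : f.SameCycle v s
    · have hvs' : (glue f u t).SameCycle v s := by
        rwa [← sameCycle_skip (glue f u t) hvt hst, hskip]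
      have F1st : (glue (glue f u t) u v).SameCycle s t := by
        rcases sameCycle_glue_or (u := u) (v := v) (f := glue f u t) (x := s) (.inr hvs'.symm)
          with k | k
        · exact k.trans (F1uv.trans (hutf hF1v))
        · exact k.trans (hutf hF1v)
      have hF1fix : ∀ n ∉ insert t N, glue (glue f u t) u v n = n := fun n hn =>
        glue_fix (h1.fix n hn) (fun e => hn (e ▸ Finset.mem_insert_of_mem hu))
          (fun e => hn (e ▸ Finset.mem_insert_of_mem hv))
      have nst : ¬ (glue (glue (glue f u t) u v) s t).SameCycle s t := fun k =>
        (glue_sameCycle_iff hF1fix hst).1 k F1st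
      have hvt2 : (glue (glue (glue f u t) u v) s t).SameCycle v t :=
        hutf (by rw [glue_apply, if_neg hsv.symm, if_neg hvt, hF1v])
      -- In the other order, ungluing at `s` and `t` joins the cycles of `u` and `v`, and ungluing
      -- at `u` and `v` splits the result. This locates `u`, `s` on one side and `v`, `t` on the
      -- other.
      have hcomm : glue (glue (glue f u t) u v) s t = glue (glue (glue f u t) s t) u v :=
        glue_comm _ hsu.symm hut hsv.symm hvt
      have hF2fix : ∀ n ∉ insert t N, glue (glue f u t) s t n = n := fun n hn =>
        glue_fix (h1.fix n hn) (fun e => hn (e ▸ hs2)) (fun e => hn (e ▸ ht2))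
      have F2ut : (glue (glue f u t) s t).SameCycle u t :=
        hutf (by rw [glue_apply, if_neg hsu.symm, if_neg hut, hf'u])
      have F2st : (glue (glue f u t) s t).SameCycle s t :=
        (glue_sameCycle_iff h1.fix hst).2 (fun k => nus' ((hutf hf'u).trans k.symm))
      have F2uv : (glue (glue f u t) s t).SameCycle u v := by
        rcases sameCycle_glue_or (u := s) (v := t) (f := glue f u t) (x := v) (.inl hvs')
          with k | k
        · exact F2ut.trans (F2st.symm.trans k.symm)
        · exact F2ut.trans k.symm
      have nuv2 : ¬ (glue (glue (glue f u t) u v) s t).SameCycle u v := by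
        rw [hcomm]
        exact fun k => (glue_sameCycle_iff hF2fix huv).1 k F2uv
      have hus2 : (glue (glue (glue f u t) u v) s t).SameCycle u s := by
        have k := sameCycle_glue_or (u := u) (v := v) (f := glue (glue f u t) s t) (x := s)
          (.inl (F2st.trans F2ut.symm))
        rw [← hcomm] at k
        rcases k with k | k
        · exact k.symm
        · exact (nst (k.trans hvt2)).elim
      refine h2.interchange_comp hU h1 hs2 ht2 hs' ht' hst hsu.symm hut hsv.symm hvt
        (fun Z eZ lZ hZ => ?_) hus2 hvt2 nuv2
      obtain ⟨w, k0, k1, k2, k3, k4⟩ := count hu h1 Z eZ lZ hZ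
      have := k2 nuv
      have := k3 F1st
      omega
    -- Here `s` is on neither cycle, so both ungluings merge parts and `G` stays 0.
    · have hvs' : ¬ (glue f u t).SameCycle v s := by
        rwa [← sameCycle_skip (glue f u t) hvt hst, hskip]
      have F1st : ¬ (glue (glue f u t) u v).SameCycle s t := fun k => by
        have k2 := sameCycle_glue_avoid (f := glue f u t) (c := u) (d := v) (y := s)
          (fun z hz => ⟨fun e => nus' (e ▸ hz.symm), fun e => hvs' (e ▸ hz.symm)⟩) v
        exact hvs' (k2.1 (k.trans (hutf hF1v).symm)).symm
      refine h2.interchange hU h1 hs2 ht2 hs' ht' hst hsu.symm hut hsv.symm hvt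
        (fun Z eZ lZ hZ => ?_)
      obtain ⟨w, k0, k1, k2, k3, k4⟩ := count hu h1 Z eZ lZ hZ
      have := k2 nuv
      have := k4 F1st
      have := Z.card_index_pos
      exact ⟨g - 1, by omega, 0, by omega⟩
  · by_cases huv' : f.SameCycle u v
    · have nuv0 : ¬ (glue f u v).SameCycle u v := fun k =>
        (glue_sameCycle_iff hX.fix huv).1 k huv'
      -- The first ungluing splits the common cycle of `u` and `v`. If `t` is inserted after `u`, it
      -- lands on the piece of `v`; if before, on that of `u`. The side is chosen so that `t` is not
      -- on the cycle of `s` and the second ungluing merges parts.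
      obtain ⟨q, hq, hqu, F1⟩ : ∃ q ∈ N, (q = u ∨ f q = u) ∧
          ¬ (glue (glue f q t) u v).SameCycle s t := by
        have hsk : ∀ {q a b}, q ∈ N → a ≠ t → b ≠ t →
            ((glue (glue f q t) u v).SameCycle a b ↔ (glue f u v).SameCycle a b) := by
          intro q a b hq ha hb
          have hqt : q ≠ t := fun h => ht (h ▸ hq)
          rw [← sameCycle_skip (glue (glue f q t) u v) ha hb, ← skip_glue _ hut.symm hvt.symm,
            skip_glue_of_fixed (hX.fix t ht) hqt]
        by_cases hsv0 : (glue f u v).SameCycle s v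
        · have hqN : f.symm u ∈ N := by
            by_contra hn
            have := hX.fix _ hn
            rw [apply_symm_apply] at this
            exact hn (this ▸ hu)
          have hqt : f.symm u ≠ t := fun h => ht (h ▸ hqN)
          refine ⟨f.symm u, hqN, .inr (apply_symm_apply _ _), fun k => ?_⟩
          have : glue (glue f (f.symm u) t) u v t = u := by
            rw [glue_apply, if_neg hut.symm, if_neg hvt.symm, glue_apply, if_neg hqt.symm,
              if_pos rfl, apply_symm_apply]
          have k2 := (hsk hqN hst hut).1 (k.trans (hutf this))
          exact nuv0 (k2.symm.trans hsv0)
        · exact ⟨u, hu, .inl rfl, fun k => hsv0 ((hsk hu hst hvt).1 (k.trans (hutf hF1v).symm))⟩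
      refine h.move_of hX hs hsu ht hq hqu (fun l' h1 h2 => ?_)
      refine h2.interchange hU h1 hs2 ht2 hs' ht' hst hsu.symm hut hsv.symm hvt
        (fun Z eZ lZ hZ => ?_)
      obtain ⟨w, k0, k1, k2, k3, k4⟩ := count hq h1 Z eZ lZ hZ
      have := k1 huv'
      have := k4 F1
      exact ⟨g - 1, by omega, G - 1, by omega⟩
    · refine h.move_of hX hs hsu ht hu (.inl rfl) (fun l' h1 h2 => ?_)
      refine h2.interchange hU h1 hs2 ht2 hs' ht' hst hsu.symm hut hsv.symm hvt
        (fun Z eZ lZ hZ => ?_)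
      obtain ⟨w, k0, k1, k2, k3, k4⟩ := count hu h1 Z eZ lZ hZ
      have := k2 huv'
      -- The first ungluing merges parts. If the second splits one, `G` drops by one, which is
      -- possible since `G` is positive here; otherwise `G` is unchanged.
      by_cases F1 : (glue (glue f u t) u v).SameCycle s t
      · have := k3 F1
        exact ⟨g - 1, by omega, G - 1, by omega⟩
      · have := k4 F1
        exact ⟨g - 1, by omega, G, by omega⟩

/-- A model of `Y` becomes one of `X` with `y₁` and `y₂` as dummies. The embedding `j` is left free
so that the models of two presentations can be arranged to meet only in the elements of `X`. -/
theorem exists_isVal_of_reach {Y : MultCyc} {y₁ y₂ : Y.carrier} (hy : y₁ ≠ y₂)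
    (φ : Y.cut y₁ y₂ ⟶ X) {y : (Q.obj g).obj Y} (hyr : Reach m g Y y) (j : Y.carrier ⊕ Y.Empties → B)
    (hj : Function.Injective j) :
    ∃ (f : Perm B) (N : Finset B) (l : B → X.index),
      IsModel X f N (fun x => j (.inl (φ.toEquiv.symm x).1)) l ∧ (∀ n, n ∈ N ↔ n ∈ Set.range j) ∧
      IsVal m g f N (fun x => j (.inl (φ.toEquiv.symm x).1)) l (j (.inl y₁)) (j (.inl y₂))
        ((Q.obj (g + 1)).map φ (Q.contr g Y hy y)) := by
  obtain ⟨f, N, l, h, hN⟩ := exists_model Y j hj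
  obtain ⟨c, hc, hc'⟩ := h.exists_cut (u := y₁) (v := y₂)
  have hm : IsModel Y (glue (glue f ((j ∘ Sum.inl) y₁) ((j ∘ Sum.inl) y₂)) ((j ∘ Sum.inl) y₁)
      ((j ∘ Sum.inl) y₂)) N (j ∘ Sum.inl) l := by rwa [glue_glue]
  refine ⟨_, N, _, hc.transport φ, hN, Y, j ∘ Sum.inl, l, y₁, y₂, hy, φ, y, ⟨hm, c, ?_, ?_⟩, rfl, rfl,
    hyr, rfl⟩
  · rwa [glue_glue]
  · exact ⟨fun z => by simp, fun n hn => rfl⟩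

/-- There is at most one reachable element. -/
theorem uniqueReach (m : CycFamily Q) (g : ℕ) : UniqueReach m g := by
  induction g with
  | zero =>
    rintro X x x' ⟨h, rfl⟩ ⟨h', rfl⟩
    rfl
  | succ g hU =>
    intro X x x' hx hx'
    have hG := hx.isGeometric
    obtain ⟨B, hB, ⟨b₀⟩⟩ : ∃ B : Type, Infinite B ∧ Nonempty B :=
      ⟨ℕ, inferInstance, inferInstance⟩
    obtain ⟨Y, y₁, y₂, hy, φ, y, hyr, rfl⟩ := hx
    obtain ⟨Y', y₁', y₂', hy', φ', y', hyr', rfl⟩ := hx'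
    obtain ⟨j, hj, -⟩ := exists_extension (γ := Y.carrier ⊕ Y.Empties) ∅ (fun _ => b₀)
      (by simp) ∅ (by simp)
    obtain ⟨f, N, l, hM, hN, hV⟩ := exists_isVal_of_reach hy φ hyr j hj
    set e : X.carrier → B := fun x => j (.inl (φ.toEquiv.symm x).1) with he
    -- `K` consists of the elements of `Y'` that survive in `X`; there the second embedding must
    -- agree with `e`. Everything else is sent outside `N`, and the default `b₀` of `e₀` is never
    -- used.
    let K : Set (Y'.carrier ⊕ Y'.Empties) := {z | ∃ w : (Y'.cut y₁' y₂').carrier, z = .inl w.1}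
    let e₀ : Y'.carrier ⊕ Y'.Empties → B := fun z =>
      if h : ∃ w : (Y'.cut y₁' y₂').carrier, z = .inl w.1 then e (φ'.toEquiv h.choose) else b₀
    have he₀ : ∀ w : (Y'.cut y₁' y₂').carrier, e₀ (.inl w.1) = e (φ'.toEquiv w) := fun w => by
      have h : ∃ w' : (Y'.cut y₁' y₂').carrier,
        (.inl w.1 : Y'.carrier ⊕ Y'.Empties) = .inl w'.1 := ⟨w, rfl⟩
      simp only [e₀, dif_pos h]
      congr 2
      exact Subtype.ext (Sum.inl_injective h.choose_spec).symm
    obtain ⟨j', hj', hjK, hjN⟩ := exists_extension K e₀ (by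
      rintro _ ⟨w, rfl⟩ _ ⟨w', rfl⟩ h
      rw [he₀, he₀] at h
      rw [φ'.toEquiv.injective (hM.inj h)]) N (by
      rintro _ ⟨w, rfl⟩
      rw [he₀]
      exact hM.mem _)
    obtain ⟨f', N', l', hM', hN', hV'⟩ := exists_isVal_of_reach hy' φ' hyr' j' hj'
    have hee : (fun x => j' (.inl (φ'.toEquiv.symm x).1)) = e := by
      funext x
      rw [hjK _ ⟨_, rfl⟩, he₀, apply_symm_apply]
    rw [hee] at hM' hV'
    have hdisj : ∀ n ∈ N, n ∈ N' → n ∈ Set.range e := by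
      intro n hn hn'
      obtain ⟨z, rfl⟩ := (hN' n).1 hn'
      by_cases hz : z ∈ K
      · obtain ⟨w, rfl⟩ := hz
        rw [hjK _ ⟨_, rfl⟩, he₀]
        exact ⟨_, rfl⟩
      · exact (hjN z hz hn).elim
    obtain ⟨F, L, hF, hF1, hF2, hL1, hL2⟩ := hM.amalgamate hM' hdisj
    generalize j (.inl y₁) = u at hV
    generalize j (.inl y₂) = v at hV
    generalize j' (.inl y₁') = u' at hV'
    generalize j' (.inl y₂') = v' at hV'
    generalize (Q.obj (g + 1)).map φ (Q.contr g Y hy y) = x at hV ⊢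
    generalize (Q.obj (g + 1)).map φ' (Q.contr g Y' hy' y') = x' at hV' ⊢
    obtain ⟨hu, hv, huv, hue, hve⟩ := hV.mem
    obtain ⟨hu', hv', huv', hue', hve'⟩ := hV'.mem
    have meets : ∀ {M : Finset B} {k : B → X.index} {p : Perm B}, IsModel X p M e k →
        M ⊆ N ∪ N' → (∀ n ∈ M, L n = k n) → ∀ n ∈ N ∪ N', ∃ i ∈ M, F.SameCycle n i := by
      intro M k p hp hM hk n hn
      obtain ⟨i, hi, hki⟩ := hp.surj (L n)
      exact ⟨i, hi, (hF.lab n hn i (hM hi)).1 (by rw [hk i hi, hki])⟩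
    have hW : IsVal m g F (N ∪ N') e L u v x := by
      refine IsVal.extend (N := N) hF ?_ Finset.subset_union_left
        (meets hM Finset.subset_union_left hL1)
      rw [hF1]
      exact hV.congr hL1
    have hW' : IsVal m g F (N ∪ N') e L u' v' x' := by
      refine IsVal.extend (N := N') hF ?_ Finset.subset_union_right
        (meets hM' Finset.subset_union_right hL2)
      rw [hF2]
      exact hV'.congr hL2
    have sep : ∀ {a b : B}, a ∈ N → b ∈ N' → a ∉ Set.range e → b ≠ a := by
      rintro a b ha hb hae rfl
      exact hae (hdisj b ha hb)
    -- It is enough to move the contraction to one that involves a given element.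
    have key : ∀ {u' v' : B}, u' ∈ N' → v' ∈ N' → u' ∉ Set.range e → v' ∉ Set.range e → u' ≠ v' →
        IsVal m g F (N ∪ N') e L u' v' x' →
        (Nat.card X.index = g + 2 → ¬ F.SameCycle u u') → x = x' := by
      intro u' v' hu' hv' hue' hve' huv' hW' hl
      have h1 := hW.move hU hF hG (Finset.mem_union_right N hu') hue' (sep hu hu' hue)
        (sep hv hu' hve) hl
      have h2 := h1.symm.move hU hF hG (Finset.mem_union_right N hv') hve' huv'.symm
        (sep hu hv' hue) (hW'.not_sameCycle hF)
      exact h2.unique hU hF hW'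
    -- Moving to `(u, u')` is impossible only if `G = 0` and `u`, `u'` share a cycle. Then `v'` is
    -- not on that cycle, and `u'` and `v'` exchange their roles.
    by_cases hl : Nat.card X.index = g + 2 → ¬ F.SameCycle u u'
    · exact key hu' hv' hue' hve' huv' hW' hl
    · push Not at hl
      exact key hv' hu' hve' hue' huv'.symm hW'.symm
        (fun hc k => hW'.not_sameCycle hF hc (hl.2.symm.trans k))

end

/-! ### Formal properties of values of left adjoints. -/

section

namespace IsLeftAdjointValue
variable {C D E : Type*} [Category C] [Category D] [Category E]

theorem comp {R : D ⥤ C} {R' : E ⥤ D} {c : C} {d : D} {e : E} (h : IsLeftAdjointValue R c d)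
    (h' : IsLeftAdjointValue R' d e) : IsLeftAdjointValue (R' ⋙ R) c e := by
  obtain ⟨η, hη⟩ := h
  obtain ⟨ζ, hζ⟩ := h'
  refine ⟨η ≫ R.map ζ, fun x f => ?_⟩
  obtain ⟨f₁, h₁, u₁⟩ := hη _ f
  obtain ⟨f₂, h₂, u₂⟩ := hζ _ f₁
  refine ⟨f₂, ?_, fun y hy => u₂ _ (u₁ _ ?_)⟩
  · dsimp only [Functor.comp_map]
    rw [Category.assoc, ← R.map_comp, h₂, h₁]
  · dsimp only [Functor.comp_map] at hy ⊢
    rw [R.map_comp, ← Category.assoc, hy]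

/-- Morphisms from `d` to `R'.obj x` correspond to morphisms from `c` to the image of `x` under both
functors, and hence to morphisms from `e` to `x`. -/
theorem cancel {R : D ⥤ C} {R' : E ⥤ D} {c : C} {d : D} {e : E} (h : IsLeftAdjointValue R c d)
    (h' : IsLeftAdjointValue (R' ⋙ R) c e) : IsLeftAdjointValue R' d e := by
  obtain ⟨η, hη⟩ := h
  obtain ⟨ζ, hζ⟩ := h'
  obtain ⟨θ, hθ, -⟩ := hη _ ζ
  refine ⟨θ, fun x f => ?_⟩
  obtain ⟨f', h₁, u₁⟩ := hζ x (η ≫ R.map f)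
  refine ⟨f', ?_, fun y hy => u₁ _ ?_⟩
  · refine (hη _ (η ≫ R.map f)).unique ?_ rfl
    rw [R.map_comp, ← Category.assoc, hθ]
    exact h₁
  · subst hy
    dsimp only [Functor.comp_map]
    rw [R.map_comp, ← Category.assoc, hθ]

theorem exists_iso {R : D ⥤ C} {c : C} {d d' : D} (h : IsLeftAdjointValue R c d)
    (h' : IsLeftAdjointValue R c d') : Nonempty (d ≅ d') := by
  obtain ⟨η, hη⟩ := h
  obtain ⟨ζ, hζ⟩ := h'
  obtain ⟨f, hf, -⟩ := hη _ ζ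
  obtain ⟨g, hg, -⟩ := hζ _ η
  refine ⟨f, g, (hη _ η).unique ?_ (by simp), (hζ _ ζ).unique ?_ (by simp)⟩
  · rw [R.map_comp, ← Category.assoc, hf, hg]
  · rw [R.map_comp, ← Category.assoc, hg, hf]

theorem of_adjunction {R : D ⥤ C} {L : C ⥤ D} (adj : L ⊣ R) (c : C) :
    IsLeftAdjointValue R c (L.obj c) := by
  refine ⟨adj.unit.app c, fun d f => ⟨(adj.homEquiv _ _).symm f, ?_, fun y hy => ?_⟩⟩
  · beta_reduce
    rw [← adj.homEquiv_unit, Equiv.apply_symm_apply]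
  · rw [Equiv.eq_symm_apply, adj.homEquiv_unit, hy]

theorem fullSubcategory {p : ObjectProperty D} {R : D ⥤ C} {c : C} {d : p.FullSubcategory}
    (h : IsLeftAdjointValue R c d.obj) : IsLeftAdjointValue (p.ι ⋙ R) c d := by
  obtain ⟨η, hη⟩ := h
  refine ⟨η, fun x f => ?_⟩
  obtain ⟨f', hf, hu⟩ := hη x.obj f
  exact ⟨ObjectProperty.homMk f', hf, fun y hy => ObjectProperty.hom_ext _ (hu _ hy)⟩

/-- The value of a left adjoint, transported along a pair of functors with left adjoints. -/
theorem transfer {C' D' : Type*} [Category C'] [Category D'] {S : D ⥤ C} {S' : D' ⥤ C'}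
    {U : C' ⥤ C} {V : D' ⥤ D} (e : V ⋙ S = S' ⋙ U) {c : C} {c' : C'} {d : D} {d' : D'}
    (hU : IsLeftAdjointValue U c c') (hV : IsLeftAdjointValue V d d')
    (h : IsLeftAdjointValue S c d) : IsLeftAdjointValue S' c' d' :=
  -- The object `d'` is the value at `c` for `V ⋙ S`, hence for `S' ⋙ U`; cancelling `U` leaves
  -- `S'`.
  hU.cancel (e ▸ h.comp hV)

end IsLeftAdjointValue

/-! ### Forgetful functors on operads, and morphisms of operads in sets elementwise. -/

section
variable (M : Type*) [Category M] [MonoidalCategory M] [BraidedCategory M]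

/-- The components of genus `0` at the cyclically ordered sets, of a not necessarily geometric
operad. -/
def nsBoxAll : ModularOperad MultCyc M ⥤ NsCycOp M where
  obj P :=
    { obj := ObjectProperty.ι _ ⋙ P.obj 0
      comp C D := P.comp (zero_add 0) C.obj D.obj
      comp_swap C D := P.comp_swap _ _ C.obj D.obj
      comp_assoc C D E := P.comp_assoc _ _ _ _ C.obj D.obj E.obj
      comp_natural f g := P.comp_natural _ f.hom g.hom }
  map f := ⟨Functor.whiskerLeft _ (f.app 0), fun C D => f.app_comp _ C.obj D.obj⟩

/-- Desymmetrization of cyclic operads. -/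
def desCyc : CycOp M ⥤ NsCycOp M where
  obj P :=
    { obj := ObjectProperty.ι _ ⋙ forgetOrder ⋙ P.obj
      comp C D := P.comp (forgetOrder.obj C.obj) (forgetOrder.obj D.obj)
      comp_swap C D := P.comp_swap (forgetOrder.obj C.obj) (forgetOrder.obj D.obj)
      comp_assoc C D E :=
        P.comp_assoc (forgetOrder.obj C.obj) (forgetOrder.obj D.obj) (forgetOrder.obj E.obj)
      comp_natural f g := P.comp_natural (forgetOrder.map f.hom) (forgetOrder.map g.hom) }
  map f := ⟨Functor.whiskerLeft _ (Functor.whiskerLeft _ f.app), fun C D =>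
    f.app_comp (forgetOrder.obj C.obj) (forgetOrder.obj D.obj)⟩

end

section Elementwise

theorem modHom_comp_apply {G : Type*} [Category G] [CutBase G] {P Q : ModularOperad G (Type u)}
    (f : P ⟶ Q) {g' g'' g : ℕ} (hg : g' + g'' = g) (X Y : G) (u : El X) (v : El Y)
    (x : (P.obj g').obj X) (y : (P.obj g'').obj Y) :
    (f.app g).app (merge X Y u v) (P.comp hg X Y u v (x, y)) =
      Q.comp hg X Y u v ((f.app g').app X x, (f.app g'').app Y y) :=
  let p : _ × _ := (x, y); type_congr_hom (f.app_comp hg X Y u v) p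

theorem modHom_contr_apply {G : Type*} [Category G] [CutBase G] {P Q : ModularOperad G (Type u)}
    (f : P ⟶ Q) (g : ℕ) (X : G) {u v : El X} (h : u ≠ v) (x : (P.obj g).obj X) :
    (f.app (g + 1)).app (cut X u v) (P.contr g X h x) = Q.contr g X h ((f.app g).app X x) :=
  type_congr_hom (f.app_contr g X h) x

theorem cycHom_comp_apply {G : Type*} [Category G] [MergeBase G] {P Q : CyclicOperad G (Type u)}
    (f : P ⟶ Q) (X Y : G) (u : El X) (v : El Y) (x : P.obj.obj X) (y : P.obj.obj Y) :
    f.app.app (merge X Y u v) (P.comp X Y u v (x, y)) =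
      Q.comp X Y u v (f.app.app X x, f.app.app Y y) :=
  let p : _ × _ := (x, y); type_congr_hom (f.app_comp X Y u v) p

theorem nat_apply {G : Type*} [Category G] {F F' : G ⥤ Type u} (f : F ⟶ F') {X Y : G} (φ : X ⟶ Y)
    (x : F.obj X) : f.app Y (F.map φ x) = F'.map φ (f.app X x) :=
  type_congr_hom (f.naturality φ) x

theorem type_hom_ext {α β : Type u} {f g : α ⟶ β} (h : ∀ x, f x = g x) : f = g :=
  TypeCat.Hom.ext (TypeCat.Fun.ext (funext h))

end Elementwise

/-! ### Universal properties in the category of sets. -/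

variable {Q : ModularOperad MultCyc (Type u)}

/-- The values of a morphism from the terminal non-Σ cyclic operad. -/
def cycFamilyOfHom (f : starC ⟶ (nsBoxAll (Type u)).obj Q) : CycFamily Q where
  elem C := f.app.app C PUnit.unit
  map_elem φ := (nat_apply f.app φ PUnit.unit).symm
  comp_elem C D u v := (cycHom_comp_apply f C D u v PUnit.unit PUnit.unit).symm

/-- The reachable element. -/
def CycFamily.extend (m : CycFamily Q) (g : ℕ) (X : MultCyc) (h : X.IsGeometric g) :
    (Q.obj g).obj X := (exists_reach m g X h).choose

theorem CycFamily.reach_extend (m : CycFamily Q) {g : ℕ} {X : MultCyc} (h : X.IsGeometric g) :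
    Reach m g X (m.extend g X h) := (exists_reach m g X h).choose_spec

theorem CycFamily.eq_extend (m : CycFamily Q) {g : ℕ} {X : MultCyc} (h : X.IsGeometric g)
    {x : (Q.obj g).obj X} (hx : Reach m g X x) : x = m.extend g X h :=
  uniqueReach m g X _ _ hx (m.reach_extend h)

/-- The morphism from the terminal geometric non-Σ modular operad extending a family of elements at
the cyclically ordered sets. -/
def CycFamily.hom (m : CycFamily Q) : starM.obj ⟶ Q where
  app g :=
    { app := fun X => TypeCat.ofHom (fun x => m.extend g X x.down.down)
      naturality := fun X Y φ => type_hom_ext fun x =>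
        (m.eq_extend (x.down.down.of_iso φ) ((m.reach_extend x.down.down).map φ)).symm }
  app_comp hg X Y u v := type_hom_ext fun p => (m.eq_extend (p.1.down.down.merge p.2.down.down hg u v)
    (compReach m _ _ _ hg X Y u v _ _
    (m.reach_extend p.1.down.down) (m.reach_extend p.2.down.down))).symm
  app_contr g X u v h := type_hom_ext fun x =>
    (m.eq_extend (x.down.down.cut h) ((m.reach_extend x.down.down).contr h)).symm

/-- Uniqueness of the extension: a morphism that restricts to the family in genus 0 is forced on all
reachable elements, since it commutes with contractions and isomorphisms. -/
theorem CycFamily.eq_of_reach {m : CycFamily Q} (f : starM.obj ⟶ Q)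
    (hf : ∀ (C : Cyc) (x : (starM.obj.obj 0).obj C.obj), (f.app 0).app C.obj x = m.elem C) {g : ℕ}
    {X : MultCyc} {x : (Q.obj g).obj X} (hx : Reach m g X x) (y : (starM.obj.obj g).obj X) :
    (f.app g).app X y = x := by
  induction g generalizing X with
  | zero =>
    obtain ⟨h, rfl⟩ := hx
    exact hf ⟨X, h⟩ y
  | succ g ih =>
    obtain ⟨Y, u, v, h, φ, z, hz, rfl⟩ := hx
    rw [← ih hz ⟨⟨hz.isGeometric⟩⟩]
    exact (congrArg ((f.app (g + 1)).app X) rfl).trans ((nat_apply (f.app (g + 1)) φ _).trans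
      (congrArg ((Q.obj (g + 1)).map φ)
        (modHom_contr_apply f g Y h (⟨⟨hz.isGeometric⟩⟩ : (starM.obj.obj g).obj Y))))

theorem isGeometric_zero (C : Cyc) : C.obj.IsGeometric 0 := ⟨0, by rw [C.property]⟩

/-- The terminal geometric non-Σ modular operad in the category of sets is the envelope of the
terminal non-Σ cyclic operad. -/
theorem isLeftAdjointValue_nsBoxAll :
    IsLeftAdjointValue (nsBoxAll (Type u)) starC starM.obj := by
  refine ⟨⟨{ app := fun C => TypeCat.ofHom (fun _ => ⟨⟨isGeometric_zero C⟩⟩)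
             naturality := fun _ _ _ => rfl }, fun _ _ _ _ => rfl⟩, fun Q f => ?_⟩
  refine ⟨(cycFamilyOfHom f).hom, ?_, fun f' hf => ?_⟩
  · refine CyclicOperad.Hom.ext (NatTrans.ext (funext fun C => type_hom_ext fun x => ?_))
    exact ((cycFamilyOfHom f).eq_extend (isGeometric_zero C) ⟨C.property, rfl⟩).symm
  · refine ModularOperad.Hom.ext (funext fun g => NatTrans.ext (funext fun X =>
      type_hom_ext fun x => ?_))
    refine CycFamily.eq_of_reach f' (fun C y => ?_) ((cycFamilyOfHom f).reach_extend x.down.down) x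
    subst hf
    rfl

theorem merge_order (X Y : MultCyc) (u : X.carrier) (v : Y.carrier) :
    MultOrd.merge (S := ⟨X.carrier⟩) (T := ⟨Y.carrier⟩) X.order Y.order u v =
      (X.merge Y u v).order := by
  refine (MultOrd.merge_order_left X (T := ⟨Y.carrier⟩) Y.order u v).trans ?_
  refine Eq.trans ?_ (MultOrd.order_map (MultCyc.cutMap (MultCyc.sumMap (𝟙 X) (MultOrd.ofOrder Y))
      (u := Sum.inl u) (v := Sum.inr v) rfl rfl))
  refine (MultOrd.map_refl _).symm.trans ?_
  congr 1
  ext x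
  rcases x with ⟨x | x, hx⟩ <;> rfl

/-- The isomorphism `MultOrd.ofOrder X` is the identity on elements, so it acts trivially on a
desymmetrized operad. Hence the value at `X` depends only on the order of `X`, not on the names of
its parts. -/
theorem des_eq_of_order {P : ModOp (Type u)} (f : starM.obj ⟶ (des (Type u)).obj P) {g : ℕ}
    {X : MultCyc} (h : X.IsGeometric g)
    (h' : (MultOrd.toMultCyc (S := ⟨X.carrier⟩) X.order).IsGeometric g) :
    (f.app g).app (MultOrd.toMultCyc (S := ⟨X.carrier⟩) X.order) ⟨⟨h'⟩⟩ = (f.app g).app X ⟨⟨h⟩⟩ := by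
  have := nat_apply (f.app g) (MultOrd.ofOrder X) ⟨⟨h'⟩⟩
  exact ((functor_map_id (P.obj g) _).symm.trans this.symm)

/-- The modular operad of multicyclic orders is the symmetrization of the terminal geometric non-Σ
modular operad in the category of sets. -/
theorem isLeftAdjointValue_des : IsLeftAdjointValue (des (Type u)) starM.obj multOrders := by
  let η : starM.obj ⟶ (des (Type u)).obj multOrders :=
    { app := fun g =>
        { app := fun X => TypeCat.ofHom (fun x =>
            ⟨⟨X.order, x.down.down.of_iso (MultCyc.inv (MultOrd.ofOrder X))⟩⟩)
          naturality := fun _ _ φ => ulift_hom_ext fun _ => (MultOrd.order_map φ).symm }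
      app_comp := fun _ X Y u v => ulift_hom_ext fun _ => (merge_order X Y u v).symm
      app_contr := fun _ X u v _ => ulift_hom_ext fun _ => (MultOrd.cut_order X u v).symm }
  refine ⟨η, fun P f => ?_⟩
  -- A multicyclic order on `S` is sent to the value of `f` at `S` equipped with this order.
  let f₀ : multOrders ⟶ P :=
    { app := fun g =>
        { app := fun S => TypeCat.ofHom (fun o => (f.app g).app o.down.1.toMultCyc ⟨⟨o.down.2⟩⟩)
          naturality := fun S T e => type_hom_ext fun o =>
            nat_apply (f.app g) (MultOrd.mapHom e o.down.1) ⟨⟨o.down.2⟩⟩ }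
      app_comp := fun hg S T u v => type_hom_ext fun o => by
        have h1 := o.1.down.2.merge o.2.down.2 hg u v
        refine (des_eq_of_order f h1 (h1.of_iso (MultCyc.inv (MultOrd.ofOrder _)))).trans ?_
        exact modHom_comp_apply f hg o.1.down.1.toMultCyc o.2.down.1.toMultCyc u v
          ⟨⟨o.1.down.2⟩⟩ ⟨⟨o.2.down.2⟩⟩
      app_contr := fun g S u v h => type_hom_ext fun o => by
        have h1 := o.down.2.cut h
        refine (des_eq_of_order f h1 (h1.of_iso (MultCyc.inv (MultOrd.ofOrder _)))).trans ?_
        exact modHom_contr_apply f g o.down.1.toMultCyc h ⟨⟨o.down.2⟩⟩ }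
  refine ⟨f₀, ?_, fun f' hf => ?_⟩
  · refine ModularOperad.Hom.ext (funext fun g => NatTrans.ext (funext fun X =>
      type_hom_ext fun x => ?_))
    exact des_eq_of_order f x.down.down _
  · refine ModularOperad.Hom.ext (funext fun g => NatTrans.ext (funext fun S =>
      type_hom_ext fun o => ?_))
    subst hf
    refine congrArg ((f'.app g).app S) (congrArg ULift.up (Subtype.ext ?_))
    -- Every multicyclic order is the order of a multicyclically ordered set, so all components are
    -- hit by `η` and the extension is unique.
    exact (MultOrd.order_toMultCyc o.down.1).symm

theorem isCyclic_order (C : Cyc) :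
    MultOrd.IsCyclic (S := ⟨C.obj.carrier⟩) C.obj.order :=
  (Nat.card_congr (MultOrd.ofOrder C.obj).indexEquiv).trans C.property

theorem desCyc_eq_of_order {P : CycOp (Type u)} (f : starC ⟶ (desCyc (Type u)).obj P) (C : Cyc) :
    f.app.app ⟨MultOrd.toMultCyc (S := ⟨C.obj.carrier⟩) C.obj.order, isCyclic_order C⟩ PUnit.unit =
      f.app.app C PUnit.unit := by
  let φ : (⟨MultOrd.toMultCyc (S := ⟨C.obj.carrier⟩) C.obj.order, isCyclic_order C⟩ : Cyc) ⟶ C :=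
    ObjectProperty.homMk (MultOrd.ofOrder C.obj)
  exact (functor_map_id P.obj _).symm.trans (nat_apply f.app φ PUnit.unit).symm

/-- The cyclic operad of cyclic orders is the symmetrization of the terminal non-Σ cyclic operad in
the category of sets. -/
theorem isLeftAdjointValue_desCyc : IsLeftAdjointValue (desCyc (Type u)) starC cycOrders := by
  let η : starC ⟶ (desCyc (Type u)).obj cycOrders :=
    { app :=
        { app := fun C => TypeCat.ofHom (fun _ => ⟨⟨C.obj.order, isCyclic_order C⟩⟩)
          naturality := fun _ _ φ => ulift_hom_ext fun _ => (MultOrd.order_map φ.hom).symm }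
      app_comp := fun C D u v => ulift_hom_ext fun _ => (merge_order C.obj D.obj u v).symm }
  refine ⟨η, fun P f => ?_⟩
  let f₀ : cycOrders ⟶ P :=
    { app :=
        { app := fun S => TypeCat.ofHom (fun o =>
            f.app.app ⟨o.down.1.toMultCyc, o.down.2⟩ PUnit.unit)
          naturality := fun S T e => type_hom_ext fun o => by
            let D : Cyc := ⟨MultOrd.toMultCyc (S := T) (o.down.1.map e),
              (Nat.card_congr (MultOrd.mapHom e o.down.1).indexEquiv).symm.trans o.down.2⟩
            exact nat_apply f.app (X := ⟨o.down.1.toMultCyc, o.down.2⟩) (Y := D)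
              (ObjectProperty.homMk (MultOrd.mapHom e o.down.1)) PUnit.unit }
      app_comp := fun S T u v => type_hom_ext fun o => by
        refine (desCyc_eq_of_order f (merge (G := Cyc) ⟨o.1.down.1.toMultCyc, o.1.down.2⟩
          ⟨o.2.down.1.toMultCyc, o.2.down.2⟩ u v)).trans ?_
        exact cycHom_comp_apply f ⟨o.1.down.1.toMultCyc, o.1.down.2⟩
          ⟨o.2.down.1.toMultCyc, o.2.down.2⟩ u v PUnit.unit PUnit.unit }
  refine ⟨f₀, ?_, fun f' hf => ?_⟩
  · refine CyclicOperad.Hom.ext (NatTrans.ext (funext fun C => type_hom_ext fun x => ?_))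
    exact desCyc_eq_of_order f C
  · refine CyclicOperad.Hom.ext (NatTrans.ext (funext fun S => type_hom_ext fun o => ?_))
    subst hf
    refine congrArg (f'.app.app S) (congrArg ULift.up (Subtype.ext ?_))
    exact (MultOrd.order_toMultCyc o.down.1).symm

/-- The modular operad of multicyclic orders is the envelope of the cyclic operad of cyclic orders. -/
theorem isLeftAdjointValue_box : IsLeftAdjointValue (box (Type u)) cycOrders multOrders :=
  -- Forgetting orders and restricting to genus 0 commute by definition: `des ⋙ nsBoxAll` and `box ⋙
  -- desCyc` are the same functor.
  isLeftAdjointValue_desCyc.cancel (R' := box (Type u))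
    (isLeftAdjointValue_nsBoxAll.comp isLeftAdjointValue_des)

theorem starC_isTerminal : Nonempty (Limits.IsTerminal starC.{u}) := by
  let f (P : NsCycOp (Type u)) : P ⟶ starC :=
    { app := { app := fun _ => TypeCat.ofHom (fun _ => PUnit.unit) }
      app_comp := fun _ _ _ _ => rfl }
  exact ⟨Limits.IsTerminal.ofUniqueHom f fun P f => CyclicOperad.Hom.ext (NatTrans.ext
    (funext fun C => type_hom_ext fun x => rfl))⟩

/-- An initial set maps to the empty set and is therefore empty. This is what allows a morphism from
a geometric operad to `starM`. -/
theorem IsGeometricOperad.isGeometric {P : ModularOperad MultCyc (Type u)} (hP : IsGeometricOperad P)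
    {g : ℕ} {X : MultCyc} (x : (P.obj g).obj X) : X.IsGeometric g := by
  by_contra h
  obtain ⟨i⟩ := hP g X h
  exact (i.to PEmpty x).elim

theorem starM_isTerminal : Nonempty (Limits.IsTerminal starM.{u}) := by
  let f (P : NsModOp (Type u)) : P.obj ⟶ starM.obj :=
    { app := fun _ =>
        { app := fun _ => TypeCat.ofHom (fun x => ⟨⟨P.property.isGeometric x⟩⟩) }
      app_comp := fun _ _ _ _ _ => rfl
      app_contr := fun _ _ _ _ _ => rfl }
  exact ⟨Limits.IsTerminal.ofUniqueHom (fun P => ObjectProperty.homMk (f P)) fun P f =>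
    ObjectProperty.hom_ext _ (ModularOperad.Hom.ext (funext fun g => NatTrans.ext
      (funext fun X => type_hom_ext fun x => rfl)))⟩

end

/-! ### Passage from sets to modules. -/

section

section MapLax
variable {M N : Type*} [Category M] [MonoidalCategory M] [BraidedCategory M] [Category N]
  [MonoidalCategory N] [BraidedCategory N] (F : M ⥤ N) [F.LaxBraided]

/-- The functor on cyclic operads induced by a lax symmetric monoidal functor. -/
def cycMapLax (G : Type*) [Category G] [MergeBase G] : CyclicOperad G M ⥤ CyclicOperad G N where
  obj P := P.mapLax F
  map f :=
    { app := Functor.whiskerRight f.app F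
      app_comp := fun X Y u v => by
        dsimp only [CyclicOperad.mapLax, Functor.whiskerRight_app, Functor.comp_obj]
        rw [Category.assoc, ← F.map_comp, f.app_comp, F.map_comp,
          Functor.LaxMonoidal.μ_natural_assoc] }
  map_id P := CyclicOperad.Hom.ext (Functor.whiskerRight_id' F)
  map_comp f g := CyclicOperad.Hom.ext (Functor.whiskerRight_comp f.app g.app F)

/-- The functor on modular operads induced by a lax symmetric monoidal functor. -/
def modMapLax (G : Type*) [Category G] [CutBase G] : ModularOperad G M ⥤ ModularOperad G N where
  obj P := P.mapLax F
  map f :=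
    { app := fun g => Functor.whiskerRight (f.app g) F
      app_comp := fun hg X Y u v => by
        dsimp only [ModularOperad.mapLax, Functor.whiskerRight_app, Functor.comp_obj]
        rw [Category.assoc, ← F.map_comp, f.app_comp, F.map_comp,
          Functor.LaxMonoidal.μ_natural_assoc]
      app_contr := fun g X u v h => by
        dsimp only [ModularOperad.mapLax, Functor.whiskerRight_app, Functor.comp_obj]
        rw [← F.map_comp, f.app_contr, F.map_comp] }
  map_id P := ModularOperad.Hom.ext (funext fun g => Functor.whiskerRight_id' F)
  map_comp f g := ModularOperad.Hom.ext
    (funext fun n => Functor.whiskerRight_comp (f.app n) (g.app n) F)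

/-- The forgetful functors only select components, and a lax monoidal functor is applied to each
component; the same holds for the two equalities that follow. -/
theorem modMapLax_nsBoxAll :
    modMapLax F MultCyc ⋙ nsBoxAll N = nsBoxAll M ⋙ cycMapLax F Cyc := rfl

theorem modMapLax_des : modMapLax F FinSet ⋙ des N = des M ⋙ modMapLax F MultCyc := rfl

theorem modMapLax_box : modMapLax F FinSet ⋙ box N = box M ⋙ cycMapLax F FinSet := rfl

end MapLax

open TensorProduct

variable (k : Type u) [CommRing k]

/-- The forgetful functor from modules to sets is lax symmetric monoidal. -/
instance forgetLaxBraided : (forget (ModuleCat.{u} k)).LaxBraided where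
  ε := TypeCat.ofHom (fun _ => (1 : k))
  μ X Y := TypeCat.ofHom (fun p => (p.1 : X) ⊗ₜ[k] (p.2 : Y))
  μ_natural_left _ _ := type_hom_ext fun _ => rfl
  μ_natural_right _ _ := type_hom_ext fun _ => rfl
  associativity _ _ _ := type_hom_ext fun _ => rfl
  left_unitality X := type_hom_ext fun p => (one_smul k (p.2 : X)).symm
  right_unitality X := type_hom_ext fun p => (one_smul k (p.1 : X)).symm
  braided _ _ := type_hom_ext fun _ => rfl

variable {k} in
-- The tensor product of free modules is free on the product of the bases. It reduces identities
-- about compositions in a span to operads in sets.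
theorem free_tensor_hom_ext {X Y : Type u} {V : ModuleCat.{u} k}
    {f g : (ModuleCat.free k).obj X ⊗ (ModuleCat.free k).obj Y ⟶ V}
    (h : ∀ x y, f (ModuleCat.freeMk x ⊗ₜ[k] ModuleCat.freeMk y) =
      g (ModuleCat.freeMk x ⊗ₜ[k] ModuleCat.freeMk y)) : f = g := by
  rw [← cancel_epi (ModuleCat.FreeMonoidal.μIso k X Y).inv]
  refine ModuleCat.free_hom_ext (R := k) fun p => ?_
  rw [ModuleCat.comp_apply, ModuleCat.comp_apply, ModuleCat.FreeMonoidal.μIso_inv_freeMk]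
  exact h _ _

theorem span_comp_freeMk {G : Type*} [Category G] [CutBase G] (P : ModularOperad G (Type u))
    {g' g'' g : ℕ} (hg : g' + g'' = g) (X Y : G) (u : El X) (v : El Y) (x : (P.obj g').obj X)
    (y : (P.obj g'').obj Y) :
    (spanMod k P).comp hg X Y u v (ModuleCat.freeMk x ⊗ₜ[k] ModuleCat.freeMk y) =
      ModuleCat.freeMk (P.comp hg X Y u v (x, y)) :=
  (congrArg _ (ModuleCat.free_μ_freeMk_tmul_freeMk k x y)).trans
    (ModuleCat.free_map_apply (P.comp hg X Y u v) (x, y))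

theorem spanCyc_comp_freeMk {G : Type*} [Category G] [MergeBase G] (P : CyclicOperad G (Type u))
    (X Y : G) (u : El X) (v : El Y) (x : P.obj.obj X) (y : P.obj.obj Y) :
    (spanCyc k P).comp X Y u v (ModuleCat.freeMk x ⊗ₜ[k] ModuleCat.freeMk y) =
      ModuleCat.freeMk (P.comp X Y u v (x, y)) :=
  (congrArg _ (ModuleCat.free_μ_freeMk_tmul_freeMk k x y)).trans
    (ModuleCat.free_map_apply (P.comp X Y u v) (x, y))

/-- The span of a cyclic operad is the free linear cyclic operad on it. -/
theorem isLeftAdjointValue_spanCyc {G : Type*} [Category G] [MergeBase G]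
    (P : CyclicOperad G (Type u)) :
    IsLeftAdjointValue (cycMapLax (forget (ModuleCat.{u} k)) G) P (spanCyc k P) := by
  let η : P ⟶ (cycMapLax (forget (ModuleCat.{u} k)) G).obj (spanCyc k P) :=
    { app :=
        { app := fun X => TypeCat.ofHom (fun x => ModuleCat.freeMk x)
          naturality := fun X Y φ => type_hom_ext fun x =>
            (ModuleCat.free_map_apply (P.obj.map φ) x).symm }
      app_comp := fun X Y u v => type_hom_ext fun p =>
        (spanCyc_comp_freeMk k P X Y u v p.1 p.2).symm }
  refine ⟨η, fun R f => ?_⟩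
  let f₀ : spanCyc k P ⟶ R :=
    { app :=
        { app := fun X => ModuleCat.freeDesc (f.app.app X)
          naturality := fun X Y φ => by
            refine ModuleCat.free_hom_ext (R := k) fun x => ?_
            refine (congrArg (ModuleCat.freeDesc (R := k) (f.app.app Y))
              (ModuleCat.free_map_apply (R := k) (P.obj.map φ) x)).trans ?_
            refine (ModuleCat.freeDesc_apply (R := k) _ _).trans ?_
            refine (nat_apply f.app φ x).trans ?_
            exact congrArg (R.obj.map φ) (ModuleCat.freeDesc_apply (R := k) _ x).symm }
      app_comp := fun X Y u v => by
        refine free_tensor_hom_ext fun x y => ?_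
        refine (congrArg (ModuleCat.freeDesc (R := k) (f.app.app (merge X Y u v)))
          (spanCyc_comp_freeMk k P X Y u v x y)).trans ?_
        refine (ModuleCat.freeDesc_apply (R := k) _ _).trans ?_
        refine (cycHom_comp_apply f X Y u v x y).trans ?_
        exact congrArg (R.comp X Y u v) (congrArg₂ (fun a b => a ⊗ₜ[k] b)
          (ModuleCat.freeDesc_apply (R := k) _ x).symm (ModuleCat.freeDesc_apply (R := k) _ y).symm) }
  refine ⟨f₀, ?_, fun f' hf => ?_⟩
  · refine CyclicOperad.Hom.ext (NatTrans.ext (funext fun X => type_hom_ext fun x => ?_))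
    exact ModuleCat.freeDesc_apply (R := k) _ x
  · refine CyclicOperad.Hom.ext (NatTrans.ext (funext fun X =>
      ModuleCat.free_hom_ext (R := k) fun x => ?_))
    refine Eq.trans ?_ (ModuleCat.freeDesc_apply (R := k) _ x).symm
    subst hf
    rfl

/-- The span of a modular operad is the free linear modular operad on it. -/
theorem isLeftAdjointValue_spanMod {G : Type*} [Category G] [CutBase G]
    (P : ModularOperad G (Type u)) :
    IsLeftAdjointValue (modMapLax (forget (ModuleCat.{u} k)) G) P (spanMod k P) := by
  let η : P ⟶ (modMapLax (forget (ModuleCat.{u} k)) G).obj (spanMod k P) :=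
    { app := fun g =>
        { app := fun X => TypeCat.ofHom (fun x => ModuleCat.freeMk x)
          naturality := fun X Y φ => type_hom_ext fun x =>
            (ModuleCat.free_map_apply ((P.obj g).map φ) x).symm }
      app_comp := fun hg X Y u v => type_hom_ext fun p =>
        (span_comp_freeMk k P hg X Y u v p.1 p.2).symm
      app_contr := fun g X u v h => type_hom_ext fun x =>
            (ModuleCat.free_map_apply (P.contr g X h) x).symm }
  refine ⟨η, fun R f => ?_⟩
  let f₀ : spanMod k P ⟶ R :=
    { app := fun g =>
        { app := fun X => ModuleCat.freeDesc ((f.app g).app X)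
          naturality := fun X Y φ => by
            refine ModuleCat.free_hom_ext (R := k) fun x => ?_
            refine (congrArg (ModuleCat.freeDesc (R := k) ((f.app g).app Y))
              (ModuleCat.free_map_apply (R := k) ((P.obj g).map φ) x)).trans ?_
            refine (ModuleCat.freeDesc_apply (R := k) _ _).trans ?_
            refine (nat_apply (f.app g) φ x).trans ?_
            exact congrArg ((R.obj g).map φ) (ModuleCat.freeDesc_apply (R := k) _ x).symm }
      app_comp := fun hg X Y u v => by
        refine free_tensor_hom_ext fun x y => ?_
        refine (congrArg (ModuleCat.freeDesc (R := k) ((f.app _).app (merge X Y u v)))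
          (span_comp_freeMk k P hg X Y u v x y)).trans ?_
        refine (ModuleCat.freeDesc_apply (R := k) _ _).trans ?_
        refine (modHom_comp_apply f hg X Y u v x y).trans ?_
        exact congrArg (R.comp hg X Y u v) (congrArg₂ (fun a b => a ⊗ₜ[k] b)
          (ModuleCat.freeDesc_apply (R := k) _ x).symm (ModuleCat.freeDesc_apply (R := k) _ y).symm)
      app_contr := fun g X u v h => by
        refine ModuleCat.free_hom_ext (R := k) fun x => ?_
        refine (congrArg (ModuleCat.freeDesc (R := k) ((f.app (g + 1)).app (cut X u v)))
          (ModuleCat.free_map_apply (R := k) (P.contr g X h) x)).trans ?_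
        refine (ModuleCat.freeDesc_apply (R := k) _ _).trans ?_
        refine (modHom_contr_apply f g X h x).trans ?_
        exact congrArg (R.contr g X h) (ModuleCat.freeDesc_apply (R := k) _ x).symm }
  refine ⟨f₀, ?_, fun f' hf => ?_⟩
  · refine ModularOperad.Hom.ext (funext fun g => NatTrans.ext (funext fun X =>
      type_hom_ext fun x => ?_))
    exact ModuleCat.freeDesc_apply (R := k) _ x
  · refine ModularOperad.Hom.ext (funext fun g => NatTrans.ext (funext fun X =>
      ModuleCat.free_hom_ext (R := k) fun x => ?_))
    refine Eq.trans ?_ (ModuleCat.freeDesc_apply (R := k) _ x).symm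
    subst hf
    rfl

/-- The universal property holds against all non-Σ modular operads, geometric or not, so it
restricts to the full subcategory of geometric ones. -/
theorem isLeftAdjointValue_nsBox :
    IsLeftAdjointValue (nsBox (ModuleCat.{u} k)) (nsAss k) (spanNsMod k starM) :=
  IsLeftAdjointValue.fullSubcategory (R := nsBoxAll (ModuleCat.{u} k))
    (.transfer (modMapLax_nsBoxAll (forget (ModuleCat.{u} k))) (isLeftAdjointValue_spanCyc k starC)
      (isLeftAdjointValue_spanMod k starM.obj) isLeftAdjointValue_nsBoxAll)

theorem isLeftAdjointValue_des_span :
    IsLeftAdjointValue (des (ModuleCat.{u} k)) (spanNsMod k starM).obj (spanMod k multOrders) :=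
  .transfer (modMapLax_des (forget (ModuleCat.{u} k))) (isLeftAdjointValue_spanMod k starM.obj)
    (isLeftAdjointValue_spanMod k multOrders) isLeftAdjointValue_des

theorem isLeftAdjointValue_box_ass :
    IsLeftAdjointValue (box (ModuleCat.{u} k)) (ass k) (spanMod k multOrders) :=
  .transfer (modMapLax_box (forget (ModuleCat.{u} k))) (isLeftAdjointValue_spanCyc k cycOrders)
    (isLeftAdjointValue_spanMod k multOrders) isLeftAdjointValue_box

/-! ### Components and structure operations of the span of the terminal operad. -/

theorem isZero_of_not_isGeometric (N : NsModOp (ModuleCat.{u} k)) {g : ℕ} {X : MultCyc}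
    (h : ¬ X.IsGeometric g) : Limits.IsZero ((N.obj.obj g).obj X) := by
  obtain ⟨i⟩ := N.property g X h
  exact i.isZero

/-- The component of the span of the terminal operad at a geometric pair. -/
def spanStarIso {g : ℕ} {X : MultCyc} (h : X.IsGeometric g) :
    ((spanMod k starM.obj).obj g).obj X ≅ 𝟙_ (ModuleCat.{u} k) where
  hom := ModuleCat.freeDesc (TypeCat.ofHom (fun _ => (1 : k)))
  inv := ModuleCat.ofHom (LinearMap.toSpanSingleton k _
    (ModuleCat.freeMk (R := k) (⟨⟨h⟩⟩ : (starM.obj.obj g).obj X)))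
  hom_inv_id := ModuleCat.free_hom_ext (R := k) fun x => by
    refine (congrArg (LinearMap.toSpanSingleton k _ _) (ModuleCat.freeDesc_apply (R := k) _ x)).trans ?_
    exact one_smul k _
  inv_hom_id := by
    refine ModuleCat.hom_ext (LinearMap.ext_ring ?_)
    refine (congrArg (ModuleCat.freeDesc (M := 𝟙_ (ModuleCat.{u} k))
      (TypeCat.ofHom (fun _ => (1 : k)))) (one_smul k _)).trans ?_
    exact ModuleCat.freeDesc_apply (R := k) _ _

theorem spanStarIso_freeMk {g : ℕ} {X : MultCyc} (h : X.IsGeometric g) (x : (starM.obj.obj g).obj X) :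
    (spanStarIso k h).hom (ModuleCat.freeMk x) = (1 : k) :=
  ModuleCat.freeDesc_apply (R := k) _ x

theorem spanStarIso_map {g : ℕ} {X Y : MultCyc} (f : X ⟶ Y) (h : X.IsGeometric g) :
    ((spanMod k starM.obj).obj g).map f ≫ (spanStarIso k (h.of_iso f)).hom =
      (spanStarIso k h).hom :=
  ModuleCat.free_hom_ext (R := k) fun x => (congrArg _ (ModuleCat.free_map_apply (R := k) _ x)).trans
    ((spanStarIso_freeMk k (h.of_iso f) _).trans (spanStarIso_freeMk k h x).symm)

theorem spanStarIso_contr {g : ℕ} {X : MultCyc} {u v : X.carrier} (huv : u ≠ v)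
    (h : X.IsGeometric g) :
    (spanMod k starM.obj).contr g X huv ≫ (spanStarIso k (h.cut huv)).hom =
      (spanStarIso k h).hom :=
  ModuleCat.free_hom_ext (R := k) fun x => (congrArg _ (ModuleCat.free_map_apply (R := k) _ x)).trans
    ((spanStarIso_freeMk k (h.cut huv) _).trans (spanStarIso_freeMk k h x).symm)

theorem spanStarIso_comp {g' g'' g : ℕ} (hg : g' + g'' = g) {X Y : MultCyc} (u : X.carrier)
    (v : Y.carrier) (h : X.IsGeometric g') (h' : Y.IsGeometric g'') :
    (spanMod k starM.obj).comp hg X Y u v ≫ (spanStarIso k (h.merge h' hg u v)).hom =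
      ((spanStarIso k h).hom ⊗ₘ (spanStarIso k h').hom) ≫ (λ_ (𝟙_ (ModuleCat.{u} k))).hom := by
  refine free_tensor_hom_ext fun x y => ?_
  refine (congrArg (spanStarIso k (h.merge h' hg u v)).hom
    (span_comp_freeMk k starM.obj hg X Y u v x y)).trans ?_
  refine (spanStarIso_freeMk k (h.merge h' hg u v) _).trans ?_
  refine Eq.trans ?_ (congrArg (λ_ (𝟙_ (ModuleCat.{u} k))).hom (congrArg₂ (fun a b => a ⊗ₜ[k] b)
    (spanStarIso_freeMk k h x).symm (spanStarIso_freeMk k h' y).symm))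
  exact (one_smul k (1 : k)).symm

/-- The components of an isomorphism of modular operads. -/
def modIsoApp {G : Type*} [Category G] [CutBase G] {M : Type*} [Category M] [MonoidalCategory M]
    [BraidedCategory M] {P Q : ModularOperad G M} (φ : P ≅ Q) (g : ℕ) (X : G) :
    (P.obj g).obj X ≅ (Q.obj g).obj X where
  hom := (φ.hom.app g).app X
  inv := (φ.inv.app g).app X
  hom_inv_id := congrArg (fun f : P ⟶ P => (f.app g).app X) φ.hom_inv_id
  inv_hom_id := congrArg (fun f : Q ⟶ Q => (f.app g).app X) φ.inv_hom_id

end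

end ModEnv
end

theorem mainTheorem2 (k : Type u) [CommRing k] :
    -- the terminal operads in the category of sets
    Nonempty (Limits.IsTerminal starC.{u}) ∧
    Nonempty (Limits.IsTerminal starM.{u}) ∧
    -- the span of the terminal operad is the modular envelope
    IsLeftAdjointValue (nsBox (ModuleCat.{u} k)) (nsAss k) (spanNsMod k starM) ∧
    (∀ Mod : NsCycOp (ModuleCat.{u} k) ⥤ NsModOp (ModuleCat.{u} k),
      Nonempty (Mod ⊣ nsBox (ModuleCat.{u} k)) →
        Nonempty (Mod.obj (nsAss k) ≅ spanNsMod k starM)) ∧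
    -- the components and the structure operations of a modular envelope
    (∀ N : NsModOp (ModuleCat.{u} k),
      IsLeftAdjointValue (nsBox (ModuleCat.{u} k)) (nsAss k) N →
      (∀ (g : ℕ) (X : MultCyc), ¬ X.IsGeometric g → Limits.IsZero ((N.obj.obj g).obj X)) ∧
      ∃ θ : ∀ (g : ℕ) (X : MultCyc), X.IsGeometric g →
          ((N.obj.obj g).obj X ≅ 𝟙_ (ModuleCat.{u} k)),
        (∀ (g : ℕ) (X Y : MultCyc) (f : X ⟶ Y) (hX : X.IsGeometric g),
          (N.obj.obj g).map f ≫ (θ g Y (hX.of_iso f)).hom = (θ g X hX).hom) ∧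
        (∀ (g' g'' g : ℕ) (hg : g' + g'' = g) (X Y : MultCyc) (u : X.carrier) (v : Y.carrier)
            (hX : X.IsGeometric g') (hY : Y.IsGeometric g''),
          N.obj.comp hg X Y u v ≫ (θ g (X.merge Y u v) (hX.merge hY hg u v)).hom =
            ((θ g' X hX).hom ⊗ₘ (θ g'' Y hY).hom) ≫ (λ_ (𝟙_ (ModuleCat.{u} k))).hom) ∧
        (∀ (g : ℕ) (X : MultCyc) (u v : X.carrier) (h : u ≠ v) (hX : X.IsGeometric g),
          N.obj.contr g X h ≫ (θ (g + 1) (X.cut u v) (hX.cut h)).hom = (θ g X hX).hom)) ∧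
    -- the symmetrization of the span of the terminal operad
    IsLeftAdjointValue (des (ModuleCat.{u} k)) (spanNsMod k starM).obj (spanMod k multOrders) ∧
    -- the modular envelope of the cyclic operad for associative algebras
    IsLeftAdjointValue (box (ModuleCat.{u} k)) (ass k) (spanMod k multOrders) ∧
    (∀ Mod : CycOp (ModuleCat.{u} k) ⥤ ModOp (ModuleCat.{u} k),
      Nonempty (Mod ⊣ box (ModuleCat.{u} k)) →
        Nonempty (Mod.obj (ass k) ≅ spanMod k multOrders)) := by
  refine ⟨starC_isTerminal, starM_isTerminal, isLeftAdjointValue_nsBox k, fun Mod ⟨adj⟩ => ?_,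
    fun N hN => ⟨fun g X h => isZero_of_not_isGeometric k N h, ?_⟩, isLeftAdjointValue_des_span k,
    isLeftAdjointValue_box_ass k, fun Mod ⟨adj⟩ => ?_⟩
  · exact (IsLeftAdjointValue.of_adjunction adj _).exists_iso (isLeftAdjointValue_nsBox k)
  · obtain ⟨φ⟩ := hN.exists_iso (isLeftAdjointValue_nsBox k)
    -- Any envelope is isomorphic to the span, so the trivializations of the components of the span
    -- are transported along this isomorphism.
    let ψ : N.obj ≅ spanMod k starM.obj := (ObjectProperty.ι (IsGeometricOperad (M := ModuleCat.{u} k))).mapIso φ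
    refine ⟨fun g X h => modIsoApp ψ g X ≪≫ spanStarIso k h, fun g X Y f hX => ?_,
      fun g' g'' g hg X Y u v hX hY => ?_, fun g X u v h hX => ?_⟩
    · rw [Iso.trans_hom, Iso.trans_hom, ← spanStarIso_map k f hX, ← Category.assoc,
        ← Category.assoc]
      exact congrArg (· ≫ _) ((ψ.hom.app g).naturality f)
    · rw [Iso.trans_hom, Iso.trans_hom, Iso.trans_hom, ← MonoidalCategory.tensorHom_comp_tensorHom,
        Category.assoc, ← spanStarIso_comp k hg u v hX hY, ← Category.assoc, ← Category.assoc]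
      exact congrArg (· ≫ _) (ψ.hom.app_comp hg X Y u v)
    · rw [Iso.trans_hom, Iso.trans_hom, ← spanStarIso_contr k h hX, ← Category.assoc,
        ← Category.assoc]
      exact congrArg (· ≫ _) (ψ.hom.app_contr g X h)
  · exact (IsLeftAdjointValue.of_adjunction adj _).exists_iso (isLeftAdjointValue_box_ass k)
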